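/- Let $U_\infty=\mathbb{C}^5$ with basis $e_1,\dots,e_5$, let $U_0=U_\infty^*$ with dual basis $e_{-1},\dots,e_{-5}$, and let $\mathrm{Std}=U_0\oplus U_\infty$ carry the quadratic form $Q(d,u)=d(u)$. The Clifford algebra $C(Q)$ (with $v\cdot v=Q(v)$) acts on $\Lambda U_\infty$, where $e_i$ acts by left wedging and $e_{-i}$ by contraction. The group $\operatorname{Spin}(10)\subset C(Q)$ acts on the half-spin space $S^+=\Lambda^{\mathrm{even}}U_\infty$, on $\Lambda^7S^+$ and on $\operatorname{Sym}(\Lambda^7S^+)$, and it acts on $\mathrm{Std}$ by $v\mapsto gvg^{-1}$. Let $T\subset\operatorname{Spin}(10)$ be the maximal torus of lifts of the diagonal torus. Let $L_1,\dots,L_5$ be the weights of $e_1,\dots,e_5$, let $\alpha_i=L_i-L_{i+1}$ $(1\le i\le 4)$ and $\alpha_5=L_4+L_5$ be the simple roots, and let $5\omega_1=5L_1$. In $\mathfrak{so}(10)=\operatorname{span}\{\tfrac12[a,b]: a,b\in \mathrm{Std}\}\subset C(Q)$ take the root vectors $X_{-\alpha_i}=e_{i+1}e_{-i}$ $(1\le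 i\le 4)$ and $X_{-\alpha_5}=e_{-5}e_{-4}$. For a sequence $I=(i_1,\dots,i_k)$ with entries in $\{1,\dots,5\}$ put $X_I=X_{-\alpha_{i_k}}\cdots X_{-\alpha_{i_1}}$. Let $V(5\omega_1)\subset\operatorname{Sym}^5\mathrm{Std}$ be the submodule generated by the highest weight vector $w=e_1^5$, and put $f_I=X_I.w$. With $e_{ij\cdots}=e_i\wedge e_j\wedge\cdots$, let $V_1,V_2\subset\Lambda^7S^+$ be the submodules generated by $$v_1=e_{12}\wedge e_{13}\wedge e_{1234}\wedge e_{1235}\wedge e_{1245}\wedge e_{1345}\wedge e_{2345},\qquad v_2=e_{12}\wedge e_{13}\wedge e_{14}\wedge e_{1234}\wedge e_{1235}\wedge e_{1245}\wedge e_{1345}.$$ **Proposition.** Both $\operatorname{Sym}^2V_1$ and $\operatorname{Sym}^2V_2$ contain highest weight vectors of weight $5\omega_1$. There are finite sets $A,B$ of sequences $I$, $J$ as above and rational numbers $c_{IJ}$ such that: 1. $(f_I)_{I\in A}$ and $(f_J)_{J\in B}$ are bases of $V(5\omega_1)$, and the tensors $f_I\otimes f_J$ with $I\in A$, $J\in B$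 of opposite weights form a basis of $(V(5\omega_1)\otimes V(5\omega_1))^T$. 2. For all highest weight vectors $w_1\in\operatorname{Sym}^2V_1$ and $w_2\in\operatorname{Sym}^2V_2$ of weight $5\omega_1$, the element $$F_{5\omega_1}=\sum_{I,J}c_{IJ}\,(X_I.w_1)\otimes(X_J.w_2),$$ where the sum runs over the pairs $(I,J)\in A\times B$ of opposite weights, lies in $\operatorname{Sym}^2V_1\otimes\operatorname{Sym}^2V_2$ and is $\operatorname{Spin}(10)$-invariant. Its image under multiplication is a nonzero $\operatorname{Spin}(10)$-invariant element of $\operatorname{Sym}^4\Lambda^7S^+$. -/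

import Mathlib

open scoped TensorProduct

noncomputable section

namespace SpinTen

/-! ### Induced maps and induced derivations on exterior powers and symmetric algebras -/

section Induced

variable {M : Type*} [AddCommGroup M] [Module ℂ M]

/-- `Λ(1 + ε f)`. -/
def extLift (f : M →ₗ[ℂ] M) : ExteriorAlgebra ℂ M →ₐ[ℂ] DualNumber (ExteriorAlgebra ℂ M) :=
  ExteriorAlgebra.lift ℂ
    ⟨(TrivSqZeroExt.inlAlgHom ℂ (ExteriorAlgebra ℂ M) (ExteriorAlgebra ℂ M)).toLinearMap ∘ₗ
        ExteriorAlgebra.ι ℂ +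
      (TrivSqZeroExt.inrHom (ExteriorAlgebra ℂ M) (ExteriorAlgebra ℂ M)).restrictScalars ℂ ∘ₗ
        ExteriorAlgebra.ι ℂ ∘ₗ f, fun m => by
      ext
      · simp
      · simp [ExteriorAlgebra.ι_add_mul_swap]⟩

/-- The derivation of the exterior algebra `Λ M` extending `f : M → M`, the `ε`-part of
`Λ(1 + ε f)`. -/
def extDerAux (f : M →ₗ[ℂ] M) : ExteriorAlgebra ℂ M →ₗ[ℂ] ExteriorAlgebra ℂ M :=
  (TrivSqZeroExt.sndHom (ExteriorAlgebra ℂ M) (ExteriorAlgebra ℂ M)).restrictScalars ℂ ∘ₗ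
    (extLift f).toLinearMap

theorem extLift_fst (f : M →ₗ[ℂ] M) (x : ExteriorAlgebra ℂ M) : (extLift f x).fst = x := by
  have h : (TrivSqZeroExt.fstHom ℂ (ExteriorAlgebra ℂ M) (ExteriorAlgebra ℂ M)).comp (extLift f)
      = AlgHom.id ℂ _ := by
    ext m
    simp [extLift]
  exact DFunLike.congr_fun h x

theorem extDerAux_ι (f : M →ₗ[ℂ] M) (m : M) :
    extDerAux f (ExteriorAlgebra.ι ℂ m) = ExteriorAlgebra.ι ℂ (f m) := by
  simp [extDerAux, extLift]

theorem extDerAux_mul (f : M →ₗ[ℂ] M) (x y : ExteriorAlgebra ℂ M) :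
    extDerAux f (x * y) = x * extDerAux f y + extDerAux f x * y := by
  simp [extDerAux, extLift_fst]

theorem extDerAux_mem (f : M →ₗ[ℂ] M) (n : ℕ) :
    ∀ x ∈ (⋀[ℂ]^n M : Submodule ℂ (ExteriorAlgebra ℂ M)), extDerAux f x ∈ ⋀[ℂ]^n M := by
  induction n with
  | zero =>
    intro x hx
    rw [ExteriorAlgebra.exteriorPower, pow_zero] at hx
    obtain ⟨r, rfl⟩ := Submodule.mem_one.mp hx
    have h1 : extDerAux f (1 : ExteriorAlgebra ℂ M) = 0 := by simp [extDerAux]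
    rw [Algebra.algebraMap_eq_smul_one, map_smul, h1, smul_zero]
    exact Submodule.zero_mem _
  | succ n ih =>
    intro x hx
    rw [ExteriorAlgebra.exteriorPower, pow_succ] at hx ⊢
    refine Submodule.mul_induction_on hx ?_ ?_
    · rintro a ha _ ⟨m, rfl⟩
      rw [extDerAux_mul, extDerAux_ι]
      exact Submodule.add_mem _ (Submodule.mul_mem_mul ha ⟨_, rfl⟩)
        (Submodule.mul_mem_mul (ih a ha) ⟨_, rfl⟩)
    · intro a b ha hb
      rw [map_add]
      exact Submodule.add_mem _ ha hb

/-- The derivation `x₁ ∧ ⋯ ∧ xₙ ↦ ∑ᵢ x₁ ∧ ⋯ ∧ f xᵢ ∧ ⋯ ∧ xₙ` of `Λⁿ M` induced by `f`. -/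
def extDer (n : ℕ) (f : Module.End ℂ M) : Module.End ℂ (⋀[ℂ]^n M) :=
  (extDerAux f).restrict (extDerAux_mem f n)

/-- The algebra endomorphism of `Sym M` induced by `f : M → M`. -/
def symMap (f : Module.End ℂ M) : SymmetricAlgebra ℂ M →ₐ[ℂ] SymmetricAlgebra ℂ M :=
  SymmetricAlgebra.lift (SymmetricAlgebra.ι ℂ M ∘ₗ f)

/-- `Sym(1 + ε f)`. -/
def symLift (f : Module.End ℂ M) :
    SymmetricAlgebra ℂ M →ₐ[ℂ] DualNumber (SymmetricAlgebra ℂ M) :=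
  SymmetricAlgebra.lift
    ((TrivSqZeroExt.inlAlgHom ℂ (SymmetricAlgebra ℂ M) (SymmetricAlgebra ℂ M)).toLinearMap ∘ₗ
        SymmetricAlgebra.ι ℂ M +
      (TrivSqZeroExt.inrHom (SymmetricAlgebra ℂ M) (SymmetricAlgebra ℂ M)).restrictScalars ℂ ∘ₗ
        SymmetricAlgebra.ι ℂ M ∘ₗ f)

/-- The derivation of `Sym M` extending `f : M → M`, the `ε`-part of `Sym(1 + ε f)`. -/
def symDer (f : Module.End ℂ M) : Module.End ℂ (SymmetricAlgebra ℂ M) :=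
  (TrivSqZeroExt.sndHom (SymmetricAlgebra ℂ M) (SymmetricAlgebra ℂ M)).restrictScalars ℂ ∘ₗ
    (symLift f).toLinearMap

theorem symLift_fst (f : Module.End ℂ M) (x : SymmetricAlgebra ℂ M) : (symLift f x).fst = x := by
  have h : (TrivSqZeroExt.fstHom ℂ (SymmetricAlgebra ℂ M) (SymmetricAlgebra ℂ M)).comp (symLift f)
      = AlgHom.id ℂ _ := by
    ext m
    simp [symLift]
  exact DFunLike.congr_fun h x

theorem symDer_ι (f : Module.End ℂ M) (m : M) :
    symDer f (SymmetricAlgebra.ι ℂ M m) = SymmetricAlgebra.ι ℂ M (f m) := by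
  simp [symDer, symLift]

theorem symDer_mul (f : Module.End ℂ M) (x y : SymmetricAlgebra ℂ M) :
    symDer f (x * y) = x * symDer f y + symDer f x * y := by
  simp [symDer, symLift_fst]

/-- `Symⁿ N` inside `Sym M`, for a subspace `N` of `M`. -/
def symPow (n : ℕ) (N : Submodule ℂ M) : Submodule ℂ (SymmetricAlgebra ℂ M) :=
  (N.map (SymmetricAlgebra.ι ℂ M)) ^ n

end Induced

/-! ### The quadratic space, the spin group, and its representations -/

/-- The Lagrangian `U_∞`. -/
abbrev U : Type := Fin 5 → ℂ

/-- The `10`-dimensional space `U₀ ⊕ U_∞`, with `U₀` the dual of `U_∞`. -/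
abbrev Std : Type := Module.Dual ℂ U × U

/-- The quadratic form `Q(d, u) = d u`. -/
abbrev Q : QuadraticForm ℂ Std := QuadraticForm.dualProd ℂ U

/-- `Spin(10)`. -/
abbrev Spin : Type := spinGroup Q

/-- The basis `e₁, …, e₅` of `U_∞` (indexed by `0, …, 4`). -/
def e (i : Fin 5) : Std := (0, Pi.single i 1)

/-- The dual basis `e₋₁, …, e₋₅` of `U₀` (indexed by `0, …, 4`). -/
def em (i : Fin 5) : Std := (LinearMap.proj i, 0)

/-- The action `φ` of the Clifford algebra on `Λ U_∞`: elements of `U_∞` act by left wedging,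
elements of `U₀` by contraction. -/
def spinor : CliffordAlgebra Q →ₐ[ℂ] Module.End ℂ (ExteriorAlgebra ℂ U) :=
  CliffordAlgebra.lift Q
    ⟨LinearMap.coprod (CliffordAlgebra.contractLeft (Q := (0 : QuadraticForm ℂ U)))
      (LinearMap.mul ℂ (ExteriorAlgebra ℂ U) ∘ₗ ExteriorAlgebra.ι ℂ), fun m => by
      obtain ⟨d, u⟩ := m
      refine LinearMap.ext fun x => ?_
      have h1 : CliffordAlgebra.contractLeft (Q := (0 : QuadraticForm ℂ U)) d
          (ExteriorAlgebra.ι ℂ u * x) = d u • x - ExteriorAlgebra.ι ℂ u *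
            CliffordAlgebra.contractLeft (Q := (0 : QuadraticForm ℂ U)) d x :=
        CliffordAlgebra.contractLeft_ι_mul _ _ _
      have h2 : ExteriorAlgebra.ι ℂ u * (ExteriorAlgebra.ι ℂ u * x) = 0 := by
        rw [← mul_assoc, ExteriorAlgebra.ι_sq_zero, zero_mul]
      have h3 := CliffordAlgebra.contractLeft_contractLeft (Q := (0 : QuadraticForm ℂ U)) d x
      simp [Module.End.mul_apply, h1, h2, h3, mul_add, Algebra.algebraMap_eq_smul_one]⟩

/-- The half-spin space `S⁺ = Λ^even U_∞`. -/
def Splus : Submodule ℂ (ExteriorAlgebra ℂ U) :=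
  CliffordAlgebra.evenOdd (0 : QuadraticForm ℂ U) 0

theorem contract_mem (d : Module.Dual ℂ U) (k : ZMod 2) (x : ExteriorAlgebra ℂ U)
    (hx : x ∈ CliffordAlgebra.evenOdd (0 : QuadraticForm ℂ U) k) :
    CliffordAlgebra.contractLeft (Q := (0 : QuadraticForm ℂ U)) d x ∈
      CliffordAlgebra.evenOdd (0 : QuadraticForm ℂ U) (k + 1) := by
  have key : ∀ (n : ℕ), ∀ x ∈ LinearMap.range (CliffordAlgebra.ι (0 : QuadraticForm ℂ U)) ^ n,
      CliffordAlgebra.contractLeft (Q := (0 : QuadraticForm ℂ U)) d x ∈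
        CliffordAlgebra.evenOdd (0 : QuadraticForm ℂ U) ((n : ZMod 2) + 1) := by
    intro n
    induction n with
    | zero =>
      intro x hx
      rw [pow_zero] at hx
      obtain ⟨r, rfl⟩ := Submodule.mem_one.mp hx
      rw [CliffordAlgebra.contractLeft_algebraMap]
      exact Submodule.zero_mem _
    | succ n ih =>
      intro x hx
      rw [pow_succ'] at hx
      refine Submodule.mul_induction_on hx ?_ ?_
      · rintro _ ⟨m, rfl⟩ b hb
        rw [CliffordAlgebra.contractLeft_ι_mul]
        have e1 : (((n + 1 : ℕ) : ZMod 2) + 1) = (n : ZMod 2) := by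
          push_cast
          rw [add_assoc, show (1 + 1 : ZMod 2) = 0 from rfl, add_zero]
        rw [e1]
        refine Submodule.sub_mem _ (Submodule.smul_mem _ _ ?_) ?_
        · exact Submodule.mem_iSup_of_mem (p := fun j : {m : ℕ // (m : ZMod 2) = (n : ZMod 2)} =>
            LinearMap.range (CliffordAlgebra.ι (0 : QuadraticForm ℂ U)) ^ (j : ℕ)) ⟨n, rfl⟩ hb
        · have h := CliffordAlgebra.evenOdd_mul_le (0 : QuadraticForm ℂ U) 1 ((n : ZMod 2) + 1)
            (Submodule.mul_mem_mul (CliffordAlgebra.ι_mem_evenOdd_one _ m) (ih b hb))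
          rwa [show (1 + ((n : ZMod 2) + 1)) = (n : ZMod 2) by
            rw [add_comm, add_assoc, show (1 + 1 : ZMod 2) = 0 from rfl, add_zero]] at h
      · intro a b ha hb
        rw [map_add]
        exact Submodule.add_mem _ ha hb
  have hle : CliffordAlgebra.evenOdd (0 : QuadraticForm ℂ U) k ≤
      (CliffordAlgebra.evenOdd (0 : QuadraticForm ℂ U) (k + 1)).comap
        (CliffordAlgebra.contractLeft (Q := (0 : QuadraticForm ℂ U)) d) := by
    refine iSup_le ?_
    rintro ⟨n, rfl⟩ x hx
    exact key n x hx
  exact hle hx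

theorem spinor_ι_mem (m : Std) (k : ZMod 2) (x : ExteriorAlgebra ℂ U)
    (hx : x ∈ CliffordAlgebra.evenOdd (0 : QuadraticForm ℂ U) k) :
    spinor (CliffordAlgebra.ι Q m) x ∈ CliffordAlgebra.evenOdd (0 : QuadraticForm ℂ U) (k + 1) := by
  obtain ⟨d, u⟩ := m
  have h1 : spinor (CliffordAlgebra.ι Q (d, u)) x =
      CliffordAlgebra.contractLeft (Q := (0 : QuadraticForm ℂ U)) d x +
        ExteriorAlgebra.ι ℂ u * x := by
    simp [spinor]
  rw [h1]
  refine Submodule.add_mem _ (contract_mem d k x hx) ?_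
  rw [add_comm]
  exact CliffordAlgebra.evenOdd_mul_le (0 : QuadraticForm ℂ U) 1 k
    (Submodule.mul_mem_mul (CliffordAlgebra.ι_mem_evenOdd_one _ u) hx)

theorem spinor_mem (c : CliffordAlgebra.even Q) (x : ExteriorAlgebra ℂ U) (hx : x ∈ Splus) :
    spinor (c : CliffordAlgebra Q) x ∈ Splus := by
  obtain ⟨c, hc⟩ := c
  have key : ∀ y ∈ Splus, spinor c y ∈ Splus := by
    refine CliffordAlgebra.even_induction Q (motive := fun c _ => ∀ y ∈ Splus, spinor c y ∈ Splus)
      ?_ ?_ ?_ c hc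
    · intro r y hy
      rw [AlgHom.commutes]
      exact Submodule.smul_mem _ r hy
    · intro a b _ _ ha hb y hy
      rw [map_add]
      exact Submodule.add_mem _ (ha y hy) (hb y hy)
    · intro m₁ m₂ a _ ha y hy
      rw [map_mul, map_mul]
      exact spinor_ι_mem m₁ 1 _ (spinor_ι_mem m₂ 0 _ (ha y hy))
  exact key x hx

/-- The action of the even Clifford algebra on `S⁺`. -/
def spinorPlus : CliffordAlgebra.even Q →ₐ[ℂ] Module.End ℂ Splus where
  toFun c := (spinor (c : CliffordAlgebra Q)).restrict (spinor_mem c)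
  map_one' := by ext; simp
  map_mul' a b := by ext; simp
  map_zero' := by ext; simp
  map_add' a b := by ext; simp
  commutes' r := by ext; simp

/-- The half-spin representation of `Spin(10)` on `S⁺`. -/
def spinRep : Representation ℂ Spin Splus where
  toFun g := spinorPlus ⟨g, spinGroup.mem_even g.2⟩
  map_one' := map_one spinorPlus
  map_mul' a b := map_mul spinorPlus ⟨a, spinGroup.mem_even a.2⟩ ⟨b, spinGroup.mem_even b.2⟩

theorem ι_injective : Function.Injective (CliffordAlgebra.ι Q) := by
  intro a b hab
  have h := congrArg (CliffordAlgebra.equivExterior Q) hab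
  simpa [CliffordAlgebra.equivExterior, CliffordAlgebra.changeForm_ι] using h

theorem conj_mem (g : Spin) (v : Std) :
    (g : CliffordAlgebra Q) * CliffordAlgebra.ι Q v * ((g⁻¹ : Spin) : CliffordAlgebra Q) ∈
      LinearMap.range (CliffordAlgebra.ι Q) := by
  have h := spinGroup.conjAct_smul_ι_mem_range_ι (x := spinGroup.toUnits g) (by simp) v
  rwa [ConjAct.units_smul_def, ConjAct.ofConjAct_toConjAct] at h

/-- The map `v ↦ g v g⁻¹` on `Std ⊂ C(Q)`. -/
def vecMap (g : Spin) : Module.End ℂ Std :=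
  (LinearEquiv.ofInjective (CliffordAlgebra.ι Q) ι_injective).symm.toLinearMap ∘ₗ
    LinearMap.codRestrict (LinearMap.range (CliffordAlgebra.ι Q))
      (LinearMap.mulLeftRight ℂ ((g : CliffordAlgebra Q), ((g⁻¹ : Spin) : CliffordAlgebra Q)) ∘ₗ
        CliffordAlgebra.ι Q) (conj_mem g)

theorem ι_vecMap (g : Spin) (v : Std) :
    CliffordAlgebra.ι Q (vecMap g v) =
      (g : CliffordAlgebra Q) * CliffordAlgebra.ι Q v * ((g⁻¹ : Spin) : CliffordAlgebra Q) := by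
  have h := LinearEquiv.ofInjective_symm_apply (f := CliffordAlgebra.ι Q) (h := ι_injective)
    ⟨_, conj_mem g v⟩
  exact h

/-- The vector representation of `Spin(10)` on the standard representation. -/
def vecRep : Representation ℂ Spin Std where
  toFun := vecMap
  map_one' := by
    refine LinearMap.ext fun v => ι_injective ?_
    rw [ι_vecMap]
    simp
  map_mul' a b := by
    refine LinearMap.ext fun v => ι_injective ?_
    rw [Module.End.mul_apply, ι_vecMap, ι_vecMap, ι_vecMap]
    simp only [mul_inv_rev, Submonoid.coe_mul, mul_assoc]

theorem diag_mul {a b : Spin} {v : Std} (ha : ∃ t : ℂ, vecRep a v = t • v)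
    (hb : ∃ t : ℂ, vecRep b v = t • v) : ∃ t : ℂ, vecRep (a * b) v = t • v := by
  obtain ⟨s, hs⟩ := ha
  obtain ⟨t, ht⟩ := hb
  exact ⟨t * s, by rw [map_mul, Module.End.mul_apply, ht, map_smul, hs, smul_smul]⟩

theorem diag_inv {a : Spin} {v : Std} (ha : ∃ t : ℂ, vecRep a v = t • v) :
    ∃ t : ℂ, vecRep a⁻¹ v = t • v := by
  obtain ⟨s, hs⟩ := ha
  have h : v = s • vecRep a⁻¹ v := by
    rw [← map_smul, ← hs, ← Module.End.mul_apply, ← map_mul, inv_mul_cancel, map_one,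
      Module.End.one_apply]
  by_cases h0 : s = 0
  · have hv : v = 0 := by rw [h, h0, zero_smul]
    exact ⟨0, by rw [hv, map_zero, smul_zero]⟩
  · exact ⟨s⁻¹, by rw [eq_inv_smul_iff₀ h0, ← h]⟩

/-- The maximal torus `T ⊂ Spin(10)`: the lifts of the diagonal maximal torus of `SO(10)` with
respect to the basis `e₁, …, e₅, e₋₁, …, e₋₅`. -/
def torus : Subgroup Spin where
  carrier := {g | ∀ i, (∃ t : ℂ, vecRep g (e i) = t • e i) ∧ ∃ t : ℂ, vecRep g (em i) = t • em i}
  one_mem' := fun i => ⟨⟨1, by simp⟩, ⟨1, by simp⟩⟩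
  mul_mem' := fun ha hb i => ⟨diag_mul (ha i).1 (hb i).1, diag_mul (ha i).2 (hb i).2⟩
  inv_mem' := fun ha i => ⟨diag_inv (ha i).1, diag_inv (ha i).2⟩

/-! ### The Lie algebra `𝔰𝔬(10) = 𝔰𝔭𝔦𝔫(10)`

It is the span of the elements `[a, b] / 2` of the Clifford algebra, `a, b ∈ Std`, under the
commutator. An action of it on a space `M` is recorded as the operators `act a b` by which these
elements act on `M`. -/

/-- The element `[a, b] / 2` of the even Clifford algebra. -/
def bivector (a b : Std) : CliffordAlgebra.even Q :=
  (2⁻¹ : ℂ) • ((CliffordAlgebra.even.ι Q).bilin a b - (CliffordAlgebra.even.ι Q).bilin b a)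

/-- The action of `[a, b] / 2` on the standard representation, `v ↦ B(b,v) a - B(a,v) b`. -/
def stdAct (a b : Std) : Module.End ℂ Std :=
  (QuadraticMap.polarBilin Q b).smulRight a - (QuadraticMap.polarBilin Q a).smulRight b

theorem ι_mul_commutator (a b v : Std) :
    CliffordAlgebra.ι Q a * CliffordAlgebra.ι Q b * CliffordAlgebra.ι Q v -
      CliffordAlgebra.ι Q v * (CliffordAlgebra.ι Q a * CliffordAlgebra.ι Q b) =
        CliffordAlgebra.ι Q (stdAct a b v) := by
  have hb := CliffordAlgebra.ι_mul_ι_add_swap (Q := Q) b v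
  have ha := CliffordAlgebra.ι_mul_ι_add_swap (Q := Q) a v
  have h1 : CliffordAlgebra.ι Q (stdAct a b v) =
      CliffordAlgebra.ι Q a * algebraMap ℂ _ (QuadraticMap.polar Q b v) -
        algebraMap ℂ _ (QuadraticMap.polar Q a v) * CliffordAlgebra.ι Q b := by
    rw [← Algebra.commutes]
    simp [stdAct, Algebra.smul_def]
  rw [h1, ← ha, ← hb]
  noncomm_ring

/-- `stdAct` is the commutator action. -/
theorem bivector_commutator (a b v : Std) :
    (bivector a b : CliffordAlgebra Q) * CliffordAlgebra.ι Q v -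
      CliffordAlgebra.ι Q v * (bivector a b : CliffordAlgebra Q) =
        CliffordAlgebra.ι Q (stdAct a b v) := by
  have h1 := ι_mul_commutator a b v
  have h2 := ι_mul_commutator b a v
  have h3 : stdAct b a v = - stdAct a b v := by simp [stdAct]
  have h4 : (bivector a b : CliffordAlgebra Q) = (2⁻¹ : ℂ) •
      (CliffordAlgebra.ι Q a * CliffordAlgebra.ι Q b -
        CliffordAlgebra.ι Q b * CliffordAlgebra.ι Q a) := rfl
  rw [h3, map_neg] at h2
  have h5 : CliffordAlgebra.ι Q (stdAct a b v) = (2⁻¹ : ℂ) •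
      (CliffordAlgebra.ι Q (stdAct a b v) - -CliffordAlgebra.ι Q (stdAct a b v)) := by
    rw [sub_neg_eq_add, ← two_smul ℂ, smul_smul]
    norm_num
  rw [h4, h5, ← h2, ← h1, smul_mul_assoc, mul_smul_comm, ← smul_sub]
  congr 1
  noncomm_ring

/-- The action of `[a, b] / 2` on `S⁺`. -/
def spinAct (a b : Std) : Module.End ℂ Splus := spinorPlus (bivector a b)

section Action

variable {M : Type*} [AddCommGroup M] [Module ℂ M] (act : Std → Std → Module.End ℂ M)

/-- The `i`-th coordinate `Hᵢ` of the diagonal Cartan subalgebra; it acts on `eᵢ` by `1` and on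
`e₋ᵢ` by `-1`. -/
def cartan (i : Fin 5) : Module.End ℂ M := act (e i) (em i)

/-- The root vectors `X_{αᵢ}` of the simple roots `Lᵢ - Lᵢ₊₁` (`i ≤ 4`) and `L₄ + L₅`. -/
def raising (i : Fin 5) : Module.End ℂ M :=
  ![act (e 0) (em 1), act (e 1) (em 2), act (e 2) (em 3), act (e 3) (em 4), act (e 3) (e 4)] i

/-- The root vectors `X_{-αᵢ}` of the negatives of the simple roots. -/
def lowering (i : Fin 5) : Module.End ℂ M :=
  ![act (e 1) (em 0), act (e 2) (em 1), act (e 3) (em 2), act (e 4) (em 3), act (em 4) (em 3)] i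

/-- `X_{-α_{i_k}} ⋯ X_{-α_{i_1}} w` for the sequence `I = [i_1, …, i_k]`. -/
def lowerSeq (I : List (Fin 5)) (w : M) : M := I.foldl (fun x i => lowering act i x) w

/-- `w` is a highest weight vector of weight `∑ᵢ lam i • Lᵢ`. -/
def IsHighestWeightVector (lam : Fin 5 → ℤ) (w : M) : Prop :=
  w ≠ 0 ∧ (∀ i, raising act i w = 0) ∧ ∀ i, cartan act i w = (lam i : ℂ) • w

/-- The submodule generated by `w`: the smallest subspace that contains `w` and is stable under
the Lie algebra. -/
def generated (w : M) : Submodule ℂ M :=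
  sInf {N | w ∈ N ∧ ∀ a b, ∀ x ∈ N, act a b x ∈ N}

end Action

/-- The simple roots in the coordinates `L₁, …, L₅`. -/
def simpleRoot : Fin 5 → Fin 5 → ℤ :=
  ![![1, -1, 0, 0, 0], ![0, 1, -1, 0, 0], ![0, 0, 1, -1, 0], ![0, 0, 0, 1, -1], ![0, 0, 0, 1, 1]]

/-- The weight `5ω₁ = 5L₁`. -/
def fiveOmega : Fin 5 → ℤ := ![5, 0, 0, 0, 0]

/-- The weight of `lowerSeq I w` when `w` has weight `5ω₁`. -/
def seqWeight (I : List (Fin 5)) : Fin 5 → ℤ := fiveOmega - (I.map simpleRoot).sum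

/-- The pairs in `A × B` of sequences of opposite weight. -/
def oppositePairs (A B : Finset (List (Fin 5))) : Finset (List (Fin 5) × List (Fin 5)) :=
  (A ×ˢ B).filter fun p => seqWeight p.1 + seqWeight p.2 = 0

/-! ### `V(5ω₁)` inside `Sym⁵ Std` -/

/-- The action of the Lie algebra on `Sym Std`. -/
def symStdAct (a b : Std) : Module.End ℂ (SymmetricAlgebra ℂ Std) := symDer (stdAct a b)

/-- The highest weight vector `e₁⁵` of `Sym⁵ Std`. -/
def hwStd : SymmetricAlgebra ℂ Std := SymmetricAlgebra.ι ℂ Std (e 0) ^ 5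

/-- `V(5ω₁) ⊂ Sym⁵ Std`. -/
def VFive : Submodule ℂ (SymmetricAlgebra ℂ Std) := generated symStdAct hwStd

/-- The basis elements `f_I = X_{-α_{i_k}} ⋯ X_{-α_{i_1}} e₁⁵`. -/
def fvec (I : List (Fin 5)) : SymmetricAlgebra ℂ Std := lowerSeq symStdAct I hwStd

/-- `(V(5ω₁) ⊗ V(5ω₁))^T`, as a subspace of `Sym Std ⊗ Sym Std`. -/
def torusInvariants : Submodule ℂ (SymmetricAlgebra ℂ Std ⊗[ℂ] SymmetricAlgebra ℂ Std) :=
  LinearMap.range (TensorProduct.mapIncl VFive VFive) ⊓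
    ⨅ g ∈ torus, LinearMap.ker
      (TensorProduct.map (symMap (vecRep g)).toLinearMap (symMap (vecRep g)).toLinearMap -
        LinearMap.id)

/-! ### `Λ⁷ S⁺`, its submodules `V₁`, `V₂`, and `Sym(Λ⁷ S⁺)` -/

/-- `Λ⁷ S⁺`. -/
abbrev LSeven : Type := ⋀[ℂ]^7 Splus

/-- The action of the Lie algebra on `Λ⁷ S⁺`. -/
def lambdaAct (a b : Std) : Module.End ℂ LSeven := extDer 7 (spinAct a b)

/-- The representation of `Spin(10)` on `Λ⁷ S⁺`. -/
def lambdaRep (g : Spin) : Module.End ℂ LSeven := exteriorPower.map 7 (spinRep g)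

/-- `eᵢ ∧ eⱼ ∈ S⁺`. -/
def s2 (i j : Fin 5) : Splus :=
  ⟨ExteriorAlgebra.ι ℂ (Pi.single i 1) * ExteriorAlgebra.ι ℂ (Pi.single j 1),
    CliffordAlgebra.ι_mul_ι_mem_evenOdd_zero _ _ _⟩

/-- `eᵢ ∧ eⱼ ∧ eₖ ∧ eₗ ∈ S⁺`. -/
def s4 (i j k l : Fin 5) : Splus :=
  ⟨(s2 i j : ExteriorAlgebra ℂ U) * (s2 k l : ExteriorAlgebra ℂ U), by
    have h := CliffordAlgebra.evenOdd_mul_le (0 : QuadraticForm ℂ U) 0 0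
      (Submodule.mul_mem_mul (s2 i j).2 (s2 k l).2)
    exact h⟩

/-- The highest weight vector
`v₁ = e₁₂ ∧ e₁₃ ∧ e₁₂₃₄ ∧ e₁₂₃₅ ∧ e₁₂₄₅ ∧ e₁₃₄₅ ∧ e₂₃₄₅` of `Λ⁷ S⁺`. -/
def v₁ : LSeven := exteriorPower.ιMulti ℂ 7
  ![s2 0 1, s2 0 2, s4 0 1 2 3, s4 0 1 2 4, s4 0 1 3 4, s4 0 2 3 4, s4 1 2 3 4]

/-- The highest weight vector
`v₂ = e₁₂ ∧ e₁₃ ∧ e₁₄ ∧ e₁₂₃₄ ∧ e₁₂₃₅ ∧ e₁₂₄₅ ∧ e₁₃₄₅` of `Λ⁷ S⁺`. -/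
def v₂ : LSeven := exteriorPower.ιMulti ℂ 7
  ![s2 0 1, s2 0 2, s2 0 3, s4 0 1 2 3, s4 0 1 2 4, s4 0 1 3 4, s4 0 2 3 4]

/-- `V₁ ⊂ Λ⁷ S⁺`, of highest weight `(1,0,1,0,1)`. -/
def V₁ : Submodule ℂ LSeven := generated lambdaAct v₁

/-- `V₂ ⊂ Λ⁷ S⁺`, of highest weight `(3,0,0,1,0)`. -/
def V₂ : Submodule ℂ LSeven := generated lambdaAct v₂

/-- `Sym(Λ⁷ S⁺)`. -/
abbrev SymL : Type := SymmetricAlgebra ℂ LSeven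

/-- The action of the Lie algebra on `Sym(Λ⁷ S⁺)`. -/
def symLAct (a b : Std) : Module.End ℂ SymL := symDer (lambdaAct a b)

/-- The action of `Spin(10)` on `Sym(Λ⁷ S⁺)`. -/
def symLRep (g : Spin) : SymL →ₐ[ℂ] SymL := symMap (lambdaRep g)

/-- The combination `∑ c_{IJ} (X_{-α_{i_k}} ⋯ X_{-α_{i_1}} w₁) ⊗ (X_{-α_{j_l}} ⋯ X_{-α_{j_1}} w₂)`
over the pairs `(I, J)` in `P`. -/
def Ften (P : Finset (List (Fin 5) × List (Fin 5))) (c : List (Fin 5) → List (Fin 5) → ℚ)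
    (w₁ w₂ : SymL) : SymL ⊗[ℂ] SymL :=
  ∑ p ∈ P, (c p.1 p.2 : ℂ) • (lowerSeq symLAct p.1 w₁ ⊗ₜ[ℂ] lowerSeq symLAct p.2 w₂)

/-- The image of `Ften` under the multiplication `Sym²V₁ ⊗ Sym²V₂ → Sym⁴(Λ⁷ S⁺)`. -/
def Fpoly (P : Finset (List (Fin 5) × List (Fin 5))) (c : List (Fin 5) → List (Fin 5) → ℚ)
    (w₁ w₂ : SymL) : SymL :=
  LinearMap.mul' ℂ SymL (Ften P c w₁ w₂)

end SpinTen

end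

/-! The module V = V(5ω₁) is self-dual, and an invariant tensor in V ⊗ V is given, in any basis, by
the inverse of the Gram matrix of an invariant form on V. The basis is taken among the vectors f_I.
Its Gram matrix is rational, because its entries come from commuting raising operators past lowering
ones, so the entries of the inverse can serve as the c_{IJ} (`hwGram`, `invCoeff`), with A = B.
Invariance under the Cartan subalgebra forces c_{IJ} = 0 unless I and J have opposite weights.

The same coefficients work for w₁ and w₂ because highest weight vectors of equal weight satisfy the
same linear relations between their words in the lowering operators (`exists_transport`). The reason
is unitarity rather than complete reducibility: each module that occurs has coordinates in which
X_{-α} is a real matrix and X_α its transpose (`Frame`). For Std and S⁺ these are the standard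
bases, and iterated contraction passes them on to exterior and symmetric powers. The resulting
Hermitian form is positive definite, and the product of two words is a number fixed by the highest
weight (`wordForm`) times ⟨w, w⟩. A combination of words is zero exactly when its norm is, so the
highest weight decides which combinations vanish. The form also makes V₁ and V₂ orthogonal, as their
highest weights differ; hence V₁ ∩ V₂ = 0, and multiplication is injective on Sym²V₁ ⊗ Sym²V₂
(`mul'_ne_zero`).

Existence of w₁ and w₂ is a dual statement. A bilinear form L on Λ⁷S⁺ that is annihilated by the
lowering operators and scaled by the Cartan subalgebra through 5ω₁ becomes, via the Hermitian form,
a highest weight vector in Sym²V_i, nonzero once the symmetrization of L is nonzero on V_i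
(`exists_highest_symPow_two`). Such an L comes from the equivariant map Γ : S⁺ × S⁺ → Std: contract
x ⊗ y five times with the e₁-coordinate of Γ and twice more through the invariant ∑ Γ_p Γ_{-p},
which uses up all seven factors on each side. Its nonvanishing is an integer computation
(`covariantPoly_ne_zero`).

Invariance under the Lie algebra passes to the group along polynomial curves. For vectors v, w the
Clifford product vw is a scalar plus B = [v, w]/2, and B² is a scalar; so the segment from 1 to vw
has a logarithmic derivative that is a combination of B and scalars, and a tensor killed by the Lie
algebra is multiplied along it by a power of a polynomial, at the end by a power of Q(v)Q(w). A spin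
element is a product of an even number of vectors whose values of Q multiply to 1
(`even_apply_spin`).

The statement on (V ⊗ V)^T holds because the f_I are weight vectors and T contains elements that
scale a single e_k by 1/4. -/

open scoped TensorProduct

noncomputable section

namespace SpinTen

/-! ### Functoriality of the induced derivations -/

section Derivations

variable {M : Type*} [AddCommGroup M] [Module ℂ M]

/-- A derivation is determined by its values on generators. This yields linearity in f and
compatibility with commutators, so that a Lie algebra action on M induces one on Λⁿ M. -/
theorem extDerAux_unique (f : Module.End ℂ M) (D : Module.End ℂ (ExteriorAlgebra ℂ M))
    (hD : ∀ x y, D (x * y) = x * D y + D x * y)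
    (hι : ∀ m, D (ExteriorAlgebra.ι ℂ m) = ExteriorAlgebra.ι ℂ (f m)) : D = extDerAux f := by
  have h1 : ∀ D : Module.End ℂ (ExteriorAlgebra ℂ M),
      (∀ x y, D (x * y) = x * D y + D x * y) → D 1 = 0 := fun D hD => by
    simpa using hD 1 1
  refine LinearMap.ext fun x => ?_
  induction x using ExteriorAlgebra.induction with
  | algebraMap r =>
    rw [Algebra.algebraMap_eq_smul_one, map_smul, map_smul, h1 D hD, h1 _ (extDerAux_mul f)]
  | ι m => rw [hι, extDerAux_ι]
  | mul a b ha hb => rw [hD, extDerAux_mul, ha, hb]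
  | add a b ha hb => rw [map_add, map_add, ha, hb]

theorem extDerAux_one (f : Module.End ℂ M) : extDerAux f 1 = 0 := by
  simpa using extDerAux_mul f 1 1

theorem extDerAux_algebraMap (f : Module.End ℂ M) (r : ℂ) :
    extDerAux f (algebraMap ℂ _ r) = 0 := by
  rw [Algebra.algebraMap_eq_smul_one, map_smul, extDerAux_one, smul_zero]

theorem extDerAux_add (f g : Module.End ℂ M) :
    extDerAux (f + g) = extDerAux f + extDerAux g := by
  symm
  refine extDerAux_unique _ _ (fun x y => ?_) fun m => ?_
  · simp only [LinearMap.add_apply, extDerAux_mul, mul_add, add_mul]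
    abel
  · simp [extDerAux_ι]

theorem extDerAux_smul (t : ℂ) (f : Module.End ℂ M) :
    extDerAux (t • f) = t • extDerAux f := by
  symm
  refine extDerAux_unique _ _ (fun x y => ?_) fun m => ?_
  · simp only [LinearMap.smul_apply, extDerAux_mul, smul_add, mul_smul_comm, smul_mul_assoc]
  · simp [extDerAux_ι]

theorem extDerAux_commutator (f g : Module.End ℂ M) :
    extDerAux (f * g - g * f) = extDerAux f * extDerAux g - extDerAux g * extDerAux f := by
  symm
  refine extDerAux_unique _ _ (fun x y => ?_) fun m => ?_
  · simp only [LinearMap.sub_apply, Module.End.mul_apply, extDerAux_mul, map_add]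
    noncomm_ring
  · simp [extDerAux_ι]

theorem coe_extDer (n : ℕ) (f : Module.End ℂ M) (x : ⋀[ℂ]^n M) :
    ((extDer n f x : ⋀[ℂ]^n M) : ExteriorAlgebra ℂ M) = extDerAux f x := rfl

theorem extDer_add (n : ℕ) (f g : Module.End ℂ M) : extDer n (f + g) = extDer n f + extDer n g := by
  refine LinearMap.ext fun x => Subtype.ext ?_
  simp [coe_extDer, extDerAux_add]

theorem extDer_smul (n : ℕ) (t : ℂ) (f : Module.End ℂ M) : extDer n (t • f) = t • extDer n f := by
  refine LinearMap.ext fun x => Subtype.ext ?_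
  simp [coe_extDer, extDerAux_smul]

theorem extDer_commutator (n : ℕ) (f g : Module.End ℂ M) :
    extDer n (f * g - g * f) = extDer n f * extDer n g - extDer n g * extDer n f := by
  refine LinearMap.ext fun x => Subtype.ext ?_
  simp [coe_extDer, extDerAux_commutator]

theorem symDer_unique (f : Module.End ℂ M) (D : Module.End ℂ (SymmetricAlgebra ℂ M))
    (hD : ∀ x y, D (x * y) = x * D y + D x * y)
    (hι : ∀ m, D (SymmetricAlgebra.ι ℂ M m) = SymmetricAlgebra.ι ℂ M (f m)) : D = symDer f := by
  have h1 : ∀ D : Module.End ℂ (SymmetricAlgebra ℂ M),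
      (∀ x y, D (x * y) = x * D y + D x * y) → D 1 = 0 := fun D hD => by
    simpa using hD 1 1
  refine LinearMap.ext fun x => ?_
  induction x using SymmetricAlgebra.induction with
  | algebraMap r =>
    rw [Algebra.algebraMap_eq_smul_one, map_smul, map_smul, h1 D hD, h1 _ (symDer_mul f)]
  | ι m => rw [hι, symDer_ι]
  | mul a b ha hb => rw [hD, symDer_mul, ha, hb]
  | add a b ha hb => rw [map_add, map_add, ha, hb]

theorem symDer_one (f : Module.End ℂ M) : symDer f 1 = 0 := by
  simpa using symDer_mul f 1 1

theorem symDer_algebraMap (f : Module.End ℂ M) (r : ℂ) : symDer f (algebraMap ℂ _ r) = 0 := by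
  rw [Algebra.algebraMap_eq_smul_one, map_smul, symDer_one, smul_zero]

theorem symDer_add (f g : Module.End ℂ M) : symDer (f + g) = symDer f + symDer g := by
  symm
  refine symDer_unique _ _ (fun x y => ?_) fun m => ?_
  · simp only [LinearMap.add_apply, symDer_mul, mul_add, add_mul]
    abel
  · simp [symDer_ι]

theorem symDer_smul (t : ℂ) (f : Module.End ℂ M) : symDer (t • f) = t • symDer f := by
  symm
  refine symDer_unique _ _ (fun x y => ?_) fun m => ?_
  · simp only [LinearMap.smul_apply, symDer_mul, smul_add, mul_smul_comm, smul_mul_assoc]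
  · simp [symDer_ι]

theorem symDer_commutator (f g : Module.End ℂ M) :
    symDer (f * g - g * f) = symDer f * symDer g - symDer g * symDer f := by
  symm
  refine symDer_unique _ _ (fun x y => ?_) fun m => ?_
  · simp only [LinearMap.sub_apply, Module.End.mul_apply, symDer_mul, map_add]
    ring
  · simp [symDer_ι]

/-- Two algebra maps intertwining derivations of a symmetric algebra on generators intertwine
them everywhere. -/
theorem symMap_symDer (g f f' : Module.End ℂ M) (h : g * f = f' * g) (x : SymmetricAlgebra ℂ M) :
    symMap g (symDer f x) = symDer f' (symMap g x) := by
  have hι : ∀ m, symMap g (SymmetricAlgebra.ι ℂ M m) = SymmetricAlgebra.ι ℂ M (g m) := fun m => by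
    simp [symMap]
  induction x using SymmetricAlgebra.induction with
  | algebraMap r =>
    rw [symDer_algebraMap, map_zero, AlgHom.commutes, symDer_algebraMap]
  | ι m =>
    rw [symDer_ι, hι, hι, symDer_ι, ← Module.End.mul_apply, h, Module.End.mul_apply]
  | mul a b ha hb => rw [symDer_mul, map_add, map_mul, map_mul, map_mul, symDer_mul, ha, hb]
  | add a b ha hb => simp only [map_add, ha, hb]

end Derivations

/-! ### Actions of `𝔰𝔬(10)` -/

/-- The operators `act a b` satisfy the relations of the elements `[a, b] / 2` of `𝔰𝔬(10)`. -/
structure IsLieAct {M : Type*} [AddCommGroup M] [Module ℂ M]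
    (act : Std → Std → Module.End ℂ M) : Prop where
  add_left : ∀ a a' b, act (a + a') b = act a b + act a' b
  smul_left : ∀ (t : ℂ) a b, act (t • a) b = t • act a b
  swap : ∀ a b, act b a = -act a b
  comm : ∀ a b c d, act a b * act c d - act c d * act a b =
    act (stdAct a b c) d + act c (stdAct a b d)

theorem polarBilin_Q (x y : Std) : QuadraticMap.polarBilin Q x y = x.1 y.2 + y.1 x.2 := by
  simp [QuadraticMap.polarBilin, QuadraticMap.polar]
  ring

theorem stdAct_apply (a b v : Std) :
    stdAct a b v = (b.1 v.2 + v.1 b.2) • a - (a.1 v.2 + v.1 a.2) • b := by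
  simp only [stdAct, LinearMap.sub_apply, LinearMap.smulRight_apply, polarBilin_Q]

/-- The operators `stdAct a b` lie in the orthogonal Lie algebra; the relation `comm` on Std rests
on this. -/
theorem stdAct_skew (a b v w : Std) : QuadraticMap.polarBilin Q (stdAct a b v) w =
    -QuadraticMap.polarBilin Q v (stdAct a b w) := by
  simp only [stdAct_apply, polarBilin_Q]
  simp
  ring

namespace IsLieAct

/-- Linearity and compatibility with commutators are all that is asked of Ψ, so this covers Λⁿ and
Sym alike. -/
theorem map {M N : Type*} [AddCommGroup M] [Module ℂ M] [AddCommGroup N] [Module ℂ N]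
    {act : Std → Std → Module.End ℂ M} (h : IsLieAct act)
    (Ψ : Module.End ℂ M → Module.End ℂ N) (hadd : ∀ f g, Ψ (f + g) = Ψ f + Ψ g)
    (hsmul : ∀ (t : ℂ) f, Ψ (t • f) = t • Ψ f)
    (hcomm : ∀ f g, Ψ (f * g - g * f) = Ψ f * Ψ g - Ψ g * Ψ f) :
    IsLieAct fun a b => Ψ (act a b) where
  add_left a a' b := by rw [h.add_left, hadd]
  smul_left t a b := by rw [h.smul_left, hsmul]
  swap a b := by rw [h.swap, ← neg_one_smul ℂ, hsmul, neg_one_smul]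
  comm a b c d := by rw [← hcomm, h.comm, hadd]

variable {M : Type*} [AddCommGroup M] [Module ℂ M] {act : Std → Std → Module.End ℂ M}

theorem smul_right (h : IsLieAct act) (t : ℂ) (a b : Std) : act a (t • b) = t • act a b := by
  rw [h.swap, h.smul_left, h.swap a b]
  simp

end IsLieAct

theorem isLieAct_stdAct : IsLieAct stdAct where
  add_left a a' b := by
    refine LinearMap.ext fun v => ?_
    simp only [stdAct_apply, LinearMap.add_apply, Prod.fst_add, Prod.snd_add, map_add]
    module
  smul_left t a b := by
    refine LinearMap.ext fun v => ?_
    simp only [stdAct_apply, LinearMap.smul_apply, Prod.smul_fst, Prod.smul_snd, map_smul,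
      smul_eq_mul]
    module
  swap a b := by simp [stdAct]
  comm a b c d := by
    refine LinearMap.ext fun v => ?_
    simp only [LinearMap.sub_apply, Module.End.mul_apply, LinearMap.add_apply]
    have h1 := stdAct_skew a b c v
    have h2 := stdAct_skew a b d v
    generalize hc : stdAct a b c = c' at *
    generalize hd : stdAct a b d = d' at *
    have h3 : ∀ x y v, stdAct x y v =
      QuadraticMap.polarBilin Q y v • x - QuadraticMap.polarBilin Q x v • y := fun x y v => by
      simp [stdAct]
    rw [h3 c d v, h3 c' d v, h3 c d' v, h3 c d (stdAct a b v), h1, h2, map_sub, map_smul,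
      map_smul, hc, hd]
    module

theorem coe_bivector (a b : Std) : (bivector a b : CliffordAlgebra Q) = (2⁻¹ : ℂ) •
    (CliffordAlgebra.ι Q a * CliffordAlgebra.ι Q b -
      CliffordAlgebra.ι Q b * CliffordAlgebra.ι Q a) := rfl

/-- The commutator with [a, b]/2 is a derivation of the Clifford algebra that acts on vectors by
`stdAct a b`; it is applied here to [c, d]/2. -/
theorem bivector_mul_sub (a b c d : Std) :
    bivector a b * bivector c d - bivector c d * bivector a b =
      bivector (stdAct a b c) d + bivector c (stdAct a b d) := by
  refine Subtype.ext ?_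
  have h1 := bivector_commutator a b c
  have h2 := bivector_commutator a b d
  change (bivector a b : CliffordAlgebra Q) * (bivector c d : CliffordAlgebra Q) -
    (bivector c d : CliffordAlgebra Q) * (bivector a b : CliffordAlgebra Q) =
      (bivector (stdAct a b c) d : CliffordAlgebra Q) +
        (bivector c (stdAct a b d) : CliffordAlgebra Q)
  generalize (bivector a b : CliffordAlgebra Q) = X at *
  rw [coe_bivector, coe_bivector, coe_bivector, ← h1, ← h2, mul_smul_comm, smul_mul_assoc,
    ← smul_sub, ← smul_add]
  congr 1
  noncomm_ring

theorem isLieAct_spinAct : IsLieAct spinAct where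
  add_left a a' b := by
    rw [spinAct, spinAct, spinAct, ← map_add]
    congr 1
    simp only [bivector, map_add, LinearMap.add_apply]
    module
  smul_left t a b := by
    rw [spinAct, spinAct, ← map_smul]
    congr 1
    simp only [bivector, map_smul, LinearMap.smul_apply]
    module
  swap a b := by
    have h : bivector b a = -bivector a b := by
      simp only [bivector]
      module
    rw [spinAct, spinAct, h]
    exact map_neg spinorPlus _
  comm a b c d := by
    have h1 := congrArg spinorPlus (bivector_mul_sub a b c d)
    rw [map_add] at h1
    rw [spinAct, spinAct, spinAct, spinAct, ← h1, ← map_mul, ← map_mul]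
    exact (map_sub spinorPlus _ _).symm

theorem isLieAct_lambdaAct : IsLieAct lambdaAct :=
  isLieAct_spinAct.map _ (extDer_add 7) (extDer_smul 7) (extDer_commutator 7)

theorem isLieAct_symLAct : IsLieAct symLAct :=
  isLieAct_lambdaAct.map _ symDer_add symDer_smul symDer_commutator

theorem isLieAct_symStdAct : IsLieAct symStdAct :=
  isLieAct_stdAct.map _ symDer_add symDer_smul symDer_commutator

/-- The action on a tensor product. -/
def tensAct {M N : Type*} [AddCommGroup M] [Module ℂ M] [AddCommGroup N] [Module ℂ N]
    (act : Std → Std → Module.End ℂ M) (act' : Std → Std → Module.End ℂ N) (a b : Std) :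
    Module.End ℂ (M ⊗[ℂ] N) :=
  TensorProduct.map (act a b) LinearMap.id + TensorProduct.map LinearMap.id (act' a b)

theorem tensAct_tmul {M N : Type*} [AddCommGroup M] [Module ℂ M] [AddCommGroup N] [Module ℂ N]
    (act : Std → Std → Module.End ℂ M) (act' : Std → Std → Module.End ℂ N) (a b : Std)
    (x : M) (y : N) : tensAct act act' a b (x ⊗ₜ y) = act a b x ⊗ₜ y + x ⊗ₜ act' a b y := rfl

theorem IsLieAct.tensAct {M N : Type*} [AddCommGroup M] [Module ℂ M] [AddCommGroup N]
    [Module ℂ N] {act : Std → Std → Module.End ℂ M} {act' : Std → Std → Module.End ℂ N}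
    (h : IsLieAct act) (h' : IsLieAct act') : IsLieAct (tensAct act act') where
  add_left a a' b := by
    refine TensorProduct.ext' fun x y => ?_
    simp only [LinearMap.add_apply, tensAct_tmul, h.add_left, h'.add_left, TensorProduct.add_tmul,
      TensorProduct.tmul_add]
    abel
  smul_left t a b := by
    refine TensorProduct.ext' fun x y => ?_
    simp only [LinearMap.smul_apply, tensAct_tmul, h.smul_left, h'.smul_left, smul_add,
      TensorProduct.smul_tmul', TensorProduct.tmul_smul]
  swap a b := by
    refine TensorProduct.ext' fun x y => ?_
    rw [LinearMap.neg_apply, tensAct_tmul, tensAct_tmul, h.swap a b, h'.swap a b]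
    simp only [LinearMap.neg_apply, TensorProduct.neg_tmul, TensorProduct.tmul_neg]
    abel
  comm a b c d := by
    refine TensorProduct.ext' fun x y => ?_
    have h1 := LinearMap.congr_fun (h.comm a b c d) x
    have h2 := LinearMap.congr_fun (h'.comm a b c d) y
    simp only [LinearMap.sub_apply, LinearMap.add_apply, Module.End.mul_apply] at h1 h2
    rw [sub_eq_iff_eq_add] at h1 h2
    simp only [LinearMap.sub_apply, LinearMap.add_apply, Module.End.mul_apply, tensAct_tmul,
      map_add, h1, h2, TensorProduct.add_tmul, TensorProduct.tmul_add]
    abel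

/-! ### Root vectors -/

theorem stdAct_e_em_e (a b c : Fin 5) : stdAct (e a) (em b) (e c) = if b = c then e a else 0 := by
  rw [stdAct_apply]
  by_cases h : b = c <;> simp [e, em, h]

theorem stdAct_e_em_em (a b c : Fin 5) :
    stdAct (e a) (em b) (em c) = if a = c then -em b else 0 := by
  rw [stdAct_apply]
  by_cases h : a = c <;> simp [e, em, h, eq_comm]

theorem stdAct_e_e_e (a b c : Fin 5) : stdAct (e a) (e b) (e c) = 0 := by
  rw [stdAct_apply]
  simp [e]

theorem stdAct_e_e_em (a b c : Fin 5) : stdAct (e a) (e b) (em c) =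
    (if b = c then e a else 0) - if a = c then e b else 0 := by
  rw [stdAct_apply]
  by_cases h : a = c <;> by_cases h' : b = c <;> simp [e, em, h, h', eq_comm]

theorem std_decomposition (v : Std) :
    v = ∑ i, v.2 i • e i + ∑ i, v.1 (Pi.single i 1) • em i := by
  refine Prod.ext ?_ ?_
  · refine LinearMap.pi_ext' fun j => LinearMap.ext_ring ?_
    simp [e, em, Prod.fst_sum, Pi.single_apply]
  · funext j
    simp [e, em, Prod.snd_sum, Pi.single_apply]

namespace IsLieAct

variable {M : Type*} [AddCommGroup M] [Module ℂ M] {act : Std → Std → Module.End ℂ M}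

theorem zero_left (h : IsLieAct act) (b : Std) : act 0 b = 0 := by
  simpa using h.smul_left 0 0 b

theorem zero_right (h : IsLieAct act) (a : Std) : act a 0 = 0 := by
  simpa using h.smul_right 0 a 0

theorem neg_left (h : IsLieAct act) (a b : Std) : act (-a) b = -act a b := by
  simpa using h.smul_left (-1) a b

theorem neg_right (h : IsLieAct act) (a b : Std) : act a (-b) = -act a b := by
  simpa using h.smul_right (-1) a b

theorem self (h : IsLieAct act) (a : Std) : act a a = 0 := by
  have h1 := h.swap a a
  have h2 : (2 : ℂ) • act a a = 0 := by
    rw [two_smul]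
    nth_rewrite 1 [h1]
    simp
  simpa using h2

/-- For distinct simple roots the difference is not a root, so the commutator vanishes; for equal
ones it is the coroot, which has the coordinates of the root because D₅ is simply laced. -/
theorem raising_lowering (h : IsLieAct act) (i j : Fin 5) :
    raising act i * lowering act j - lowering act j * raising act i =
      if i = j then ∑ k, (simpleRoot i k : ℂ) • cartan act k else 0 := by
  fin_cases i <;> fin_cases j <;>
  simp [raising, lowering, cartan, h.comm, stdAct_e_em_e, stdAct_e_em_em, stdAct_e_e_em,
      stdAct_e_e_e, h.zero_left, h.zero_right, h.neg_right, Fin.sum_univ_five, simpleRoot, h.self, sub_eq_add_neg]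
  -- What remains is i = j = 4, where the last Cartan element appears with its two arguments in the
  -- opposite order.
  rw [h.swap (e 4) (em 4), neg_neg]

theorem cartan_lowering (h : IsLieAct act) (k i : Fin 5) :
    cartan act k * lowering act i - lowering act i * cartan act k =
      -((simpleRoot i k : ℂ) • lowering act i) := by
  fin_cases i <;> fin_cases k <;>
  simp [lowering, cartan, h.comm, stdAct_e_em_e, stdAct_e_em_em,
      h.zero_left, h.zero_right, h.neg_left, h.neg_right, simpleRoot]

theorem lie_mem {L : Submodule ℂ (Module.End ℂ M)}
    (hL : ∀ f ∈ L, ∀ g ∈ L, f * g - g * f ∈ L) (h : IsLieAct act) {a b c d : Std}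
    (h1 : act a b ∈ L) (h2 : act c d ∈ L) :
    act (stdAct a b c) d + act c (stdAct a b d) ∈ L := by
  rw [← h.comm]
  exact hL _ h1 _ h2

/-- A commutator-closed subspace containing the simple root vectors and their negatives contains the whole
image of `𝔰𝔬(10)`. -/
theorem mem_of_simple (h : IsLieAct act) (L : Submodule ℂ (Module.End ℂ M))
    (hL : ∀ f ∈ L, ∀ g ∈ L, f * g - g * f ∈ L)
    (hr : ∀ i, raising act i ∈ L) (hl : ∀ i, lowering act i ∈ L) (a b : Std) : act a b ∈ L := by
  -- The bracket of e_i e_{-j} with e_j e_{-k} is e_i e_{-k}; adjacent indices thus generate all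
  -- root vectors of 𝔤𝔩(5).
  have hA : ∀ {i j k : Fin 5}, i ≠ k → act (e i) (em j) ∈ L → act (e j) (em k) ∈ L →
      act (e i) (em k) ∈ L := by
    intro i j k hik h1 h2
    simpa [stdAct_e_em_e, stdAct_e_em_em, hik, h.zero_right] using h.lie_mem hL h1 h2
  have u01 : act (e 0) (em 1) ∈ L := hr 0
  have u12 : act (e 1) (em 2) ∈ L := hr 1
  have u23 : act (e 2) (em 3) ∈ L := hr 2
  have u34 : act (e 3) (em 4) ∈ L := hr 3
  have l10 : act (e 1) (em 0) ∈ L := hl 0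
  have l21 : act (e 2) (em 1) ∈ L := hl 1
  have l32 : act (e 3) (em 2) ∈ L := hl 2
  have l43 : act (e 4) (em 3) ∈ L := hl 3
  have u02 := hA (by decide) u01 u12
  have u13 := hA (by decide) u12 u23
  have u24 := hA (by decide) u23 u34
  have u03 := hA (by decide) u02 u23
  have u14 := hA (by decide) u13 u34
  have u04 := hA (by decide) u03 u34
  have l20 := hA (by decide) l21 l10
  have l31 := hA (by decide) l32 l21
  have l42 := hA (by decide) l43 l32
  have l30 := hA (by decide) l32 l20
  have l41 := hA (by decide) l43 l31
  have l40 := hA (by decide) l43 l30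
  have hAne : ∀ i j, i ≠ j → act (e i) (em j) ∈ L := by
    intro i j hij
    fin_cases i <;> fin_cases j <;> first | exact absurd rfl hij | assumption
  have hE34 : act (e 3) (e 4) ∈ L := hr 4
  have hF43 : act (em 4) (em 3) ∈ L := hl 4
  -- Brackets with root vectors of 𝔤𝔩(5) change one index at a time, so the root vectors for ±(L₄ +
  -- L₅) give those for all ±(L_i + L_j).
  have hE4 : ∀ i, i ≠ 4 → act (e i) (e 4) ∈ L := by
    intro i hi
    by_cases h3 : i = 3
    · rw [h3]
      exact hE34
    · simpa [stdAct_e_em_e, h.zero_right] using h.lie_mem hL (hAne i 3 h3) hE34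
  have hF4 : ∀ i, i ≠ 4 → act (em 4) (em i) ∈ L := by
    intro i hi
    by_cases h3 : i = 3
    · rw [h3]
      exact hF43
    · simpa [stdAct_e_em_em, h.zero_left, h.neg_right] using
        h.lie_mem hL (hAne 3 i (Ne.symm h3)) hF43
  have hE : ∀ i j, act (e i) (e j) ∈ L := by
    intro i j
    by_cases hij : i = j
    · rw [hij, h.self]
      exact L.zero_mem
    by_cases hj : j = 4
    · rw [hj]
      exact hE4 i (hj ▸ hij)
    by_cases hi : i = 4
    · rw [h.swap, hi]
      exact L.neg_mem (hE4 j hj)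
    simpa [stdAct_e_em_e, h.zero_left, Ne.symm hi] using h.lie_mem hL (hAne j 4 hj) (hE4 i hi)
  have hF : ∀ i j, act (em i) (em j) ∈ L := by
    intro i j
    by_cases hij : i = j
    · rw [hij, h.self]
      exact L.zero_mem
    by_cases hi : i = 4
    · rw [hi]
      exact hF4 j (hi ▸ Ne.symm hij)
    by_cases hj : j = 4
    · rw [h.swap, hj]
      exact L.neg_mem (hF4 i hi)
    simpa [stdAct_e_em_em, h.zero_right, h.neg_left, Ne.symm hj] using
      h.lie_mem hL (hAne 4 i (Ne.symm hi)) (hF4 j hj)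
  -- Brackets inside 𝔤𝔩(5) only give the differences H_i − H_j. The bracket of the root vectors for
  -- ±(L₄ + L₅) supplies H₄ + H₅, and dividing by 2 separates the H_i.
  have hd : ∀ i j, act (e i) (em i) - act (e j) (em j) ∈ L := by
    intro i j
    by_cases hij : i = j
    · rw [hij, sub_self]
      exact L.zero_mem
    simpa [stdAct_e_em_e, stdAct_e_em_em, h.neg_right, ← sub_eq_add_neg] using
      h.lie_mem hL (hAne i j hij) (hAne j i (Ne.symm hij))
  have hs : act (e 3) (em 3) + act (e 4) (em 4) ∈ L := by
    have h1 := h.lie_mem hL hE34 hF43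
    simp [stdAct_e_e_em, h.neg_right, h.swap (e 4) (em 4)] at h1
    simpa [h.swap (em 4) (e 4)] using h1
  have h3 : act (e 3) (em 3) ∈ L := by
    have h1 := L.smul_mem (2⁻¹ : ℂ) (L.add_mem hs (hd 3 4))
    have h2 : (2⁻¹ : ℂ) • (act (e 3) (em 3) + act (e 4) (em 4) +
        (act (e 3) (em 3) - act (e 4) (em 4))) = act (e 3) (em 3) := by module
    rwa [h2] at h1
  have hAll : ∀ i j, act (e i) (em j) ∈ L := by
    intro i j
    by_cases hij : i = j
    · rw [← hij]
      simpa using L.add_mem (hd i 3) h3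
    · exact hAne i j hij
  have hsuml : ∀ (f : Fin 5 → Std) (b : Std), (∀ i, act (f i) b ∈ L) → act (∑ i, f i) b ∈ L := by
    intro f b hf
    rw [Fin.sum_univ_five]
    simp only [h.add_left]
    exact L.add_mem (L.add_mem (L.add_mem (L.add_mem (hf 0) (hf 1)) (hf 2)) (hf 3)) (hf 4)
  have hgen : ∀ (x : Std), (∀ i, act (e i) x ∈ L) → (∀ i, act (em i) x ∈ L) →
      ∀ v, act v x ∈ L := by
    intro x h1 h2 v
    rw [std_decomposition v, h.add_left]
    refine L.add_mem (hsuml _ _ fun i => ?_) (hsuml _ _ fun i => ?_)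
    · rw [h.smul_left]
      exact L.smul_mem _ (h1 i)
    · rw [h.smul_left]
      exact L.smul_mem _ (h2 i)
  have hflip : ∀ {x y}, act x y ∈ L → act y x ∈ L := fun {x y} hxy => by
    rw [h.swap]
    exact L.neg_mem hxy
  refine hgen b (fun i => hflip ?_) (fun i => hflip ?_) a
  · exact hgen _ (fun j => hE j i) (fun j => hflip (hAll i j)) b
  · exact hgen _ (fun j => hAll j i) (fun j => hF j i) b

end IsLieAct

/-! ### Highest weight vectors and their lowering words -/

section Words

variable {M : Type*} [AddCommGroup M] [Module ℂ M] (act : Std → Std → Module.End ℂ M)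

/-- `X_{-α_{i_1}} ⋯ X_{-α_{i_k}} w` for `I = [i_1, …, i_k]`. -/
def word (I : List (Fin 5)) (w : M) : M := I.foldr (fun i x => lowering act i x) w

theorem word_nil (w : M) : word act [] w = w := rfl

theorem word_cons (i : Fin 5) (I : List (Fin 5)) (w : M) :
    word act (i :: I) w = lowering act i (word act I w) := rfl

theorem lowerSeq_eq_word (I : List (Fin 5)) (w : M) :
    lowerSeq act I w = word act I.reverse w := by
  rw [word, List.foldr_reverse]
  rfl

/-- The weight of `word act I w` if `w` has weight `lam`. -/
def wordWeight (lam : Fin 5 → ℚ) (I : List (Fin 5)) (k : Fin 5) : ℚ :=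
  lam k - ((I.map simpleRoot).sum k : ℤ)

/-- `w` is a highest weight vector of the (possibly half-integral) weight `lam`. -/
def IsHighest (lam : Fin 5 → ℚ) (w : M) : Prop :=
  w ≠ 0 ∧ (∀ i, raising act i w = 0) ∧ ∀ i, cartan act i w = (lam i : ℂ) • w

theorem IsHighestWeightVector.isHighest {act : Std → Std → Module.End ℂ M} {lam : Fin 5 → ℤ}
    {w : M} (hw : IsHighestWeightVector act lam w) : IsHighest act (fun k => (lam k : ℚ)) w :=
  ⟨hw.1, hw.2.1, fun i => by simpa using hw.2.2 i⟩

/-- The pairing of a weight with the coroot of a simple root. -/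
def corootPairing (i : Fin 5) (mu : Fin 5 → ℚ) : ℚ := ∑ k, simpleRoot i k * mu k

/-- The coefficients of `X_{αᵢ} (word J w)` in the words, for a highest weight vector `w`. -/
def raisingCoeffs (lam : Fin 5 → ℚ) (i : Fin 5) : List (Fin 5) → List (ℚ × List (Fin 5))
  | [] => []
  | j :: J => (if i = j then [(corootPairing i (wordWeight lam J), J)] else []) ++
      (raisingCoeffs lam i J).map fun p => (p.1, j :: p.2)

/-- The contravariant form on words, normalized at the highest weight vector. -/
def wordForm (lam : Fin 5 → ℚ) : List (Fin 5) → List (Fin 5) → ℚ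
  | [], J => if J = [] then 1 else 0
  | i :: I, J => ((raisingCoeffs lam i J).map fun p => p.1 * wordForm lam I p.2).sum

variable {act}

theorem cartan_word (h : IsLieAct act) {lam : Fin 5 → ℚ} {w : M}
    (hw : IsHighest act lam w) (k : Fin 5) (I : List (Fin 5)) :
    cartan act k (word act I w) = (wordWeight lam I k : ℂ) • word act I w := by
  induction I with
  | nil => simpa [word, wordWeight] using hw.2.2 k
  | cons i I ih =>
    have h1 := LinearMap.congr_fun (h.cartan_lowering k i) (word act I w)
    simp only [LinearMap.sub_apply, Module.End.mul_apply, LinearMap.neg_apply,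
      LinearMap.smul_apply, sub_eq_iff_eq_add] at h1
    rw [word_cons, h1, ih, map_smul]
    have h2 : wordWeight lam (i :: I) k = wordWeight lam I k - simpleRoot i k := by
      simp [wordWeight]
      ring
    rw [h2]
    push_cast
    module

/-- X_{α_i} is moved to the right through the word: each commutator is zero or the coroot, which
acts on the remaining word by a scalar, and X_{α_i} finally kills w. The coefficients are rational
and involve only the weight. -/
theorem raising_word (h : IsLieAct act) {lam : Fin 5 → ℚ} {w : M}
    (hw : IsHighest act lam w) (i : Fin 5) (J : List (Fin 5)) :
    raising act i (word act J w) =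
      ((raisingCoeffs lam i J).map fun p => (p.1 : ℂ) • word act p.2 w).sum := by
  induction J with
  | nil => simpa [word, raisingCoeffs] using hw.2.1 i
  | cons j J ih =>
    have h1 := LinearMap.congr_fun (h.raising_lowering i j) (word act J w)
    simp only [LinearMap.sub_apply, Module.End.mul_apply, sub_eq_iff_eq_add] at h1
    rw [word_cons, h1, ih, raisingCoeffs, List.map_append, List.sum_append, map_list_sum,
      List.map_map, List.map_map]
    congr 1
    · by_cases hij : i = j
      · simp only [hij, if_true, List.map_cons, List.map_nil, List.sum_cons, List.sum_nil,
          add_zero, LinearMap.sum_apply, LinearMap.smul_apply, cartan_word h hw, smul_smul,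
          ← Finset.sum_smul]
        simp [corootPairing]
      · simp [hij]
    · congr 2
      funext p
      simp [word_cons]

/-- The span of the words. -/
def wordSpan (act : Std → Std → Module.End ℂ M) (w : M) : Submodule ℂ M :=
  Submodule.span ℂ (Set.range fun I => word act I w)

theorem word_mem_wordSpan (w : M) (I : List (Fin 5)) : word act I w ∈ wordSpan act w :=
  Submodule.subset_span ⟨I, rfl⟩

/-- The operators preserving a subspace, and likewise the operators annihilating it, are closed
under commutators. -/
theorem IsLieAct.stable (h : IsLieAct act) {S : Submodule ℂ M}
    (hr : ∀ i, ∀ x ∈ S, raising act i x ∈ S) (hl : ∀ i, ∀ x ∈ S, lowering act i x ∈ S)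
    (a b : Std) : ∀ x ∈ S, act a b x ∈ S := by
  let L : Submodule ℂ (Module.End ℂ M) :=
    { carrier := {f | ∀ x ∈ S, f x ∈ S}
      add_mem' := fun hf hg x hx => S.add_mem (hf x hx) (hg x hx)
      zero_mem' := fun x _ => S.zero_mem
      smul_mem' := fun t f hf x hx => S.smul_mem t (hf x hx) }
  exact h.mem_of_simple L
    (fun f hf g hg x hx => S.sub_mem (hf _ (hg x hx)) (hg _ (hf x hx))) hr hl a b

theorem IsLieAct.annihilates (h : IsLieAct act) {x : M}
    (hr : ∀ i, raising act i x = 0) (hl : ∀ i, lowering act i x = 0)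
    (a b : Std) : act a b x = 0 := by
  let L : Submodule ℂ (Module.End ℂ M) :=
    { carrier := {f | f x = 0}
      add_mem' := fun {f g} hf hg => by
        simp only [Set.mem_ofPred_eq] at hf hg
        simp [hf, hg]
      zero_mem' := rfl
      smul_mem' := fun t f hf => by
        simp only [Set.mem_ofPred_eq] at hf
        simp [hf] }
  refine h.mem_of_simple L (fun f hf g hg => ?_) hr hl a b
  have hf' : f x = 0 := hf
  have hg' : g x = 0 := hg
  change f (g x) - g (f x) = 0
  rw [hf', hg', map_zero, map_zero, sub_zero]

theorem generated_stable (act : Std → Std → Module.End ℂ M) (w : M) (a b : Std) :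
    ∀ x ∈ generated act w, act a b x ∈ generated act w := by
  intro x hx
  refine (Submodule.mem_sInf).mpr fun N hN => hN.2 a b x ((Submodule.mem_sInf).mp hx N hN)

theorem mem_generated (act : Std → Std → Module.End ℂ M) (w : M) : w ∈ generated act w :=
  (Submodule.mem_sInf).mpr fun _ hN => hN.1

theorem lowering_mem {S : Submodule ℂ M} (hS : ∀ a b, ∀ x ∈ S, act a b x ∈ S) (i : Fin 5)
    {x : M} (hx : x ∈ S) : lowering act i x ∈ S := by
  fin_cases i <;> exact hS _ _ x hx

theorem raising_mem {S : Submodule ℂ M} (hS : ∀ a b, ∀ x ∈ S, act a b x ∈ S) (i : Fin 5)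
    {x : M} (hx : x ∈ S) : raising act i x ∈ S := by
  fin_cases i <;> exact hS _ _ x hx

theorem word_mem {S : Submodule ℂ M} (hS : ∀ i, ∀ x ∈ S, lowering act i x ∈ S) {w : M}
    (hw : w ∈ S) (I : List (Fin 5)) : word act I w ∈ S := by
  induction I with
  | nil => exact hw
  | cons i I ih => exact hS i _ ih

/-- The span of the words is stable under lowering operators by construction and under raising
operators by `raising_word`; these generate the Lie algebra. -/
theorem generated_eq_wordSpan (h : IsLieAct act) {lam : Fin 5 → ℚ} {w : M}
    (hw : IsHighest act lam w) : generated act w = wordSpan act w := by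
  refine le_antisymm (sInf_le ⟨word_mem_wordSpan w [], ?_⟩) ?_
  · intro a b
    refine h.stable (fun i x hx => ?_) (fun i x hx => ?_) a b
    · refine Submodule.span_induction (p := fun x _ => raising act i x ∈ wordSpan act w) ?_ ?_ ?_ ?_
        hx
      · rintro _ ⟨J, rfl⟩
        change raising act i (word act J w) ∈ _
        rw [raising_word h hw]
        refine list_sum_mem fun y hy => ?_
        obtain ⟨p, -, rfl⟩ := List.mem_map.mp hy
        exact Submodule.smul_mem _ _ (word_mem_wordSpan w _)
      · simp
      · intro x y _ _ hx hy
        rw [map_add]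
        exact Submodule.add_mem _ hx hy
      · intro t x _ hx
        rw [map_smul]
        exact Submodule.smul_mem _ _ hx
    · refine Submodule.span_induction (p := fun x _ => lowering act i x ∈ wordSpan act w)
        ?_ ?_ ?_ ?_ hx
      · rintro _ ⟨J, rfl⟩
        exact word_mem_wordSpan w (i :: J)
      · simp
      · intro x y _ _ hx hy
        rw [map_add]
        exact Submodule.add_mem _ hx hy
      · intro t x _ hx
        rw [map_smul]
        exact Submodule.smul_mem _ _ hx
  · refine Submodule.span_le.mpr ?_
    rintro _ ⟨I, rfl⟩
    exact word_mem (fun i x hx => lowering_mem (generated_stable act w) i hx)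
      (mem_generated act w) I

/-- A form for which raising and lowering operators are adjoint is determined on words. -/
theorem form_word (h : IsLieAct act) {lam : Fin 5 → ℚ} {w : M}
    (hw : IsHighest act lam w) (β : M → (M →ₗ[ℂ] ℂ))
    (h1 : ∀ i x y, β (lowering act i x) y = β x (raising act i y))
    (h2 : ∀ i y, β w (lowering act i y) = 0) (I J : List (Fin 5)) :
    β (word act I w) (word act J w) = wordForm lam I J * β w w := by
  induction I generalizing J with
  | nil =>
    cases J with
    | nil => simp [word, wordForm]
    | cons j J => simp [word_nil, word_cons, wordForm, h2]
  | cons i I ih =>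
    rw [word_cons, h1, raising_word h hw, map_list_sum, List.map_map, wordForm]
    have h3 : ∀ l : List (ℚ × List (Fin 5)),
        (l.map (β (word act I w) ∘ fun p => (p.1 : ℂ) • word act p.2 w)).sum =
          (((l.map fun p => p.1 * wordForm lam I p.2).sum : ℚ) : ℂ) * β w w := by
      intro l
      induction l with
      | nil => simp
      | cons p l ihl =>
        rw [List.map_cons, List.sum_cons, ihl, List.map_cons, List.sum_cons]
        simp only [Function.comp, map_smul, ih, smul_eq_mul]
        push_cast
        ring
    exact h3 _

end Words

/-! ### Frames: real coordinates in which raising and lowering operators are transposed -/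

section Frames

variable {M : Type*} [AddCommGroup M] [Module ℂ M]

/-- A real frame for an action: finitely many coordinates, injective on `S`, in which the
lowering operators are given by real matrices and the raising operators by their transposes. -/
structure Frame (act : Std → Std → Module.End ℂ M) (S : Submodule ℂ M) where
  /-- the index set of the coordinates -/
  K : Type
  [fintype : Fintype K]
  /-- the coordinates -/
  coord : M →ₗ[ℂ] (K → ℂ)
  /-- the matrices of the lowering operators -/
  mat : Fin 5 → Matrix K K ℝ
  inj : ∀ x ∈ S, coord x = 0 → x = 0
  lower : ∀ i x, coord (lowering act i x) = ((mat i).map Complex.ofReal).mulVec (coord x)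
  raise : ∀ i x, coord (raising act i x) =
    ((mat i).transpose.map Complex.ofReal).mulVec (coord x)

namespace Frame

attribute [instance] Frame.fintype

variable {act : Std → Std → Module.End ℂ M} {S : Submodule ℂ M} (φ : Frame act S)

/-- The Hermitian form of a frame. -/
def herm (x : M) : M →ₗ[ℂ] ℂ where
  toFun y := star (φ.coord x) ⬝ᵥ φ.coord y
  map_add' y z := by simp
  map_smul' t y := by simp

theorem herm_apply (x y : M) : φ.herm x y = star (φ.coord x) ⬝ᵥ φ.coord y := rfl

theorem herm_comm (x y : M) : φ.herm x y = star (φ.herm y x) := by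
  rw [herm_apply, herm_apply, Matrix.star_dotProduct]

/-- The matrix of a lowering operator is real, so its conjugate transpose is the matrix of the
raising operator. -/
theorem herm_lower (i : Fin 5) (x y : M) :
    φ.herm (lowering act i x) y = φ.herm x (raising act i y) := by
  rw [herm_apply, herm_apply, φ.lower, φ.raise, Matrix.star_mulVec, ← Matrix.dotProduct_mulVec]
  congr 2
  ext j k
  simp

theorem herm_raise (i : Fin 5) (x y : M) :
    φ.herm (raising act i x) y = φ.herm x (lowering act i y) := by
  rw [herm_comm, ← herm_lower, ← herm_comm]

-- Positive definiteness, available on S because the coordinates are injective there.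
open scoped ComplexOrder in
theorem eq_zero_of_herm {x : M} (hx : x ∈ S) (h : φ.herm x x = 0) : x = 0 :=
  φ.inj x hx (dotProduct_star_self_eq_zero.mp h)

theorem herm_add_left (x x' y : M) : φ.herm (x + x') y = φ.herm x y + φ.herm x' y := by
  simp [herm_apply]

theorem herm_zero_left (y : M) : φ.herm 0 y = 0 := by
  simp [herm_apply]

theorem herm_smul_left (t : ℂ) (x y : M) : φ.herm (t • x) y = star t * φ.herm x y := by
  simp [herm_apply]

end Frame

/-- The module enters only through the factor ⟨w, w⟩; the other factor is determined by the
coefficients and the weight. This is what allows relations to be compared between two modules. -/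
theorem herm_sum_word {act : Std → Std → Module.End ℂ M} {S : Submodule ℂ M}
    (φ : Frame act S) (h : IsLieAct act) {lam : Fin 5 → ℚ} {w : M}
    (hw : IsHighest act lam w) (a : List (Fin 5) →₀ ℂ) :
    φ.herm (Finsupp.linearCombination ℂ (fun I => word act I w) a)
      (Finsupp.linearCombination ℂ (fun I => word act I w) a) =
        (a.sum fun I s => a.sum fun J t => star s * t * (wordForm lam I J : ℂ)) * φ.herm w w := by
  -- The adjoints of the lowering operators kill w, so w is orthogonal to their images.
  have h2 : ∀ i y, φ.herm w (lowering act i y) = 0 := fun i y => by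
    rw [← φ.herm_raise, hw.2.1 i, φ.herm_zero_left]
  have h3 : ∀ y, φ.herm (Finsupp.linearCombination ℂ (fun I => word act I w) a) y =
      a.sum fun I s => star s * φ.herm (word act I w) y := by
    intro y
    rw [Finsupp.linearCombination_apply, Finsupp.sum, Finsupp.sum, Frame.herm_apply, map_sum,
      star_sum, sum_dotProduct]
    refine Finset.sum_congr rfl fun I _ => ?_
    rw [← Frame.herm_apply, Frame.herm_smul_left]
  rw [h3, Finsupp.sum, Finsupp.sum, Finset.sum_mul]
  refine Finset.sum_congr rfl fun I _ => ?_
  rw [Finsupp.linearCombination_apply, Finsupp.sum, Finsupp.sum, map_sum, Finset.mul_sum,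
    Finset.sum_mul]
  refine Finset.sum_congr rfl fun J _ => ?_
  rw [map_smul, form_word h hw (fun x => φ.herm x) φ.herm_lower h2, smul_eq_mul]
  ring

/-- Two highest weight vectors of the same weight in modules with frames satisfy the same linear
relations between their lowering words. -/
theorem exists_transport {N : Type*} [AddCommGroup N] [Module ℂ N]
    {act : Std → Std → Module.End ℂ M} {act' : Std → Std → Module.End ℂ N}
    {S : Submodule ℂ M} {S' : Submodule ℂ N} (φ : Frame act S) (φ' : Frame act' S')
    (h : IsLieAct act) (h' : IsLieAct act')
    (hS' : ∀ i, ∀ x ∈ S', lowering act' i x ∈ S') {lam : Fin 5 → ℚ} {w : M} {w' : N}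
    (hw : IsHighest act lam w) (hw' : IsHighest act' lam w')
    (hwS : w ∈ S) (hwS' : w' ∈ S') :
    ∃ f : M →ₗ[ℂ] N, ∀ I, f (word act I w) = word act' I w' := by
  set p := Finsupp.linearCombination ℂ (fun I => word act I w) with hp
  set p' := Finsupp.linearCombination ℂ (fun I => word act' I w') with hp'
  -- A relation between the words of w makes the common Hermitian expression in its coefficients
  -- vanish, since ⟨w, w⟩ ≠ 0. The same combination of words of w' then has norm zero.
  have hker : ∀ a, p a = 0 → p' a = 0 := by
    intro a ha
    refine φ'.eq_zero_of_herm ?_ ?_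
    · rw [hp', Finsupp.linearCombination_apply]
      exact Submodule.sum_mem _ fun I _ => Submodule.smul_mem _ _ (word_mem hS' hwS' I)
    · have h1 := herm_sum_word φ h hw a
      have h2 := herm_sum_word φ' h' hw' a
      rw [← hp, ha, map_zero] at h1
      have h3 : φ.herm w w ≠ 0 := fun h0 => hw.1 (φ.eq_zero_of_herm hwS h0)
      rw [h2, (mul_eq_zero.mp h1.symm).resolve_right h3, zero_mul]
  -- Since ker p ≤ ker p', the map p' factors through p; the factor is p' composed with a section of
  -- p extended from its range to M.
  obtain ⟨s, hs⟩ := p.rangeRestrict.exists_rightInverse_of_surjective p.range_rangeRestrict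
  obtain ⟨s', hs'⟩ := s.exists_extend
  refine ⟨p' ∘ₗ s', fun I => ?_⟩
  have h1 : word act I w = p (Finsupp.single I 1) := by simp [hp]
  have h2 : word act' I w' = p' (Finsupp.single I 1) := by simp [hp']
  rw [h1, h2, LinearMap.comp_apply, ← sub_eq_zero, ← map_sub]
  refine hker _ ?_
  have h3 : s' (p (Finsupp.single I 1)) = s (p.rangeRestrict (Finsupp.single I 1)) :=
    LinearMap.congr_fun hs' (p.rangeRestrict (Finsupp.single I 1))
  have h4 : p (s (p.rangeRestrict (Finsupp.single I 1))) = p (Finsupp.single I 1) :=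
    congrArg Subtype.val (LinearMap.congr_fun hs (p.rangeRestrict (Finsupp.single I 1)))
  rw [map_sub, h3, h4, sub_self]

end Frames

/-! ### Iterated contractions -/

section Contractions

variable {E K : Type*} [AddCommGroup E] [Module ℂ E]

/-- The coordinates given by `n`-fold contractions. -/
def contrCoord (c : K → Module.End ℂ E) (ε : E →ₗ[ℂ] ℂ) :
    (n : ℕ) → E →ₗ[ℂ] ((Fin n → K) → ℂ)
  | 0 => LinearMap.pi fun _ => ε
  | n + 1 => LinearMap.pi fun k =>
      LinearMap.proj (Fin.tail k) ∘ₗ contrCoord c ε n ∘ₗ c (k 0)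

theorem contrCoord_zero (c : K → Module.End ℂ E) (ε : E →ₗ[ℂ] ℂ) (x : E) (k : Fin 0 → K) :
    contrCoord c ε 0 x k = ε x := rfl

theorem contrCoord_succ (c : K → Module.End ℂ E) (ε : E →ₗ[ℂ] ℂ) (n : ℕ) (x : E)
    (k : Fin (n + 1) → K) :
    contrCoord c ε (n + 1) x k = contrCoord c ε n (c (k 0) x) (Fin.tail k) := rfl

open Classical in
/-- The matrix of the derivation induced by a matrix on an `n`-fold tensor power. -/
def derMatrix (F : Matrix K K ℝ) : (n : ℕ) → Matrix (Fin n → K) (Fin n → K) ℝ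
  | 0 => 0
  | n + 1 => fun k l => F (k 0) (l 0) * (if Fin.tail k = Fin.tail l then 1 else 0) +
      (if k 0 = l 0 then 1 else 0) * derMatrix F n (Fin.tail k) (Fin.tail l)

open Classical in
theorem derMatrix_succ (F : Matrix K K ℝ) (n : ℕ) (k l : Fin (n + 1) → K) :
    derMatrix F (n + 1) k l = F (k 0) (l 0) * (if Fin.tail k = Fin.tail l then 1 else 0) +
      (if k 0 = l 0 then 1 else 0) * derMatrix F n (Fin.tail k) (Fin.tail l) := rfl

open Classical in
theorem derMatrix_transpose (F : Matrix K K ℝ) (n : ℕ) :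
    derMatrix F.transpose n = (derMatrix F n).transpose := by
  induction n with
  | zero => rfl
  | succ n ih =>
    ext k l
    simp only [derMatrix_succ, ih, Matrix.transpose_apply]
    congr 2 <;> exact if_congr eq_comm rfl rfl

theorem sum_fin_succ_fun [Fintype K] {n : ℕ} (G : (Fin (n + 1) → K) → ℂ) :
    ∑ l, G l = ∑ m, ∑ t : Fin n → K, G (Fin.cons m t) := by
  rw [← (Fin.consEquiv fun _ => K).sum_comp, Fintype.sum_prod_type]
  rfl

-- Each time f is moved past a contraction it leaves a term with the matrix F. Collecting these
-- gives the derivation that F induces on the n-th tensor power, and the term in which f has passed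
-- all contractions dies because ε ∘ f = 0.
open Classical in
theorem contrCoord_derivation [Fintype K] (c : K → Module.End ℂ E) (ε : E →ₗ[ℂ] ℂ) (f : Module.End ℂ E)
    (F : Matrix K K ℝ) (hε : ∀ x, ε (f x) = 0)
    (hc : ∀ k x, c k (f x) = f (c k x) + ∑ m, (F k m : ℂ) • c m x) (n : ℕ) (x : E) :
    contrCoord c ε n (f x) =
      ((derMatrix F n).map Complex.ofReal).mulVec (contrCoord c ε n x) := by
  induction n generalizing x with
  | zero =>
    ext k
    simp [contrCoord_zero, hε, derMatrix, Matrix.mulVec, dotProduct]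
  | succ n ih =>
    ext k
    rw [contrCoord_succ, hc, map_add, Pi.add_apply, ih, map_sum, Finset.sum_apply]
    simp only [map_smul, Pi.smul_apply, smul_eq_mul]
    rw [Matrix.mulVec, dotProduct, Matrix.mulVec, dotProduct, sum_fin_succ_fun]
    have h1 : ∀ (m : K) (t : Fin n → K),
        ((derMatrix F (n + 1)).map Complex.ofReal) k (Fin.cons m t) *
          contrCoord c ε (n + 1) x (Fin.cons m t) =
        (if k 0 = m then 1 else 0) * ((derMatrix F n).map Complex.ofReal (Fin.tail k) t *
          contrCoord c ε n (c m x) t) +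
        (if Fin.tail k = t then 1 else 0) * ((F (k 0) m : ℂ) * contrCoord c ε n (c m x) t) := by
      intro m t
      rw [contrCoord_succ, Matrix.map_apply, Matrix.map_apply, derMatrix_succ, Fin.tail_cons,
        Fin.cons_zero]
      by_cases h1 : Fin.tail k = t <;> by_cases h2 : k 0 = m <;> simp [h1, h2]
      ring
    simp only [h1, Finset.sum_add_distrib]
    congr 1
    · rw [Finset.sum_comm]
      simp
    · refine Finset.sum_congr rfl fun m _ => ?_
      simp

/-- Contractions lower the degree and are jointly injective in positive degree; descending to degree
0, the functional ε detects what is left. -/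
theorem contrCoord_injective (c : K → Module.End ℂ E) (ε : E →ₗ[ℂ] ℂ) (P : ℕ → Submodule ℂ E)
    (h0 : ∀ x ∈ P 0, ε x = 0 → x = 0) (hP : ∀ n k, ∀ x ∈ P (n + 1), c k x ∈ P n)
    (hE : ∀ n, ∀ x ∈ P (n + 1), (∀ k, c k x = 0) → x = 0) (n : ℕ) :
    ∀ x ∈ P n, contrCoord c ε n x = 0 → x = 0 := by
  induction n with
  | zero => exact fun x hx h => h0 x hx (congrFun h Fin.elim0)
  | succ n ih =>
    intro x hx h
    refine hE n x hx fun k => ih _ (hP n k x hx) ?_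
    funext l
    have h1 := congrFun h (Fin.cons k l)
    rwa [contrCoord_succ, Fin.cons_zero, Fin.tail_cons] at h1

end Contractions

/-! ### Contractions in the exterior algebra -/

section Exterior

variable {M : Type*} [AddCommGroup M] [Module ℂ M]

/-- Contraction in the exterior algebra. -/
def extContr (d : Module.Dual ℂ M) : Module.End ℂ (ExteriorAlgebra ℂ M) :=
  CliffordAlgebra.contractLeft (Q := (0 : QuadraticForm ℂ M)) d

theorem extContr_ι_mul (d : Module.Dual ℂ M) (m : M) (x : ExteriorAlgebra ℂ M) :
    extContr d (ExteriorAlgebra.ι ℂ m * x) =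
      d m • x - ExteriorAlgebra.ι ℂ m * extContr d x :=
  CliffordAlgebra.contractLeft_ι_mul _ _ _

theorem extContr_algebraMap (d : Module.Dual ℂ M) (r : ℂ) :
    extContr d (algebraMap ℂ (ExteriorAlgebra ℂ M) r) = 0 :=
  CliffordAlgebra.contractLeft_algebraMap _ _ _

theorem extContr_one (d : Module.Dual ℂ M) : extContr d (1 : ExteriorAlgebra ℂ M) = 0 :=
  CliffordAlgebra.contractLeft_one _ _

theorem extContr_smul (t : ℂ) (d : Module.Dual ℂ M) : extContr (t • d) = t • extContr d :=
  map_smul _ _ _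

theorem extContr_sum {K : Type*} (s : Finset K) (d : K → Module.Dual ℂ M) :
    extContr (∑ k ∈ s, d k) = ∑ k ∈ s, extContr (d k) :=
  map_sum _ _ _

theorem exteriorAlgebra_left_induction {P : ExteriorAlgebra ℂ M → Prop}
    (algebraMap : ∀ r : ℂ, P (algebraMap ℂ _ r)) (add : ∀ x y, P x → P y → P (x + y))
    (ι_mul : ∀ x m, P x → P (ExteriorAlgebra.ι ℂ m * x)) (x : ExteriorAlgebra ℂ M) : P x :=
  CliffordAlgebra.left_induction (Q := (0 : QuadraticForm ℂ M)) algebraMap add ι_mul x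

/-- Supplies the commutation hypothesis of `contrCoord_derivation`: the commutator of the
antiderivation of d with the derivation of f is the antiderivation with values d ∘ f on generators.
-/
theorem extContr_extDerAux (d : Module.Dual ℂ M) (f : Module.End ℂ M)
    (x : ExteriorAlgebra ℂ M) :
    extContr d (extDerAux f x) = extDerAux f (extContr d x) + extContr (d ∘ₗ f) x := by
  induction x using exteriorAlgebra_left_induction with
  | algebraMap r => simp [extDerAux_algebraMap, extContr_algebraMap]
  | add x y hx hy =>
    simp only [map_add, hx, hy]
    abel
  | ι_mul x m hx =>
    rw [extDerAux_mul, extDerAux_ι, map_add, extContr_ι_mul, extContr_ι_mul, extContr_ι_mul,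
      extContr_ι_mul, map_sub, map_smul, extDerAux_mul, extDerAux_ι, hx, mul_add]
    simp only [LinearMap.comp_apply]
    abel

theorem algebraMapInv_extDerAux (f : Module.End ℂ M) (x : ExteriorAlgebra ℂ M) :
    ExteriorAlgebra.algebraMapInv (extDerAux f x) = 0 := by
  induction x using exteriorAlgebra_left_induction with
  | algebraMap r => simp [extDerAux_algebraMap]
  | add x y hx hy => simp [hx, hy]
  | ι_mul x m hx => simp [extDerAux_mul, extDerAux_ι, ExteriorAlgebra.algebraMapInv]

theorem extContr_mem (d : Module.Dual ℂ M) (n : ℕ) :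
    ∀ x ∈ (⋀[ℂ]^(n + 1) M : Submodule ℂ (ExteriorAlgebra ℂ M)), extContr d x ∈ ⋀[ℂ]^n M := by
  induction n with
  | zero =>
    intro x hx
    rw [ExteriorAlgebra.exteriorPower, zero_add, pow_one] at hx
    obtain ⟨m, rfl⟩ := hx
    rw [ExteriorAlgebra.exteriorPower, pow_zero]
    exact Submodule.mem_one.mpr ⟨d m, (CliffordAlgebra.contractLeft_ι _ _ _).symm⟩
  | succ n ih =>
    intro x hx
    rw [ExteriorAlgebra.exteriorPower, pow_succ'] at hx
    refine Submodule.mul_induction_on hx ?_ ?_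
    · rintro _ ⟨m, rfl⟩ b hb
      rw [extContr_ι_mul]
      refine Submodule.sub_mem _ (Submodule.smul_mem _ _ hb) ?_
      rw [ExteriorAlgebra.exteriorPower, pow_succ']
      exact Submodule.mul_mem_mul ⟨m, rfl⟩ (ih b hb)
    · intro a b ha hb
      rw [map_add]
      exact Submodule.add_mem _ ha hb

/-- Euler's identity. In characteristic zero it shows that an element of positive degree with
vanishing contractions is zero. -/
theorem extContr_euler {K : Type*} [Fintype K] (d : K → Module.Dual ℂ M) (u : K → M)
    (hu : ∀ m, ∑ k, d k m • u k = m) (n : ℕ) :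
    ∀ x ∈ (⋀[ℂ]^n M : Submodule ℂ (ExteriorAlgebra ℂ M)),
      ∑ k, ExteriorAlgebra.ι ℂ (u k) * extContr (d k) x = (n : ℂ) • x := by
  induction n with
  | zero =>
    intro x hx
    rw [ExteriorAlgebra.exteriorPower, pow_zero] at hx
    obtain ⟨r, rfl⟩ := Submodule.mem_one.mp hx
    simp [extContr_algebraMap]
  | succ n ih =>
    intro x hx
    rw [ExteriorAlgebra.exteriorPower, pow_succ'] at hx
    refine Submodule.mul_induction_on hx ?_ ?_
    · rintro _ ⟨m, rfl⟩ b hb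
      have h1 : ∀ k, ExteriorAlgebra.ι ℂ (u k) * extContr (d k) (ExteriorAlgebra.ι ℂ m * b) =
          ExteriorAlgebra.ι ℂ (d k m • u k) * b + ExteriorAlgebra.ι ℂ m *
            (ExteriorAlgebra.ι ℂ (u k) * extContr (d k) b) := by
        intro k
        have h2 := ExteriorAlgebra.ι_add_mul_swap (R := ℂ) (u k) m
        rw [extContr_ι_mul, mul_sub, ← mul_assoc, ← mul_assoc, eq_neg_of_add_eq_zero_left h2,
          map_smul, mul_smul_comm, smul_mul_assoc, neg_mul, sub_neg_eq_add]
      simp only [h1]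
      rw [Finset.sum_add_distrib, ← Finset.sum_mul, ← map_sum, hu, ← Finset.mul_sum, ih b hb]
      push_cast
      rw [mul_smul_comm]
      module
    · intro a b ha hb
      simp only [map_add, mul_add, Finset.sum_add_distrib, ha, hb, smul_add]

end Exterior

/-! ### Contractions in the symmetric algebra -/

section Symmetric

variable {M : Type*} [AddCommGroup M] [Module ℂ M]

/-- `ι m ↦ ι m + ε d(m)`. -/
def symContrLift (d : Module.Dual ℂ M) :
    SymmetricAlgebra ℂ M →ₐ[ℂ] DualNumber (SymmetricAlgebra ℂ M) :=
  SymmetricAlgebra.lift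
    ((TrivSqZeroExt.inlAlgHom ℂ (SymmetricAlgebra ℂ M) (SymmetricAlgebra ℂ M)).toLinearMap ∘ₗ
        SymmetricAlgebra.ι ℂ M +
      (TrivSqZeroExt.inrHom (SymmetricAlgebra ℂ M) (SymmetricAlgebra ℂ M)).restrictScalars ℂ ∘ₗ
        Algebra.linearMap ℂ (SymmetricAlgebra ℂ M) ∘ₗ d)

/-- The derivation of the symmetric algebra extending a linear form. -/
def symContr (d : Module.Dual ℂ M) : Module.End ℂ (SymmetricAlgebra ℂ M) :=
  (TrivSqZeroExt.sndHom (SymmetricAlgebra ℂ M) (SymmetricAlgebra ℂ M)).restrictScalars ℂ ∘ₗ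
    (symContrLift d).toLinearMap

theorem symContrLift_fst (d : Module.Dual ℂ M) (x : SymmetricAlgebra ℂ M) :
    (symContrLift d x).fst = x := by
  have h : (TrivSqZeroExt.fstHom ℂ (SymmetricAlgebra ℂ M) (SymmetricAlgebra ℂ M)).comp
      (symContrLift d) = AlgHom.id ℂ _ := by
    ext m
    simp [symContrLift]
  exact DFunLike.congr_fun h x

theorem symContr_ι (d : Module.Dual ℂ M) (m : M) :
    symContr d (SymmetricAlgebra.ι ℂ M m) = algebraMap ℂ _ (d m) := by
  simp [symContr, symContrLift, Algebra.algebraMap_eq_smul_one]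

theorem symContr_mul (d : Module.Dual ℂ M) (x y : SymmetricAlgebra ℂ M) :
    symContr d (x * y) = x * symContr d y + symContr d x * y := by
  simp [symContr, symContrLift_fst]

theorem symContr_one (d : Module.Dual ℂ M) : symContr d (1 : SymmetricAlgebra ℂ M) = 0 := by
  simpa using symContr_mul d 1 1

theorem symContr_algebraMap (d : Module.Dual ℂ M) (r : ℂ) :
    symContr d (algebraMap ℂ (SymmetricAlgebra ℂ M) r) = 0 := by
  rw [Algebra.algebraMap_eq_smul_one, map_smul, symContr_one, smul_zero]

theorem symContr_sum_smul {K : Type*} [Fintype K] (t : K → ℂ) (d : K → Module.Dual ℂ M)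
    (x : SymmetricAlgebra ℂ M) :
    symContr (∑ k, t k • d k) x = ∑ k, t k • symContr (d k) x := by
  induction x using SymmetricAlgebra.induction with
  | algebraMap r => simp [symContr_algebraMap]
  | ι m => simp [symContr_ι, Algebra.smul_def]
  | mul a b ha hb =>
    rw [symContr_mul, ha, hb, Finset.mul_sum, Finset.sum_mul, ← Finset.sum_add_distrib]
    refine Finset.sum_congr rfl fun k _ => ?_
    rw [symContr_mul, smul_add, mul_smul_comm, smul_mul_assoc]
  | add a b ha hb => simp only [map_add, ha, hb, smul_add, Finset.sum_add_distrib]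

theorem symContr_symDer (d : Module.Dual ℂ M) (f : Module.End ℂ M) (x : SymmetricAlgebra ℂ M) :
    symContr d (symDer f x) = symDer f (symContr d x) + symContr (d ∘ₗ f) x := by
  induction x using SymmetricAlgebra.induction with
  | algebraMap r => simp [symDer_algebraMap, symContr_algebraMap]
  | ι m => simp [symDer_ι, symContr_ι, symDer_algebraMap]
  | mul a b ha hb =>
    simp only [symDer_mul, map_add, symContr_mul, ha, hb]
    ring
  | add a b ha hb =>
    simp only [map_add, ha, hb]
    abel

theorem algebraMapInv_symDer (f : Module.End ℂ M) (x : SymmetricAlgebra ℂ M) :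
    SymmetricAlgebra.algebraMapInv (symDer f x) = 0 := by
  induction x using SymmetricAlgebra.induction with
  | algebraMap r => simp [symDer_algebraMap]
  | ι m => simp [symDer_ι, SymmetricAlgebra.algebraMapInv_ι]
  | mul a b ha hb => simp [symDer_mul, ha, hb]
  | add a b ha hb => simp [ha, hb]

theorem symContr_mem (d : Module.Dual ℂ M) (n : ℕ) :
    ∀ x ∈ symPow (n + 1) (⊤ : Submodule ℂ M), symContr d x ∈ symPow n (⊤ : Submodule ℂ M) := by
  induction n with
  | zero =>
    intro x hx
    rw [symPow, zero_add, pow_one] at hx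
    obtain ⟨m, -, rfl⟩ := hx
    rw [symPow, pow_zero, symContr_ι]
    exact Submodule.mem_one.mpr ⟨d m, rfl⟩
  | succ n ih =>
    intro x hx
    rw [symPow, pow_succ'] at hx
    refine Submodule.mul_induction_on hx ?_ ?_
    · rintro _ ⟨m, hm, rfl⟩ b hb
      rw [symContr_mul, symContr_ι, ← Algebra.smul_def]
      refine Submodule.add_mem _ ?_ (Submodule.smul_mem _ _ hb)
      rw [symPow, pow_succ']
      exact Submodule.mul_mem_mul ⟨m, hm, rfl⟩ (ih b hb)
    · intro a b ha hb
      rw [map_add]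
      exact Submodule.add_mem _ ha hb

theorem symContr_euler {K : Type*} [Fintype K] (d : K → Module.Dual ℂ M) (u : K → M)
    (hu : ∀ m, ∑ k, d k m • u k = m) (n : ℕ) :
    ∀ x ∈ symPow n (⊤ : Submodule ℂ M),
      ∑ k, SymmetricAlgebra.ι ℂ M (u k) * symContr (d k) x = (n : ℂ) • x := by
  induction n with
  | zero =>
    intro x hx
    rw [symPow, pow_zero] at hx
    obtain ⟨r, rfl⟩ := Submodule.mem_one.mp hx
    simp [symContr_algebraMap]
  | succ n ih =>
    intro x hx
    rw [symPow, pow_succ'] at hx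
    refine Submodule.mul_induction_on hx ?_ ?_
    · rintro _ ⟨m, -, rfl⟩ b hb
      have h1 : ∀ k, SymmetricAlgebra.ι ℂ M (u k) *
          symContr (d k) (SymmetricAlgebra.ι ℂ M m * b) =
          SymmetricAlgebra.ι ℂ M (d k m • u k) * b + SymmetricAlgebra.ι ℂ M m *
            (SymmetricAlgebra.ι ℂ M (u k) * symContr (d k) b) := by
        intro k
        rw [symContr_mul, symContr_ι, map_smul, Algebra.smul_def]
        ring
      simp only [h1]
      rw [Finset.sum_add_distrib, ← Finset.sum_mul, ← map_sum, hu, ← Finset.mul_sum, ih b hb]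
      push_cast
      rw [mul_smul_comm]
      module
    · intro a b ha hb
      simp only [map_add, mul_add, Finset.sum_add_distrib, ha, hb, smul_add]

end Symmetric

/-! ### Frames on exterior and symmetric powers -/

namespace Frame

variable {M : Type*} [AddCommGroup M] [Module ℂ M] {act : Std → Std → Module.End ℂ M}

/-- The linear forms of a frame. -/
def dual {S : Submodule ℂ M} (φ : Frame act S) (k : φ.K) : Module.Dual ℂ M :=
  LinearMap.proj k ∘ₗ φ.coord

/-- The coordinates may be linearly dependent, so the u k are not a dual basis; they are the images
of the unit vectors under a left inverse of the coordinate map. -/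
theorem exists_dual_frame (φ : Frame act ⊤) : ∃ u : φ.K → M, ∀ m, ∑ k, φ.dual k m • u k = m := by
  classical
  obtain ⟨g, hg⟩ := φ.coord.exists_leftInverse_of_injective
    (LinearMap.ker_eq_bot'.mpr fun m hm => φ.inj m trivial hm)
  refine ⟨fun k => g (Pi.single k 1), fun m => ?_⟩
  have h1 := LinearMap.congr_fun hg m
  simp only [LinearMap.comp_apply, LinearMap.id_apply] at h1
  rw [pi_eq_sum_univ' (φ.coord m), map_sum] at h1
  refine Eq.trans (Finset.sum_congr rfl fun k _ => ?_) h1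
  rw [map_smul]
  rfl

theorem dual_comp {S : Submodule ℂ M} (φ : Frame act S) (f : Module.End ℂ M)
    (F : Matrix φ.K φ.K ℝ) (h : ∀ x, φ.coord (f x) = (F.map Complex.ofReal).mulVec (φ.coord x))
    (k : φ.K) : φ.dual k ∘ₗ f = ∑ m, (F k m : ℂ) • φ.dual m := by
  ext x
  have h1 := congrFun (h x) k
  simpa [Matrix.mulVec, dotProduct, dual] using h1

/-- The frame on an exterior power. -/
def exteriorPower (φ : Frame act ⊤) (n : ℕ) : Frame (fun a b => extDer n (act a b)) ⊤ where
  K := Fin n → φ.K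
  coord := contrCoord (fun k => extContr (φ.dual k))
    ExteriorAlgebra.algebraMapInv.toLinearMap n ∘ₗ (⋀[ℂ]^n M).subtype
  mat i := derMatrix (φ.mat i) n
  inj x _ hx := by
    obtain ⟨u, hu⟩ := φ.exists_dual_frame
    refine Subtype.ext (contrCoord_injective _ _ (fun n => ⋀[ℂ]^n M) ?_
      (fun n k => extContr_mem _ n) ?_ n x x.2 hx)
    · intro x hx h0
      rw [ExteriorAlgebra.exteriorPower, pow_zero] at hx
      obtain ⟨r, rfl⟩ := Submodule.mem_one.mp hx
      have h1 : r = 0 := by simpa using h0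
      rw [h1, map_zero]
    · intro n x hx h0
      have h1 := extContr_euler (fun k => φ.dual k) u hu (n + 1) x hx
      simp only [h0, mul_zero, Finset.sum_const_zero] at h1
      exact (smul_eq_zero.mp h1.symm).resolve_left (Nat.cast_ne_zero.mpr n.succ_ne_zero)
  lower i x := by
    have h1 : lowering (fun a b => extDer n (act a b)) i = extDer n (lowering act i) := by
      fin_cases i <;> rfl
    rw [h1]
    refine contrCoord_derivation _ _ (extDerAux (lowering act i)) (φ.mat i)
      (algebraMapInv_extDerAux _) (fun k y => ?_) n x
    rw [extContr_extDerAux, φ.dual_comp _ _ (φ.lower i), extContr_sum]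
    simp only [LinearMap.sum_apply, extContr_smul, LinearMap.smul_apply]
  raise i x := by
    have h1 : raising (fun a b => extDer n (act a b)) i = extDer n (raising act i) := by
      fin_cases i <;> rfl
    -- The induced matrices remain transposes of each other because `derMatrix` commutes with
    -- transposition.
    rw [h1, ← derMatrix_transpose]
    refine contrCoord_derivation _ _ (extDerAux (raising act i)) (φ.mat i).transpose
      (algebraMapInv_extDerAux _) (fun k y => ?_) n x
    rw [extContr_extDerAux, φ.dual_comp _ _ (φ.raise i), extContr_sum]
    simp only [LinearMap.sum_apply, extContr_smul, LinearMap.smul_apply]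

/-- The frame on a symmetric power. -/
def symPower (φ : Frame act ⊤) (n : ℕ) : Frame (fun a b => symDer (act a b)) (symPow n ⊤) where
  K := Fin n → φ.K
  coord := contrCoord (fun k => symContr (φ.dual k))
    SymmetricAlgebra.algebraMapInv.toLinearMap n
  mat i := derMatrix (φ.mat i) n
  inj x hx h := by
    obtain ⟨u, hu⟩ := φ.exists_dual_frame
    refine contrCoord_injective _ _ (fun n => symPow n ⊤) ?_
      (fun n k => symContr_mem _ n) ?_ n x hx h
    · intro x hx h0
      rw [symPow, pow_zero] at hx
      obtain ⟨r, rfl⟩ := Submodule.mem_one.mp hx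
      have h1 : r = 0 := by simpa using h0
      rw [h1, map_zero]
    · intro n x hx h0
      have h1 := symContr_euler (fun k => φ.dual k) u hu (n + 1) x hx
      simp only [h0, mul_zero, Finset.sum_const_zero] at h1
      exact (smul_eq_zero.mp h1.symm).resolve_left (Nat.cast_ne_zero.mpr n.succ_ne_zero)
  lower i x := by
    have h1 : lowering (fun a b => symDer (act a b)) i = symDer (lowering act i) := by
      fin_cases i <;> rfl
    rw [h1]
    refine contrCoord_derivation _ _ (symDer (lowering act i)) (φ.mat i)
      (algebraMapInv_symDer _) (fun k y => ?_) n x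
    rw [symContr_symDer, φ.dual_comp _ _ (φ.lower i), symContr_sum_smul]
  raise i x := by
    have h1 : raising (fun a b => symDer (act a b)) i = symDer (raising act i) := by
      fin_cases i <;> rfl
    rw [h1, ← derMatrix_transpose]
    refine contrCoord_derivation _ _ (symDer (raising act i)) (φ.mat i).transpose
      (algebraMapInv_symDer _) (fun k y => ?_) n x
    rw [symContr_symDer, φ.dual_comp _ _ (φ.raise i), symContr_sum_smul]

end Frame

/-! ### Monomials in exterior algebras -/

section Monomials

variable {M : Type*} [AddCommGroup M] [Module ℂ M] {κ : Type*}

/-- The exterior product of the vectors `b i`, for `i` in a list. -/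
def mono (b : κ → M) (L : List κ) : ExteriorAlgebra ℂ M :=
  (L.map fun i => ExteriorAlgebra.ι ℂ (b i)).prod

theorem mono_cons (b : κ → M) (i : κ) (L : List κ) :
    mono b (i :: L) = ExteriorAlgebra.ι ℂ (b i) * mono b L := by
  simp [mono]

theorem ι_mul_ι_swap (m m' : M) (x : ExteriorAlgebra ℂ M) :
    ExteriorAlgebra.ι ℂ m * (ExteriorAlgebra.ι ℂ m' * x) =
      -(ExteriorAlgebra.ι ℂ m' * (ExteriorAlgebra.ι ℂ m * x)) := by
  have h2 := ExteriorAlgebra.ι_add_mul_swap (R := ℂ) m m'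
  rw [← mul_assoc, ← mul_assoc, eq_neg_of_add_eq_zero_left h2, neg_mul]

theorem ι_mul_ι_self (m : M) (x : ExteriorAlgebra ℂ M) :
    ExteriorAlgebra.ι ℂ m * (ExteriorAlgebra.ι ℂ m * x) = 0 := by
  rw [← mul_assoc, ExteriorAlgebra.ι_sq_zero, zero_mul]

/-- Insertion of a factor into an ordered monomial, with its sign. -/
def insertMono [LT κ] [DecidableLT κ] [DecidableEq κ] (i : κ) : List κ → ℤ × List κ
  | [] => (1, [i])
  | j :: L => if i < j then (1, i :: j :: L) else if i = j then (0, []) else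
      (-(insertMono i L).1, j :: (insertMono i L).2)

theorem ι_mul_mono [LT κ] [DecidableLT κ] [DecidableEq κ] (b : κ → M) (i : κ) (L : List κ) :
    ExteriorAlgebra.ι ℂ (b i) * mono b L =
      ((insertMono i L).1 : ℂ) • mono b (insertMono i L).2 := by
  induction L with
  | nil => simp [insertMono, mono]
  | cons j L ih =>
    rw [insertMono]
    split_ifs with h1 h2
    · simp [mono_cons]
    · rw [h2, mono_cons, ι_mul_ι_self]
      simp
    · rw [mono_cons, ι_mul_ι_swap, ih, mono_cons, mul_smul_comm]
      push_cast
      module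

/-- Contraction of a monomial without repeated factors, with its sign. -/
def contrMono [DecidableEq κ] (i : κ) : List κ → ℤ × List κ
  | [] => (0, [])
  | j :: L => if i = j then (1, L) else (-(contrMono i L).1, j :: (contrMono i L).2)

theorem extContr_mono_of_notMem [DecidableEq κ] (b : κ → M) (d : κ → Module.Dual ℂ M)
    (hd : ∀ i j, d i (b j) = if i = j then 1 else 0) (i : κ) (L : List κ) (hL : i ∉ L) :
    extContr (d i) (mono b L) = 0 := by
  induction L with
  | nil => exact extContr_one _
  | cons j L ih =>
    rw [List.mem_cons, not_or] at hL
    rw [mono_cons, extContr_ι_mul, hd, if_neg hL.1, ih hL.2]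
    simp

theorem extContr_mono [DecidableEq κ] (b : κ → M) (d : κ → Module.Dual ℂ M)
    (hd : ∀ i j, d i (b j) = if i = j then 1 else 0) (i : κ) (L : List κ) (hL : L.Nodup) :
    extContr (d i) (mono b L) = ((contrMono i L).1 : ℂ) • mono b (contrMono i L).2 := by
  induction L with
  | nil => simp [contrMono, mono, extContr_one]
  | cons j L ih =>
    rw [List.nodup_cons] at hL
    rw [mono_cons, extContr_ι_mul, hd, contrMono]
    split_ifs with h
    · rw [extContr_mono_of_notMem b d hd i L (h ▸ hL.1)]
      simp
    · rw [ih hL.2, mono_cons, mul_smul_comm]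
      push_cast
      module

theorem involute_mono (b : κ → M) (L : List κ) :
    CliffordAlgebra.involute (Q := (0 : QuadraticForm ℂ M)) (mono b L) =
      (-1 : ℂ) ^ L.length • mono b L := by
  induction L with
  | nil => simp [mono]
  | cons j L ih =>
    have h1 : CliffordAlgebra.involute (Q := (0 : QuadraticForm ℂ M))
        (ExteriorAlgebra.ι ℂ (b j)) = -ExteriorAlgebra.ι ℂ (b j) :=
      CliffordAlgebra.involute_ι _
    rw [mono_cons, map_mul, ih, h1, List.length_cons, pow_succ, mul_smul_comm]
    simp

end Monomials

/-! ### Coordinates on the half-spin space -/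

/-- The basis of `U_∞`. -/
def uVec (i : Fin 5) : U := Pi.single i 1

/-- The dual basis. -/
def uDual (i : Fin 5) : Module.Dual ℂ U := LinearMap.proj i

theorem uDual_uVec (i j : Fin 5) : uDual i (uVec j) = if i = j then 1 else 0 := by
  simp [uDual, uVec, Pi.single_apply]

/-- The subsets indexing the basis of `S⁺`. -/
def evenIdx : Fin 16 → List (Fin 5) :=
  ![[], [0, 1], [0, 2], [0, 3], [0, 4], [1, 2], [1, 3], [1, 4], [2, 3], [2, 4], [3, 4],
    [0, 1, 2, 3], [0, 1, 2, 4], [0, 1, 3, 4], [0, 2, 3, 4], [1, 2, 3, 4]]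

/-- The subsets indexing the basis of `S⁻`. -/
def oddIdx : Fin 16 → List (Fin 5) :=
  ![[0], [1], [2], [3], [4], [0, 1, 2], [0, 1, 3], [0, 1, 4], [0, 2, 3], [0, 2, 4], [0, 3, 4],
    [1, 2, 3], [1, 2, 4], [1, 3, 4], [2, 3, 4], [0, 1, 2, 3, 4]]

/-- The span of the ordered monomials contains 1 and is stable under left multiplication by
generators. -/
theorem span_mono_eq_top :
    ⊤ ≤ Submodule.span ℂ (Set.range fun k => mono uVec (Sum.elim evenIdx oddIdx k)) := by
  set S := Submodule.span ℂ (Set.range fun k => mono uVec (Sum.elim evenIdx oddIdx k))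
  -- A finite check: inserting a letter into one of the 32 ordered monomials gives sign zero or
  -- another of the 32.
  have h1 : ∀ i k, (insertMono i (Sum.elim evenIdx oddIdx k)).1 = 0 ∨
      ∃ l, Sum.elim evenIdx oddIdx l = (insertMono i (Sum.elim evenIdx oddIdx k)).2 := by
    decide +kernel
  have h2 : ∀ i, ∀ x ∈ S, ExteriorAlgebra.ι ℂ (uVec i) * x ∈ S := by
    intro i x hx
    refine Submodule.span_induction (p := fun x _ => ExteriorAlgebra.ι ℂ (uVec i) * x ∈ S)
      ?_ ?_ ?_ ?_ hx
    · rintro _ ⟨k, rfl⟩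
      change ExteriorAlgebra.ι ℂ (uVec i) * mono uVec _ ∈ S
      rw [ι_mul_mono]
      rcases h1 i k with h | ⟨l, hl⟩
      · rw [h]
        simp
      · rw [← hl]
        exact Submodule.smul_mem _ _ (Submodule.subset_span ⟨l, rfl⟩)
    · simp
    · intro x y _ _ hx hy
      rw [mul_add]
      exact S.add_mem hx hy
    · intro t x _ hx
      rw [mul_smul_comm]
      exact S.smul_mem t hx
  rintro x -
  induction x using exteriorAlgebra_left_induction with
  | algebraMap r =>
    rw [Algebra.algebraMap_eq_smul_one]
    exact S.smul_mem r (Submodule.subset_span ⟨Sum.inl 0, rfl⟩)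
  | add x y hx hy => exact S.add_mem hx hy
  | ι_mul x m hx =>
    have h3 : m = ∑ i, m i • uVec i := pi_eq_sum_univ' m
    rw [h3, map_sum, Finset.sum_mul]
    refine S.sum_mem fun i _ => ?_
    rw [map_smul, smul_mul_assoc]
    exact S.smul_mem _ (h2 i x hx)

/-- Thirty-two vectors spanning a space of dimension 2⁵. -/
theorem linearIndependent_mono :
    LinearIndependent ℂ fun k => mono uVec (Sum.elim evenIdx oddIdx k) := by
  refine linearIndependent_of_top_le_span_of_card_eq_finrank span_mono_eq_top ?_
  rw [Module.finrank_eq_card_basis (Pi.basisFun ℂ (Fin 5)).ExteriorAlgebra]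
  simp

theorem evenIdx_length (a : Fin 16) : (-1 : ℂ) ^ (evenIdx a).length = 1 := by
  fin_cases a <;> norm_num [evenIdx]

theorem oddIdx_length (a : Fin 16) : (-1 : ℂ) ^ (oddIdx a).length = -1 := by
  fin_cases a <;> norm_num [oddIdx]

theorem mono_even_mem (a : Fin 16) : mono uVec (evenIdx a) ∈ Splus := by
  have h : ∀ L : List (Fin 5), mono uVec L ∈
      CliffordAlgebra.evenOdd (0 : QuadraticForm ℂ U) (L.length : ZMod 2) := by
    intro L
    induction L with
    | nil => exact CliffordAlgebra.one_le_evenOdd_zero _ (Submodule.mem_one.mpr ⟨1, map_one _⟩)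
    | cons i L ih =>
      rw [mono_cons, List.length_cons, Nat.cast_succ, add_comm]
      exact CliffordAlgebra.evenOdd_mul_le _ 1 _
        (Submodule.mul_mem_mul (CliffordAlgebra.ι_mem_evenOdd_one _ _) ih)
  have h1 := h (evenIdx a)
  have h2 : ∀ a, (((evenIdx a).length : ℕ) : ZMod 2) = 0 := by decide
  rwa [h2 a] at h1

/-- The basis vectors of `S⁺`. -/
def sVec (a : Fin 16) : Splus := ⟨mono uVec (evenIdx a), mono_even_mem a⟩

theorem linearIndependent_sVec : LinearIndependent ℂ sVec := by
  refine LinearIndependent.of_comp Splus.subtype ?_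
  exact linearIndependent_mono.comp Sum.inl Sum.inl_injective

/-- The grade involution fixes S⁺ and negates the odd monomials, so averaging an expansion with its
image removes its odd part. -/
theorem span_sVec : ⊤ ≤ Submodule.span ℂ (Set.range sVec) := by
  rintro ⟨x, hx⟩ -
  obtain ⟨t, ht⟩ := (Submodule.mem_span_range_iff_exists_fun ℂ).mp
    (span_mono_eq_top (Submodule.mem_top (x := x)))
  have h1 : CliffordAlgebra.involute (Q := (0 : QuadraticForm ℂ U)) x = x :=
    CliffordAlgebra.involute_eq_of_mem_even hx
  rw [Fintype.sum_sum_type] at ht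
  simp only [Sum.elim_inl, Sum.elim_inr] at ht
  have h2 : (∑ a, t (Sum.inl a) • mono uVec (evenIdx a)) -
      ∑ a, t (Sum.inr a) • mono uVec (oddIdx a) = x := by
    conv_rhs => rw [← h1]
    rw [← ht, map_add, map_sum, map_sum]
    simp only [map_smul, involute_mono, evenIdx_length, oddIdx_length, one_smul, neg_smul,
      smul_neg, Finset.sum_neg_distrib, sub_eq_add_neg]
  have h3 : x = ∑ a, t (Sum.inl a) • mono uVec (evenIdx a) := by
    have h4 : (2 : ℂ) • x = (2 : ℂ) • ∑ a, t (Sum.inl a) • mono uVec (evenIdx a) := by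
      rw [two_smul, two_smul]
      nth_rewrite 1 [← ht]
      rw [← h2]
      abel
    exact smul_right_injective _ (two_ne_zero) h4
  have h5 : (⟨x, hx⟩ : Splus) = ∑ a, t (Sum.inl a) • sVec a := by
    refine Subtype.ext ?_
    simpa [sVec] using h3
  rw [h5]
  exact Submodule.sum_mem _ fun a _ => Submodule.smul_mem _ _ (Submodule.subset_span ⟨a, rfl⟩)

/-- The basis of `S⁺`. -/
def sBasis : Module.Basis (Fin 16) ℂ Splus := Module.Basis.mk linearIndependent_sVec span_sVec

theorem sBasis_apply (a : Fin 16) : sBasis a = sVec a := by simp [sBasis]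

/-- The basis vectors `eᵢ` (index `(false, i)`) and `e₋ᵢ` (index `(true, i)`) of `Std`. -/
def stdVec (p : Bool × Fin 5) : Std := if p.1 then em p.2 else e p.2

/-- The action of a basis vector of `Std` on a monomial. -/
def gammaMono (p : Bool × Fin 5) (L : List (Fin 5)) : ℤ × List (Fin 5) :=
  if p.1 then contrMono p.2 L else insertMono p.2 L

theorem spinor_mono (p : Bool × Fin 5) (L : List (Fin 5)) (hL : L.Nodup) :
    spinor (CliffordAlgebra.ι Q (stdVec p)) (mono uVec L) =
      ((gammaMono p L).1 : ℂ) • mono uVec (gammaMono p L).2 := by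
  have h1 : ∀ (d : Module.Dual ℂ U) (u : U) (x : ExteriorAlgebra ℂ U),
      spinor (CliffordAlgebra.ι Q (d, u)) x = extContr d x + ExteriorAlgebra.ι ℂ u * x := by
    intro d u x
    simp [spinor, extContr]
  obtain ⟨b, i⟩ := p
  cases b
  · have h2 := ι_mul_mono uVec i L
    simp only [stdVec, e, gammaMono, Bool.false_eq_true, if_false, h1]
    rw [← h2, ← zero_smul ℂ (0 : Module.Dual ℂ U), extContr_smul]
    simp [uVec]
  · have h2 := extContr_mono uVec uDual uDual_uVec i L hL
    simp only [stdVec, em, gammaMono, if_true, h1]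
    rw [← h2]
    simp [uDual]

/-- The index in `Std` of the dual basis vector. -/
def dualIdx (p : Bool × Fin 5) : Bool × Fin 5 := (!p.1, p.2)

theorem polar_stdVec (p q : Bool × Fin 5) :
    QuadraticMap.polar Q (stdVec p) (stdVec q) = if dualIdx p = q then 1 else 0 := by
  have h := polarBilin_Q (stdVec p) (stdVec q)
  rw [QuadraticMap.polarBilin_apply_apply] at h
  rw [h]
  obtain ⟨b, i⟩ := p
  obtain ⟨c, j⟩ := q
  cases b <;> cases c <;> simp [stdVec, e, em, dualIdx, Pi.single_apply, eq_comm]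

/-- Orthogonal vectors anticommute, so half their commutator is their product. -/
theorem bivector_stdVec (p q : Bool × Fin 5) (h : dualIdx p ≠ q) :
    (bivector (stdVec p) (stdVec q) : CliffordAlgebra Q) =
      CliffordAlgebra.ι Q (stdVec p) * CliffordAlgebra.ι Q (stdVec q) := by
  have h1 := CliffordAlgebra.ι_mul_ι_add_swap (Q := Q) (stdVec p) (stdVec q)
  rw [polar_stdVec, if_neg h, map_zero] at h1
  rw [coe_bivector, eq_neg_of_add_eq_zero_right h1]
  module

theorem bivector_stdVec_dual (p : Bool × Fin 5) :
    (bivector (stdVec p) (stdVec (dualIdx p)) : CliffordAlgebra Q) =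
      CliffordAlgebra.ι Q (stdVec p) * CliffordAlgebra.ι Q (stdVec (dualIdx p)) -
        algebraMap ℂ _ 2⁻¹ := by
  have h1 := CliffordAlgebra.ι_mul_ι_add_swap (Q := Q) (stdVec p) (stdVec (dualIdx p))
  rw [polar_stdVec, if_pos rfl, map_one] at h1
  rw [coe_bivector, eq_sub_of_add_eq' h1, Algebra.algebraMap_eq_smul_one]
  module

/-- The action of the product of two basis vectors of `Std` on the basis of `S⁺`. -/
def spinTable (p q : Bool × Fin 5) (a : Fin 16) : ℤ × Fin 16 :=
  let x := gammaMono q (evenIdx a)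
  let y := gammaMono p x.2
  -- The default index 0 is harmless: an unsuccessful search only occurs with coefficient zero, as
  -- the check `h3` in `spinor_spinTable` confirms.
  (x.1 * y.1, ((List.finRange 16).find? fun b => evenIdx b = y.2).getD 0)

theorem spinor_spinTable (p q : Bool × Fin 5) (a : Fin 16) :
    spinor (CliffordAlgebra.ι Q (stdVec p) * CliffordAlgebra.ι Q (stdVec q))
      (mono uVec (evenIdx a)) =
        ((spinTable p q a).1 : ℂ) • mono uVec (evenIdx (spinTable p q a).2) := by
  have h1 : ∀ a, (evenIdx a).Nodup := by decide
  -- A list that comes with sign zero has no meaning, so both finite checks allow for vanishing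
  -- signs.
  have h2 : ∀ q a, (gammaMono q (evenIdx a)).1 = 0 ∨ (gammaMono q (evenIdx a)).2.Nodup := by
    decide +kernel
  have h3 : ∀ p q a, (spinTable p q a).1 = 0 ∨
      evenIdx (spinTable p q a).2 = (gammaMono p (gammaMono q (evenIdx a)).2).2 := by
    decide +kernel
  rw [map_mul, Module.End.mul_apply, spinor_mono q _ (h1 a), map_smul]
  rcases h2 q a with h | h
  · have h4 : (spinTable p q a).1 = 0 := by simp [spinTable, h]
    rw [h, h4]
    simp
  · rw [spinor_mono p _ h, smul_smul, ← Int.cast_mul]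
    change ((spinTable p q a).1 : ℂ) • _ = _
    rcases h3 p q a with h4 | h4
    · rw [h4]
      simp
    · rw [h4]

theorem coe_spinAct (a b : Std) (x : Splus) : ((spinAct a b x : Splus) : ExteriorAlgebra ℂ U) =
    spinor (bivector a b : CliffordAlgebra Q) x := rfl

theorem spinAct_sVec (p q : Bool × Fin 5) (h : dualIdx p ≠ q) (a : Fin 16) :
    spinAct (stdVec p) (stdVec q) (sVec a) =
      ((spinTable p q a).1 : ℂ) • sVec (spinTable p q a).2 := by
  refine Subtype.ext ?_
  rw [coe_spinAct, bivector_stdVec p q h]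
  exact spinor_spinTable p q a

theorem spinAct_sVec_dual (p : Bool × Fin 5) (a : Fin 16) :
    spinAct (stdVec p) (stdVec (dualIdx p)) (sVec a) =
      ((spinTable p (dualIdx p) a).1 : ℂ) • sVec (spinTable p (dualIdx p) a).2 -
        (2⁻¹ : ℂ) • sVec a := by
  refine Subtype.ext ?_
  rw [coe_spinAct, bivector_stdVec_dual, map_sub, LinearMap.sub_apply, AlgHom.commutes,
    Module.algebraMap_end_apply]
  congr 1
  exact spinor_spinTable p (dualIdx p) a

/-! ### Frames on `Std` and `S⁺` -/

/-- A basis in which the lowering operators are real and the raising operators are their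
transposes is a frame. -/
def Frame.ofBasis {M : Type*} [AddCommGroup M] [Module ℂ M] {act : Std → Std → Module.End ℂ M}
    {K : Type} [Fintype K] (b : Module.Basis K ℂ M) (F : Fin 5 → Matrix K K ℝ)
    (hl : ∀ i k, lowering act i (b k) = ∑ j, (F i j k : ℂ) • b j)
    (hr : ∀ i k, raising act i (b k) = ∑ j, (F i k j : ℂ) • b j) : Frame act ⊤ where
  K := K
  coord := b.equivFun.toLinearMap
  mat := F
  inj x _ hx := b.equivFun.map_eq_zero_iff.mp hx
  lower i x := by
    have h : b.equivFun.toLinearMap ∘ₗ lowering act i =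
        ((F i).map Complex.ofReal).mulVecLin ∘ₗ b.equivFun.toLinearMap := by
      classical
      refine b.ext fun k => ?_
      ext j
      simp [-Complex.coe_smul, hl, Finsupp.single_apply, Matrix.mulVec, dotProduct]
    exact LinearMap.congr_fun h x
  raise i x := by
    have h : b.equivFun.toLinearMap ∘ₗ raising act i =
        ((F i).transpose.map Complex.ofReal).mulVecLin ∘ₗ b.equivFun.toLinearMap := by
      classical
      refine b.ext fun k => ?_
      ext j
      simp [-Complex.coe_smul, hr, Finsupp.single_apply, Matrix.mulVec, dotProduct]
    exact LinearMap.congr_fun h x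

theorem linearIndependent_stdVec : LinearIndependent ℂ stdVec := by
  refine Fintype.linearIndependent_iff.mpr fun g hg p => ?_
  have h1 := congrArg (QuadraticMap.polarBilin Q (stdVec (dualIdx p))) hg
  have h2 : dualIdx (dualIdx p) = p := by simp [dualIdx]
  rw [map_sum, map_zero] at h1
  simpa [polar_stdVec, h2] using h1

theorem span_stdVec : ⊤ ≤ Submodule.span ℂ (Set.range stdVec) := by
  rintro v -
  rw [std_decomposition v]
  refine Submodule.add_mem _ (Submodule.sum_mem _ fun i _ => Submodule.smul_mem _ _ ?_)
    (Submodule.sum_mem _ fun i _ => Submodule.smul_mem _ _ ?_)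
  · exact Submodule.subset_span ⟨(false, i), rfl⟩
  · exact Submodule.subset_span ⟨(true, i), rfl⟩

/-- The basis of `Std`. -/
def stdBasis : Module.Basis (Bool × Fin 5) ℂ Std :=
  Module.Basis.mk linearIndependent_stdVec span_stdVec

theorem stdBasis_apply (p : Bool × Fin 5) : stdBasis p = stdVec p := by simp [stdBasis]

/-- The matrix entries of `stdAct`. -/
def stdEntry (p q j r : Bool × Fin 5) : ℤ :=
  (if dualIdx q = r ∧ j = p then 1 else 0) - if dualIdx p = r ∧ j = q then 1 else 0

theorem stdAct_stdVec (p q r : Bool × Fin 5) :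
    stdAct (stdVec p) (stdVec q) (stdVec r) = ∑ j, (stdEntry p q j r : ℂ) • stdVec j := by
  have h : stdAct (stdVec p) (stdVec q) (stdVec r) =
      (if dualIdx q = r then (1 : ℂ) else 0) • stdVec p -
        (if dualIdx p = r then (1 : ℂ) else 0) • stdVec q := by
    rw [← polar_stdVec, ← polar_stdVec]
    simp [stdAct]
  rw [h]
  simp only [stdEntry]
  push_cast
  simp only [sub_smul, Finset.sum_sub_distrib]
  congr 1
  · by_cases h1 : dualIdx q = r <;> simp [h1]
  · by_cases h1 : dualIdx p = r <;> simp [h1]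

/-- The pairs of basis vectors of `Std` giving the lowering operators. -/
def lowIdx : Fin 5 → (Bool × Fin 5) × (Bool × Fin 5) :=
  ![((false, 1), (true, 0)), ((false, 2), (true, 1)), ((false, 3), (true, 2)),
    ((false, 4), (true, 3)), ((true, 4), (true, 3))]

/-- The pairs of basis vectors of `Std` giving the raising operators. -/
def raiseIdx : Fin 5 → (Bool × Fin 5) × (Bool × Fin 5) :=
  ![((false, 0), (true, 1)), ((false, 1), (true, 2)), ((false, 2), (true, 3)),
    ((false, 3), (true, 4)), ((false, 3), (false, 4))]

theorem lowering_eq {M : Type*} [AddCommGroup M] [Module ℂ M]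
    (act : Std → Std → Module.End ℂ M) (i : Fin 5) :
    lowering act i = act (stdVec (lowIdx i).1) (stdVec (lowIdx i).2) := by
  fin_cases i <;> rfl

theorem raising_eq {M : Type*} [AddCommGroup M] [Module ℂ M]
    (act : Std → Std → Module.End ℂ M) (i : Fin 5) :
    raising act i = act (stdVec (raiseIdx i).1) (stdVec (raiseIdx i).2) := by
  fin_cases i <;> rfl

/-- The frame on `Std`. -/
def stdFrame : Frame stdAct ⊤ :=
  Frame.ofBasis stdBasis (fun i j k => (stdEntry (lowIdx i).1 (lowIdx i).2 j k : ℝ))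
    (fun i k => by
      simp only [stdBasis_apply, lowering_eq, stdAct_stdVec]
      push_cast
      rfl)
    (fun i k => by
      have h : ∀ i k j, stdEntry (raiseIdx i).1 (raiseIdx i).2 j k =
        stdEntry (lowIdx i).1 (lowIdx i).2 k j := by decide +kernel
      simp only [stdBasis_apply, raising_eq, stdAct_stdVec, h]
      push_cast
      rfl)

/-- The matrix entries of `spinAct`. -/
def spinEntry (p q : Bool × Fin 5) (b a : Fin 16) : ℤ :=
  if b = (spinTable p q a).2 then (spinTable p q a).1 else 0

theorem spinAct_sVec_sum (p q : Bool × Fin 5) (h : dualIdx p ≠ q) (a : Fin 16) :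
    spinAct (stdVec p) (stdVec q) (sVec a) = ∑ b, (spinEntry p q b a : ℂ) • sVec b := by
  rw [spinAct_sVec p q h]
  simp [spinEntry, ite_smul]

theorem lowIdx_ne (i : Fin 5) : dualIdx (lowIdx i).1 ≠ (lowIdx i).2 := by
  revert i
  decide

theorem raiseIdx_ne (i : Fin 5) : dualIdx (raiseIdx i).1 ≠ (raiseIdx i).2 := by
  revert i
  decide

/-- The frame on `S⁺`. -/
def spinFrame : Frame spinAct ⊤ :=
  Frame.ofBasis sBasis (fun i j k => (spinEntry (lowIdx i).1 (lowIdx i).2 j k : ℝ))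
    (fun i k => by
      simp only [sBasis_apply, lowering_eq, spinAct_sVec_sum _ _ (lowIdx_ne i)]
      push_cast
      rfl)
    (fun i k => by
      -- In the monomial basis the raising and lowering matrices are transposes of each other, which
      -- is checked entry by entry.
      have h : ∀ i k j, spinEntry (raiseIdx i).1 (raiseIdx i).2 j k =
        spinEntry (lowIdx i).1 (lowIdx i).2 k j := by decide +kernel
      simp only [sBasis_apply, raising_eq, spinAct_sVec_sum _ _ (raiseIdx_ne i), h]
      push_cast
      rfl)

/-- The frame on `Λ⁷ S⁺`. -/
def lambdaFrame : Frame lambdaAct ⊤ := spinFrame.exteriorPower 7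

/-- The frame on `Sym² Λ⁷ S⁺`. -/
def symLFrame : Frame symLAct (symPow 2 ⊤) := lambdaFrame.symPower 2

/-- The frame on `Sym⁵ Std`. -/
def symStdFrame : Frame symStdAct (symPow 5 ⊤) := stdFrame.symPower 5

/-! ### Calculations with monomials in `Λ S⁺` -/

/-- Integral combinations of monomials in the basis vectors of `S⁺`. -/
abbrev SPoly : Type := List (ℤ × List (Fin 16))

/-- The element of `Λ S⁺` represented by a combination of monomials. -/
def evalPoly (p : SPoly) : ExteriorAlgebra ℂ Splus :=
  (p.map fun t => (t.1 : ℂ) • mono sVec t.2).sum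

theorem evalPoly_cons (t : ℤ × List (Fin 16)) (p : SPoly) :
    evalPoly (t :: p) = (t.1 : ℂ) • mono sVec t.2 + evalPoly p := by
  simp [evalPoly]

theorem evalPoly_append (p q : SPoly) : evalPoly (p ++ q) = evalPoly p + evalPoly q := by
  simp [evalPoly]

/-- Multiplication of a combination of monomials by a monomial of degree one. -/
def consPoly (z : ℤ) (a : Fin 16) (p : SPoly) : SPoly := p.map fun t => (z * t.1, a :: t.2)

theorem evalPoly_consPoly (z : ℤ) (a : Fin 16) (p : SPoly) :
    evalPoly (consPoly z a p) = (z : ℂ) • (ExteriorAlgebra.ι ℂ (sVec a) * evalPoly p) := by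
  induction p with
  | nil => simp [consPoly, evalPoly]
  | cons t p ih =>
    rw [consPoly, List.map_cons, evalPoly_cons, evalPoly_cons, ← consPoly, ih]
    simp only [mono_cons, mul_add, mul_smul_comm]
    push_cast
    module

/-- The ordered monomial, with sign, equal to a given monomial. -/
def sortMono : List (Fin 16) → ℤ × List (Fin 16)
  | [] => (1, [])
  | a :: L => ((sortMono L).1 * (insertMono a (sortMono L).2).1, (insertMono a (sortMono L).2).2)

theorem mono_sortMono (L : List (Fin 16)) :
    mono sVec L = ((sortMono L).1 : ℂ) • mono sVec (sortMono L).2 := by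
  induction L with
  | nil => simp [sortMono]
  | cons a L ih =>
    rw [mono_cons, ih, mul_smul_comm, ι_mul_mono, sortMono]
    push_cast
    module

/-- Addition of a term to a combination of monomials. -/
def addTerm (z : ℤ) (L : List (Fin 16)) : SPoly → SPoly
  | [] => [(z, L)]
  | t :: p => if t.2 = L then (t.1 + z, L) :: p else t :: addTerm z L p

theorem evalPoly_addTerm (z : ℤ) (L : List (Fin 16)) (p : SPoly) :
    evalPoly (addTerm z L p) = (z : ℂ) • mono sVec L + evalPoly p := by
  induction p with
  | nil => simp [addTerm, evalPoly]
  | cons t p ih =>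
    rw [addTerm]
    split_ifs with h
    · rw [evalPoly_cons, evalPoly_cons, h]
      push_cast
      module
    · rw [evalPoly_cons, evalPoly_cons, ih]
      module

/-- Collection of the terms of a combination of monomials. -/
def normPoly : SPoly → SPoly
  | [] => []
  | t :: p => if t.1 * (sortMono t.2).1 = 0 then normPoly p else
      (addTerm (t.1 * (sortMono t.2).1) (sortMono t.2).2 (normPoly p)).filter fun s => s.1 ≠ 0

theorem evalPoly_filter (p : SPoly) : evalPoly (p.filter fun s => s.1 ≠ 0) = evalPoly p := by
  induction p with
  | nil => rfl
  | cons t p ih =>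
    by_cases h : t.1 = 0
    · rw [List.filter_cons_of_neg (by simp [h]), ih, evalPoly_cons, h]
      simp
    · rw [List.filter_cons_of_pos (by simp [h]), evalPoly_cons, evalPoly_cons, ih]

theorem evalPoly_normPoly (p : SPoly) : evalPoly (normPoly p) = evalPoly p := by
  induction p with
  | nil => rfl
  | cons t p ih =>
    rw [normPoly, evalPoly_cons, mono_sortMono t.2, smul_smul, ← Int.cast_mul]
    split_ifs with h
    · rw [h, ih]
      simp
    · rw [evalPoly_filter, evalPoly_addTerm, ih]

/-- The derivation of a monomial induced by `stdVec p * stdVec q`. -/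
def derMono (p q : Bool × Fin 5) : List (Fin 16) → SPoly
  | [] => []
  | a :: L => ((spinTable p q a).1, (spinTable p q a).2 :: L) :: consPoly 1 a (derMono p q L)

theorem extDerAux_mono (p q : Bool × Fin 5) (h : dualIdx p ≠ q) (L : List (Fin 16)) :
    extDerAux (spinAct (stdVec p) (stdVec q)) (mono sVec L) = evalPoly (derMono p q L) := by
  induction L with
  | nil => exact extDerAux_one _
  | cons a L ih =>
    rw [mono_cons, extDerAux_mul, extDerAux_ι, ih, spinAct_sVec p q h, derMono, evalPoly_cons,
      evalPoly_consPoly, mono_cons]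
    simp [add_comm]

/-- The derivation of a combination of monomials induced by `stdVec p * stdVec q`. -/
def derPoly (p q : Bool × Fin 5) : SPoly → SPoly
  | [] => []
  | t :: P => (derMono p q t.2).map (fun s => (t.1 * s.1, s.2)) ++ derPoly p q P

theorem evalPoly_scale (z : ℤ) (p : SPoly) :
    evalPoly (p.map fun s => (z * s.1, s.2)) = (z : ℂ) • evalPoly p := by
  induction p with
  | nil => simp [evalPoly]
  | cons t p ih =>
    rw [List.map_cons, evalPoly_cons, evalPoly_cons, ih]
    push_cast
    module

theorem extDerAux_evalPoly (p q : Bool × Fin 5) (h : dualIdx p ≠ q) (P : SPoly) :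
    extDerAux (spinAct (stdVec p) (stdVec q)) (evalPoly P) =
      evalPoly (normPoly (derPoly p q P)) := by
  rw [evalPoly_normPoly]
  induction P with
  | nil => simp [evalPoly, derPoly]
  | cons t P ih =>
    rw [evalPoly_cons, map_add, map_smul, extDerAux_mono p q h, ih, derPoly, evalPoly_append,
      evalPoly_scale]

theorem extDerAux_diagonal (f : Module.End ℂ Splus) (c : Fin 16 → ℂ)
    (hf : ∀ a, f (sVec a) = c a • sVec a) (L : List (Fin 16)) :
    extDerAux f (mono sVec L) = (L.map c).sum • mono sVec L := by
  induction L with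
  | nil => simp [mono, extDerAux_one]
  | cons a L ih =>
    rw [mono_cons, extDerAux_mul, extDerAux_ι, ih, hf, map_smul, List.map_cons, List.sum_cons,
      mul_smul_comm, smul_mul_assoc]
    module

/-- The eigenvalue of the Cartan element `Hᵢ` on a basis vector of `S⁺`. -/
def spinWeight (i : Fin 5) (a : Fin 16) : ℚ := if i ∈ evenIdx a then 1 / 2 else -1 / 2

/-- H_i = e_i e_{-i} − 1/2, and e_i e_{-i} is the projection onto the monomials that contain e_i. -/
theorem cartan_sVec (i : Fin 5) (a : Fin 16) :
    cartan spinAct i (sVec a) = (spinWeight i a : ℂ) • sVec a := by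
  have h1 : ∀ i a, spinTable (false, i) (true, i) a = (1, a) ∧ i ∈ evenIdx a ∨
      (spinTable (false, i) (true, i) a).1 = 0 ∧ i ∉ evenIdx a := by decide +kernel
  have h2 := spinAct_sVec_dual (false, i) a
  change cartan spinAct i (sVec a) = _ at h2
  rw [h2, spinWeight]
  change ((spinTable (false, i) (true, i) a).1 : ℂ) • sVec (spinTable (false, i) (true, i) a).2 -
    _ = _
  rcases h1 i a with ⟨h, h'⟩ | ⟨h, h'⟩
  · rw [if_pos h', h]
    push_cast
    module
  · rw [if_neg h', h]
    push_cast
    module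

/-! ### An equivariant form on `Λ S⁺ ⊗ Λ S⁺` -/

/-- The coefficient of the top monomial in the product of the reversed monomial `K` with `L`. -/
def topPairing (K L : List (Fin 5)) : ℤ :=
  let t := K.foldl (fun t i => (t.1 * (insertMono i t.2).1, (insertMono i t.2).2)) ((1 : ℤ), L)
  if t.2 = [0, 1, 2, 3, 4] then t.1 else 0

/-- The coefficients of the equivariant symmetric bilinear map `S⁺ × S⁺ → Std`. -/
def gammaEntry (p : Bool × Fin 5) (a b : Fin 16) : ℤ :=
  let x := gammaMono (dualIdx p) (evenIdx b)
  if x.1 = 0 then 0 else x.1 * topPairing (evenIdx a) x.2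

/-- Equivariance of Γ under X_{-α_i}, one coordinate at a time: on the left the operator acts on the
two spinors in turn, on the right on the vector. There are finitely many integer identities. -/
theorem gammaEntry_lowering : ∀ i : Fin 5, ∀ p m n,
    (spinTable (lowIdx i).1 (lowIdx i).2 m).1 *
      gammaEntry p (spinTable (lowIdx i).1 (lowIdx i).2 m).2 n +
    (spinTable (lowIdx i).1 (lowIdx i).2 n).1 *
      gammaEntry p m (spinTable (lowIdx i).1 (lowIdx i).2 n).2 =
    (if p = (lowIdx i).1 then gammaEntry (dualIdx (lowIdx i).2) m n else 0) -
      if p = (lowIdx i).2 then gammaEntry (dualIdx (lowIdx i).1) m n else 0 := by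
  decide +kernel

/-- The matrices of the coordinates of `S⁺ × S⁺ → Std`. -/
def gammaMat (p : Bool × Fin 5) : Matrix (Fin 16) (Fin 16) ℂ := fun a b => (gammaEntry p a b : ℂ)

/-- The coordinate of `e₁`. -/
abbrev topIdx : Bool × Fin 5 := (false, 0)

/-- With D and E acting on the two tensor factors, moving D + E past ∑ β_{ab} L_a R_b replaces β by
FᵀB + BF for B = β, the infinitesimal action on bilinear forms. -/
theorem sum_mul_derivation {A κ : Type*} [Ring A] [Algebra ℂ A] [Fintype κ] (L R : κ → A)
    (D E : A) (F β : Matrix κ κ ℂ) (h1 : ∀ a, L a * D = D * L a + ∑ m, F a m • L m)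
    (h2 : ∀ a, L a * E = E * L a) (h3 : ∀ a, R a * D = D * R a)
    (h4 : ∀ a, R a * E = E * R a + ∑ m, F a m • R m) :
    (∑ a, ∑ b, β a b • (L a * R b)) * (D + E) =
      (D + E) * (∑ a, ∑ b, β a b • (L a * R b)) +
        ∑ a, ∑ b, (F.transpose * β + β * F) a b • (L a * R b) := by
  have h5 : ∀ a b, L a * R b * (D + E) = (D + E) * (L a * R b) +
      (∑ m, F a m • (L m * R b) + ∑ m, F b m • (L a * R m)) := by
    intro a b
    rw [mul_assoc, mul_add, h3, h4, mul_add, ← mul_assoc, h1, mul_add, ← mul_assoc (L a) E, h2]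
    simp only [add_mul, Finset.sum_mul, Finset.mul_sum, smul_mul_assoc, mul_smul_comm, mul_assoc]
    abel
  simp only [Finset.sum_mul, Finset.mul_sum, smul_mul_assoc, mul_smul_comm, h5, smul_add,
    Finset.sum_add_distrib, Finset.smul_sum, smul_smul, Matrix.add_apply, Matrix.mul_apply,
    Matrix.transpose_apply, add_smul, Finset.sum_smul]
  have h6 : ∑ a, ∑ b, ∑ m, (β a b * F a m) • (L m * R b) =
      ∑ a, ∑ b, ∑ m, (F m a * β m b) • (L a * R b) := by
    rw [Finset.sum_comm]
    conv_rhs => rw [Finset.sum_comm]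
    refine Finset.sum_congr rfl fun b _ => ?_
    rw [Finset.sum_comm]
    simp only [mul_comm]
  have h7 : ∑ a, ∑ b, ∑ m, (β a b * F b m) • (L a * R m) =
      ∑ a, ∑ b, ∑ m, (β a m * F m b) • (L a * R b) := by
    refine Finset.sum_congr rfl fun a _ => ?_
    rw [Finset.sum_comm]
  rw [h6, h7]

/-- The expression ∑ c_{d p} c_p is the invariant quadratic in a vector of operators. Skewness of S
for the duality d cancels the two correction terms, and the c_p need not commute with each other. -/
theorem quartic_commute {A κ : Type*} [Ring A] [Algebra ℂ A] [Fintype κ] (d : κ → κ)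
    (hd : Function.Involutive d) (c : κ → A) (D : A) (S : κ → κ → ℂ)
    (hS : ∀ p q, S (d p) (d q) = -S q p) (h : ∀ p, c p * D = D * c p + ∑ q, S p q • c q) :
    (∑ p, c (d p) * c p) * D = D * ∑ p, c (d p) * c p := by
  have h5 : ∀ p, c (d p) * c p * D = D * (c (d p) * c p) +
      (∑ q, S (d p) q • (c q * c p) + ∑ q, S p q • (c (d p) * c q)) := by
    intro p
    rw [mul_assoc, h, mul_add, ← mul_assoc, h, add_mul]
    simp only [Finset.sum_mul, Finset.mul_sum, smul_mul_assoc, mul_smul_comm, mul_assoc]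
    abel
  have h6 : ∑ p, ∑ q, S (d p) q • (c q * c p) = -∑ p, ∑ q, S p q • (c (d p) * c q) := by
    have h7 : ∀ p, ∑ q, S (d p) q • (c q * c p) = ∑ q, S (d p) (d q) • (c (d q) * c p) :=
      fun p => (Equiv.sum_comp (Function.Involutive.toPerm d hd) (fun q => S (d p) q • (c q * c p))).symm
    simp only [h7, hS, neg_smul, Finset.sum_neg_distrib]
    rw [Finset.sum_comm]
  rw [Finset.sum_mul, Finset.mul_sum]
  simp only [h5, Finset.sum_add_distrib]
  rw [h6]
  simp

theorem pow_mul_eigen {A : Type*} [Ring A] [Algebra ℂ A] (c D : A) (t : ℂ)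
    (h : c * D = D * c + t • c) (n : ℕ) : c ^ n * D = D * c ^ n + (n * t) • c ^ n := by
  induction n with
  | zero => simp
  | succ n ih =>
    rw [pow_succ', mul_assoc, ih, mul_add, ← mul_assoc, h, add_mul, mul_smul_comm,
      smul_mul_assoc, mul_assoc]
    push_cast
    module

section BiContr

variable {E κ : Type*} [AddCommGroup E] [Module ℂ E] [Fintype κ]

/-- The operator on `E ⊗ E` built from operators `c a` on `E` and a bilinear form. -/
def biContr (c : κ → Module.End ℂ E) (β : Matrix κ κ ℂ) : Module.End ℂ (E ⊗[ℂ] E) :=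
  ∑ a, ∑ b, β a b • TensorProduct.map (c a) (c b)

/-- The operator `D ⊗ 1 + 1 ⊗ D`. -/
def biDer (D : Module.End ℂ E) : Module.End ℂ (E ⊗[ℂ] E) :=
  TensorProduct.map D LinearMap.id + TensorProduct.map LinearMap.id D

theorem biContr_tmul (c : κ → Module.End ℂ E) (β : Matrix κ κ ℂ) (x y : E) :
    biContr c β (x ⊗ₜ y) = ∑ a, ∑ b, β a b • (c a x ⊗ₜ[ℂ] c b y) := by
  simp [biContr]

theorem biDer_tmul (D : Module.End ℂ E) (x y : E) :
    biDer D (x ⊗ₜ y) = D x ⊗ₜ y + x ⊗ₜ D y := rfl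

theorem biContr_add (c : κ → Module.End ℂ E) (β β' : Matrix κ κ ℂ) :
    biContr c (β + β') = biContr c β + biContr c β' := by
  simp [biContr, add_smul, Finset.sum_add_distrib]

theorem biContr_smul (c : κ → Module.End ℂ E) (t : ℂ) (β : Matrix κ κ ℂ) :
    biContr c (t • β) = t • biContr c β := by
  simp [biContr, mul_smul, Finset.smul_sum]

theorem biContr_sum {ι : Type*} [Fintype ι] (c : κ → Module.End ℂ E) (g : ι → Matrix κ κ ℂ) :
    biContr c (∑ q, g q) = ∑ q, biContr c (g q) :=
  map_sum (⟨⟨biContr c, biContr_add c⟩, fun t β => biContr_smul c t β⟩ :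
    Matrix κ κ ℂ →ₗ[ℂ] _) g Finset.univ

theorem biContr_biDer (c : κ → Module.End ℂ E) (D : Module.End ℂ E) (F : Matrix κ κ ℂ)
    (hc : ∀ a x, c a (D x) = D (c a x) + ∑ m, F a m • c m x) (β : Matrix κ κ ℂ) :
    biContr c β * biDer D = biDer D * biContr c β + biContr c (F.transpose * β + β * F) := by
  have h0 : ∀ β, biContr c β = ∑ a, ∑ b, β a b •
      ((TensorProduct.map (c a) LinearMap.id : Module.End ℂ (E ⊗[ℂ] E)) *
        TensorProduct.map LinearMap.id (c b)) := by
    intro β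
    simp only [Module.End.mul_eq_comp, ← TensorProduct.map_comp, LinearMap.comp_id,
      LinearMap.id_comp]
    rfl
  rw [h0, h0]
  refine sum_mul_derivation _ _ _ _ F β (fun a => TensorProduct.ext' fun x y => ?_)
    (fun a => TensorProduct.ext' fun x y => rfl) (fun a => TensorProduct.ext' fun x y => rfl)
    (fun a => TensorProduct.ext' fun x y => ?_)
  · simp [hc, TensorProduct.add_tmul, TensorProduct.sum_tmul, TensorProduct.smul_tmul']
  · simp [hc, TensorProduct.tmul_add, TensorProduct.tmul_sum]

/-- The contraction of `E ⊗ E` by `∑ₚ Γₚ ⊗ Γ₋ₚ`. -/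
def quarticContr (c : Fin 16 → Module.End ℂ E) : Module.End ℂ (E ⊗[ℂ] E) :=
  ∑ p, biContr c (gammaMat (dualIdx p)) * biContr c (gammaMat p)

/-- The form on `E ⊗ E` obtained by five contractions with the coefficient of `e₁` in `Γ`, one with
the quartic invariant, and the functional `ε`. -/
def biForm (c : Fin 16 → Module.End ℂ E) (ε : E →ₗ[ℂ] ℂ) : E ⊗[ℂ] E →ₗ[ℂ] ℂ :=
  (LinearMap.mul' ℂ ℂ ∘ₗ TensorProduct.map ε ε) ∘ₗ quarticContr c ∘ₗ
    biContr c (gammaMat topIdx) ^ 5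

/-- If `D` acts on `Γ` compatibly with a skew action on `Std`, and scales the coefficient of `e₁`,
then it scales the form. -/
theorem biForm_biDer (c : Fin 16 → Module.End ℂ E) (ε : E →ₗ[ℂ] ℂ) (D : Module.End ℂ E)
    (hε : ∀ x, ε (D x) = 0) (F : Matrix (Fin 16) (Fin 16) ℂ)
    (hc : ∀ a x, c a (D x) = D (c a x) + ∑ m, F a m • c m x)
    (S : Bool × Fin 5 → Bool × Fin 5 → ℂ) (hS : ∀ p q, S (dualIdx p) (dualIdx q) = -S q p)
    (h1 : ∀ p, F.transpose * gammaMat p + gammaMat p * F = ∑ q, S p q • gammaMat q) (t : ℂ)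
    (h2 : F.transpose * gammaMat topIdx + gammaMat topIdx * F = t • gammaMat topIdx)
    (z : E ⊗[ℂ] E) : biForm c ε (biDer D z) = (5 * t) * biForm c ε z := by
  have h0 : ∀ z, TensorProduct.map ε ε (biDer D z) = 0 := by
    intro z
    induction z with
    | zero => simp
    | add x y hx hy => rw [map_add, map_add, hx, hy, add_zero]
    | tmul x y => simp [biDer_tmul, hε]
  have h3 := pow_mul_eigen (biContr c (gammaMat topIdx)) (biDer D) t
    (by rw [biContr_biDer c D F hc, h2, biContr_smul]) 5
  -- The quartic contraction is invariant, so the whole scaling factor comes from the five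
  -- contractions with the e₁-coordinate.
  have h4 : quarticContr c * biDer D = biDer D * quarticContr c :=
    quartic_commute dualIdx (fun p => by simp [dualIdx]) (fun p => biContr c (gammaMat p)) _ S hS
      fun p => by simp only [biContr_biDer c D F hc, h1, biContr_sum, biContr_smul]
  rw [biForm, LinearMap.comp_apply, LinearMap.comp_apply, LinearMap.comp_apply,
    LinearMap.comp_apply, LinearMap.comp_apply, LinearMap.comp_apply]
  generalize biContr c (gammaMat topIdx) ^ 5 = b at h3 ⊢
  have h5 := LinearMap.congr_fun h3 z
  rw [Module.End.mul_apply, LinearMap.add_apply, Module.End.mul_apply,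
    LinearMap.smul_apply] at h5
  have h6 := LinearMap.congr_fun h4 (b z)
  rw [Module.End.mul_apply, Module.End.mul_apply] at h6
  rw [h5, map_add, h6, map_smul, map_add, h0, zero_add, map_smul, map_smul, smul_eq_mul]
  norm_num

end BiContr

/-- The form on `Λ S⁺ ⊗ Λ S⁺`: five contractions with the coefficient of `e₁` in `Γ`, one with the
quartic invariant. -/
def covariant : ExteriorAlgebra ℂ Splus ⊗[ℂ] ExteriorAlgebra ℂ Splus →ₗ[ℂ] ℂ :=
  biForm (fun a => extContr (sBasis.coord a)) ExteriorAlgebra.algebraMapInv.toLinearMap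

theorem extContr_coord_extDerAux (f : Module.End ℂ Splus) (F : Matrix (Fin 16) (Fin 16) ℂ)
    (hF : ∀ a, f (sVec a) = ∑ b, F b a • sVec b) (a : Fin 16) (x : ExteriorAlgebra ℂ Splus) :
    extContr (sBasis.coord a) (extDerAux f x) =
      extDerAux f (extContr (sBasis.coord a) x) +
        ∑ m, F a m • extContr (sBasis.coord m) x := by
  have h : sBasis.coord a ∘ₗ f = ∑ m, F a m • sBasis.coord m := by
    refine sBasis.ext fun b => ?_
    rw [LinearMap.comp_apply, sBasis_apply, hF, map_sum]
    simp [← sBasis_apply, Finsupp.single_apply]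
  rw [extContr_extDerAux, h, extContr_sum]
  simp only [LinearMap.sum_apply, extContr_smul, LinearMap.smul_apply]

theorem covariant_biDer (f : Module.End ℂ Splus) (F : Matrix (Fin 16) (Fin 16) ℂ)
    (hF : ∀ a, f (sVec a) = ∑ b, F b a • sVec b) (S : Bool × Fin 5 → Bool × Fin 5 → ℂ)
    (hS : ∀ p q, S (dualIdx p) (dualIdx q) = -S q p)
    (h1 : ∀ p, F.transpose * gammaMat p + gammaMat p * F = ∑ q, S p q • gammaMat q) (t : ℂ)
    (h2 : F.transpose * gammaMat topIdx + gammaMat topIdx * F = t • gammaMat topIdx)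
    (z : ExteriorAlgebra ℂ Splus ⊗[ℂ] ExteriorAlgebra ℂ Splus) :
    covariant (biDer (extDerAux f) z) = (5 * t) * covariant z :=
  biForm_biDer _ _ _ (algebraMapInv_extDerAux f) F (extContr_coord_extDerAux f F hF) S hS h1 t h2 z

/-- The matrix of a bivector on `S⁺`. -/
def spinMat (p q : Bool × Fin 5) : Matrix (Fin 16) (Fin 16) ℂ := fun b a => (spinEntry p q b a : ℂ)

/-- No lowering operator has e₁ in its image, e₁ being the highest weight vector of Std. The
e₁-coordinate of Γ is therefore invariant, and the scaling factor t is zero. -/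
theorem covariant_lowering (i : Fin 5)
    (z : ExteriorAlgebra ℂ Splus ⊗[ℂ] ExteriorAlgebra ℂ Splus) :
    covariant (biDer (extDerAux (lowering spinAct i)) z) = 0 := by
  set P := (lowIdx i).1
  set R := (lowIdx i).2
  have hentry : ∀ (p : Bool × Fin 5) (m n : Fin 16),
      ((spinMat P R).transpose * gammaMat p +
        gammaMat p * spinMat P R) m n =
      (if p = P then gammaMat (dualIdx R) m n else 0) -
        if p = R then gammaMat (dualIdx P) m n else 0 := by
    intro p m n
    have h := congrArg (Int.cast : ℤ → ℂ) (gammaEntry_lowering i p m n)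
    simp only [Matrix.add_apply, Matrix.mul_apply, Matrix.transpose_apply, spinMat, spinEntry,
      gammaMat]
    push_cast at h ⊢
    simp only [ite_mul, mul_ite, zero_mul, mul_zero, Finset.sum_ite_eq', Finset.mem_univ, if_true]
    rw [← h]
    ring
  have h := covariant_biDer (lowering spinAct i) (spinMat P R) (fun a => by
    rw [lowering_eq, spinAct_sVec_sum _ _ (lowIdx_ne i)]; rfl) (fun p q => (stdEntry P R p q : ℂ)) ?_ ?_
    0 ?_ z
  · simpa using h
  · intro p q
    have h1 : ∀ i p q, stdEntry (lowIdx i).1 (lowIdx i).2 (dualIdx p) (dualIdx q) =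
        -stdEntry (lowIdx i).1 (lowIdx i).2 q p := by decide +kernel
    rw [h1 i p q]
    push_cast
    rfl
  · intro p
    ext m n
    rw [hentry, Matrix.sum_apply]
    simp only [stdEntry, Matrix.smul_apply, smul_eq_mul]
    push_cast
    simp only [sub_mul, Finset.sum_sub_distrib]
    simp only [ite_and, ite_mul, one_mul, zero_mul]
    by_cases h1 : p = P <;> by_cases h2 : p = R <;> simp [h1, h2]
  · ext m n
    have h1 : ∀ i, topIdx ≠ (lowIdx i).1 ∧ topIdx ≠ (lowIdx i).2 := by decide
    rw [hentry, if_neg (h1 i).1, if_neg (h1 i).2]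
    simp

theorem gammaEntry_weight : ∀ k p m n, gammaEntry p m n ≠ 0 →
    spinWeight k m + spinWeight k n =
      (if p = (false, k) then 1 else 0) - if p = (true, k) then 1 else 0 := by
  decide +kernel

/-- The Cartan elements are diagonal and Γ preserves weights by `gammaEntry_weight`; each of the
five e₁-coordinates contributes L₁. -/
theorem covariant_cartan (k : Fin 5)
    (z : ExteriorAlgebra ℂ Splus ⊗[ℂ] ExteriorAlgebra ℂ Splus) :
    covariant (biDer (extDerAux (cartan spinAct k)) z) =
      (5 * if k = 0 then 1 else 0) * covariant z := by
  have hentry : ∀ p, (Matrix.diagonal fun a => (spinWeight k a : ℂ)).transpose * gammaMat p +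
      gammaMat p * Matrix.diagonal (fun a => (spinWeight k a : ℂ)) =
      ((if p = (false, k) then 1 else 0) - if p = (true, k) then 1 else 0 : ℂ) • gammaMat p := by
    intro p
    ext m n
    rw [Matrix.diagonal_transpose, Matrix.add_apply, Matrix.diagonal_mul, Matrix.mul_diagonal,
      Matrix.smul_apply, smul_eq_mul, mul_comm (gammaMat p m n), ← add_mul]
    by_cases h : gammaEntry p m n = 0
    · simp [gammaMat, h]
    · have h1 := congrArg (Rat.cast : ℚ → ℂ) (gammaEntry_weight k p m n h)
      push_cast at h1
      rw [h1]
      split_ifs <;> simp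
  refine covariant_biDer _ (Matrix.diagonal fun a => (spinWeight k a : ℂ)) (fun a => ?_)
    (fun p q => if p = q then
      ((if p = (false, k) then 1 else 0) - if p = (true, k) then 1 else 0 : ℂ) else 0)
    (fun p q => ?_) (fun p => ?_) _ ?_ z
  · rw [cartan_sVec]
    simp [Matrix.diagonal_apply, ite_smul]
  · rcases p with ⟨_ | _, i⟩ <;> rcases q with ⟨_ | _, j⟩ <;> simp [dualIdx, eq_comm] <;>
      by_cases h : i = j <;> simp [h]
  · rw [hentry]
    simp [ite_smul]
  · rw [hentry]
    simp [topIdx, eq_comm]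

/-! ### Highest weight vectors in the symmetric square from an equivariant form -/

section Quadratic

variable {M : Type*} [AddCommGroup M] [Module ℂ M] {act : Std → Std → Module.End ℂ M}
  {S : Submodule ℂ M}

/-- The coordinates embed V into a Euclidean space; the vectors are preimages in V of an orthonormal
basis of the image. -/
theorem Frame.exists_orthonormal (φ : Frame act S) (V : Submodule ℂ M) (hV : V ≤ S) :
    ∃ (n : ℕ) (v : Fin n → M), (∀ k, v k ∈ V) ∧ ∀ x ∈ V, x = ∑ k, φ.herm (v k) x • v k := by
  set W : Submodule ℂ (EuclideanSpace ℂ φ.K) :=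
    V.map ((WithLp.linearEquiv 2 ℂ (φ.K → ℂ)).symm.toLinearMap ∘ₗ φ.coord) with hW
  set b := stdOrthonormalBasis ℂ W
  have h1 : ∀ k, ∃ v ∈ V, WithLp.toLp 2 (φ.coord v) = (b k : EuclideanSpace ℂ φ.K) := fun k => by
    obtain ⟨v, hv, h⟩ := Submodule.mem_map.mp (b k).2
    exact ⟨v, hv, h⟩
  choose v hv hb using h1
  refine ⟨_, v, hv, fun x hx => ?_⟩
  have hx' : WithLp.toLp 2 (φ.coord x) ∈ W := ⟨x, hx, rfl⟩
  rw [← sub_eq_zero]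
  refine φ.inj _ (hV (Submodule.sub_mem _ hx
    (Submodule.sum_mem _ fun k _ => Submodule.smul_mem _ _ (hv k)))) ?_
  have h2 := congrArg Subtype.val (b.sum_repr' ⟨_, hx'⟩)
  have h3 : WithLp.toLp 2 (φ.coord x) = ∑ k, φ.herm (v k) x • WithLp.toLp 2 (φ.coord (v k)) := by
    refine Eq.trans h2.symm ?_
    rw [Submodule.coe_sum]
    refine Finset.sum_congr rfl fun k _ => ?_
    rw [Submodule.coe_smul, ← hb k, Submodule.coe_inner, ← hb k, Frame.herm_apply,
      EuclideanSpace.inner_eq_star_dotProduct, dotProduct_comm]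
  have h4 := congrArg (WithLp.linearEquiv 2 ℂ (φ.K → ℂ)) h3
  rw [map_sum] at h4
  rw [map_sub, map_sum, sub_eq_zero]
  simp only [map_smul] at h4 ⊢
  exact h4

/-- The element `∑ conj (L(vₖ, vₗ)) vₖ vₗ` of the symmetric square. -/
def dualSquare (L : M →ₗ[ℂ] M →ₗ[ℂ] ℂ) {n : ℕ} (v : Fin n → M) : SymmetricAlgebra ℂ M :=
  ∑ k, ∑ l, star (L (v k) (v l)) •
    (SymmetricAlgebra.ι ℂ M (v k) * SymmetricAlgebra.ι ℂ M (v l))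

theorem dualSquare_mem (L : M →ₗ[ℂ] M →ₗ[ℂ] ℂ) {n : ℕ} (v : Fin n → M) {V : Submodule ℂ M}
    (hv : ∀ k, v k ∈ V) : dualSquare L v ∈ symPow 2 V := by
  refine Submodule.sum_mem _ fun k _ => Submodule.sum_mem _ fun l _ => Submodule.smul_mem _ _ ?_
  rw [symPow, pow_two]
  exact Submodule.mul_mem_mul ⟨_, hv k, rfl⟩ ⟨_, hv l, rfl⟩

/-- `dualSquare L v` represents L through the Hermitian form, so D acts on it as the adjoint D' acts
on L. The identification is antilinear, whence the eigenvalue `star c`. -/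
theorem symDer_dualSquare (φ : Frame act S) (L : M →ₗ[ℂ] M →ₗ[ℂ] ℂ) {n : ℕ} {v : Fin n → M}
    {V : Submodule ℂ M} (hv : ∀ k, v k ∈ V) (hx : ∀ x ∈ V, x = ∑ k, φ.herm (v k) x • v k)
    (D D' : Module.End ℂ M) (hD : ∀ x ∈ V, D x ∈ V) (hD' : ∀ x ∈ V, D' x ∈ V)
    (hDD' : ∀ x y, φ.herm x (D y) = φ.herm (D' x) y) (c : ℂ)
    (hL : ∀ x y, L (D' x) y + L x (D' y) = c * L x y) :
    symDer D (dualSquare L v) = star c • dualSquare L v := by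
  have h1 : ∀ k, D (v k) = ∑ m, star (φ.herm (v k) (D' (v m))) • v m := fun k => by
    rw [hx _ (hD _ (hv k))]
    refine Finset.sum_congr rfl fun m _ => ?_
    rw [hDD', φ.herm_comm]
  have h2 : ∀ (f : M →ₗ[ℂ] ℂ) m, ∑ k, star (φ.herm (v k) (D' (v m))) * star (f (v k)) =
      star (f (D' (v m))) := fun f m => by
    conv_rhs => rw [hx _ (hD' _ (hv m)), map_sum, star_sum]
    refine Finset.sum_congr rfl fun k _ => ?_
    rw [map_smul, smul_eq_mul, star_mul']
  have h3 : symDer D (dualSquare L v) = ∑ k, ∑ l, star (L (v k) (D' (v l))) •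
      (SymmetricAlgebra.ι ℂ M (v k) * SymmetricAlgebra.ι ℂ M (v l)) +
      ∑ k, ∑ l, star (L (D' (v k)) (v l)) •
      (SymmetricAlgebra.ι ℂ M (v k) * SymmetricAlgebra.ι ℂ M (v l)) := by
    simp only [dualSquare, map_sum, map_smul, symDer_mul, symDer_ι, h1, smul_add,
      Finset.sum_add_distrib, Finset.mul_sum, Finset.sum_mul, Finset.smul_sum, mul_smul_comm,
      smul_mul_assoc, smul_smul]
    congr 1
    · refine Finset.sum_congr rfl fun k _ => ?_
      rw [Finset.sum_comm]
      refine Finset.sum_congr rfl fun l _ => ?_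
      rw [← Finset.sum_smul, ← h2]
      simp only [mul_comm]
    · rw [Finset.sum_comm]
      conv_rhs => rw [Finset.sum_comm]
      refine Finset.sum_congr rfl fun l _ => ?_
      rw [Finset.sum_comm]
      refine Finset.sum_congr rfl fun k _ => ?_
      rw [← Finset.sum_smul]
      have h4 := h2 (L.flip (v l)) k
      simp only [LinearMap.flip_apply] at h4
      rw [← h4]
      simp only [mul_comm]
  rw [h3, dualSquare, ← Finset.sum_add_distrib, Finset.smul_sum]
  refine Finset.sum_congr rfl fun k _ => ?_
  rw [← Finset.sum_add_distrib, Finset.smul_sum]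
  refine Finset.sum_congr rfl fun l _ => ?_
  rw [← add_smul, ← star_add, add_comm, hL, star_mul', smul_smul]

/-- Evaluating the quadratic tensor at the linear form ⟨z, ·⟩ gives the conjugate of L(z, z). -/
theorem dualSquare_ne_zero (φ : Frame act S) (L : M →ₗ[ℂ] M →ₗ[ℂ] ℂ) {n : ℕ} {v : Fin n → M}
    {z : M} (hz : z = ∑ k, φ.herm (v k) z • v k) (h : L z z ≠ 0) : dualSquare L v ≠ 0 := by
  intro h0
  have h1 := congrArg (SymmetricAlgebra.lift (φ.herm z)) h0
  apply h
  have h2 : L z z = ∑ k, ∑ l, φ.herm (v k) z * φ.herm (v l) z * L (v k) (v l) := by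
    conv_lhs => rw [hz]
    simp only [map_sum, map_smul, LinearMap.sum_apply, LinearMap.smul_apply, smul_eq_mul,
      Finset.mul_sum]
    rw [Finset.sum_comm]
    refine Finset.sum_congr rfl fun k _ => Finset.sum_congr rfl fun l _ => by ring
  rw [← star_eq_zero, h2, ← map_zero (SymmetricAlgebra.lift (φ.herm z)), ← h1, dualSquare]
  simp only [map_sum, map_smul, map_mul, SymmetricAlgebra.lift_ι_apply, star_sum, star_mul',
    smul_eq_mul]
  refine Finset.sum_congr rfl fun k _ => Finset.sum_congr rfl fun l _ => ?_
  rw [← φ.herm_comm, ← φ.herm_comm]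
  ring

/-- The Cartan subalgebra acts by self-adjoint operators. -/
theorem Frame.herm_cartan (φ : Frame act S) (h : IsLieAct act) (k : Fin 5) (x y : M) :
    φ.herm (cartan act k x) y = φ.herm x (cartan act k y) := by
  -- Each simple coroot is a commutator of mutually adjoint operators, hence self-adjoint; the H_k
  -- are combinations of simple coroots.
  have h1 : ∀ i, φ.herm ((∑ k, (simpleRoot i k : ℂ) • cartan act k) x) y =
      φ.herm x ((∑ k, (simpleRoot i k : ℂ) • cartan act k) y) := by
    intro i
    have h2 := h.raising_lowering i i
    rw [if_pos rfl] at h2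
    have h3 : ∀ x y, φ.herm (x - y) = φ.herm x - φ.herm y := fun x y => by
      ext z
      simp [Frame.herm_apply]
    rw [← h2]
    simp only [LinearMap.sub_apply, Module.End.mul_apply, h3, map_sub, φ.herm_lower,
      φ.herm_raise]
  have h4 : ∀ i, ∑ k, (simpleRoot i k : ℂ) * φ.herm (cartan act k x) y =
      ∑ k, (simpleRoot i k : ℂ) * φ.herm x (cartan act k y) := by
    intro i
    have h5 := h1 i
    simp only [LinearMap.sum_apply, LinearMap.smul_apply, Frame.herm_apply] at h5 ⊢
    simpa [sum_dotProduct, dotProduct_sum, star_sum] using h5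
  have e0 := h4 0
  have e1 := h4 1
  have e2 := h4 2
  have e3 := h4 3
  have e4 := h4 4
  simp [Fin.sum_univ_five, simpleRoot] at e0 e1 e2 e3 e4
  -- The last two coroots are H₄ − H₅ and H₄ + H₅; solving for these two, the differences give the
  -- others.
  have f3 : φ.herm (cartan act 3 x) y = φ.herm x (cartan act 3 y) := by
    linear_combination (e3 + e4) / 2
  have f4 : φ.herm (cartan act 4 x) y = φ.herm x (cartan act 4 y) := by
    linear_combination (e4 - e3) / 2
  have f2 : φ.herm (cartan act 2 x) y = φ.herm x (cartan act 2 y) := by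
    linear_combination e2 + f3
  have f1 : φ.herm (cartan act 1 x) y = φ.herm x (cartan act 1 y) := by
    linear_combination e1 + f2
  have f0 : φ.herm (cartan act 0 x) y = φ.herm x (cartan act 0 y) := by
    linear_combination e0 + f1
  fin_cases k
  exacts [f0, f1, f2, f3, f4]

/-- Taking adjoints exchanges raising and lowering operators, so a form killed by the lowering
operators yields a vector killed by the raising ones. The Cartan elements are self-adjoint and the
weight is real, so the weight is kept. -/
theorem exists_highest_symPow_two (φ : Frame act S) (h : IsLieAct act) (V : Submodule ℂ M)
    (hVS : V ≤ S) (hV : ∀ a b, ∀ x ∈ V, act a b x ∈ V) (L : M →ₗ[ℂ] M →ₗ[ℂ] ℂ)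
    (hlow : ∀ i x y, L (lowering act i x) y + L x (lowering act i y) = 0)
    (lam : Fin 5 → ℤ)
    (hcar : ∀ k x y, L (cartan act k x) y + L x (cartan act k y) = (lam k : ℂ) * L x y)
    {x y : M} (hx : x ∈ V) (hy : y ∈ V) (hxy : L x y + L y x ≠ 0) :
    ∃ w ∈ symPow 2 V, IsHighestWeightVector (fun a b => symDer (act a b)) lam w := by
  obtain ⟨n, v, hv, hsum⟩ := φ.exists_orthonormal V hVS
  -- Polarization: if L(z, z) vanished on all of V, then L would be alternating there.
  have hz : ∃ z ∈ V, L z z ≠ 0 := by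
    by_contra! hc
    have h1 := hc _ (V.add_mem hx hy)
    have h2 := hc x hx
    have h3 := hc y hy
    simp only [map_add, LinearMap.add_apply, h2, h3] at h1
    exact hxy (by linear_combination h1)
  obtain ⟨z, hz, hLz⟩ := hz
  refine ⟨dualSquare L v, dualSquare_mem L v hv, dualSquare_ne_zero φ L (hsum z hz) hLz,
    fun i => ?_, fun k => ?_⟩
  · have h1 := symDer_dualSquare φ L hv hsum (raising act i) (lowering act i)
      (fun x hx => by fin_cases i <;> exact hV _ _ x hx)
      (fun x hx => by fin_cases i <;> exact hV _ _ x hx)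
      (fun x y => (φ.herm_lower i x y).symm) 0 (fun x y => by rw [hlow, zero_mul])
    rw [star_zero, zero_smul] at h1
    rw [← h1]
    fin_cases i <;> rfl
  · have h1 := symDer_dualSquare φ L hv hsum (cartan act k) (cartan act k)
      (fun x hx => hV _ _ x hx) (fun x hx => hV _ _ x hx)
      (fun x y => (φ.herm_cartan h k x y).symm) _ (hcar k)
    rw [show star ((lam k : ℤ) : ℂ) = lam k from star_intCast _] at h1
    exact h1

end Quadratic

/-! ### Evaluation of the form on combinations of monomials -/

section ContrAll

variable {M κ : Type*} [AddCommGroup M] [Module ℂ M]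

/-- The contractions of a monomial, with their signs and the removed letters. -/
def contrAll : List κ → List (ℤ × κ × List κ)
  | [] => []
  | j :: L => (1, j, L) :: (contrAll L).map fun s => (-s.1, s.2.1, j :: s.2.2)

theorem extContr_mono_eq (b : κ → M) (d : Module.Dual ℂ M) (L : List κ) :
    extContr d (mono b L) =
      ((contrAll L).map fun s => ((s.1 : ℂ) * d (b s.2.1)) • mono b s.2.2).sum := by
  induction L with
  | nil => simp [contrAll, mono, extContr_one]
  | cons j L ih =>
    rw [mono_cons, extContr_ι_mul, ih, contrAll, List.map_cons, List.sum_cons, List.map_map,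
      ← List.sum_map_mul_left, sub_eq_add_neg]
    have h : ∀ (l : List (ℤ × κ × List κ)) (f : ℤ × κ × List κ → ExteriorAlgebra ℂ M),
        -(l.map f).sum = (l.map fun s => -f s).sum := by
      intro l f
      induction l with
      | nil => simp
      | cons s l ih => simp only [List.map_cons, List.sum_cons, neg_add, ih]
    rw [h]
    simp [Function.comp_def, mono_cons]

end ContrAll

/-- Integral combinations of tensor products of two monomials. -/
abbrev BiPoly : Type := List (ℤ × List (Fin 16) × List (Fin 16))

section EvalBi

variable {E : Type*} [AddCommGroup E] [Module ℂ E] (m : List (Fin 16) → E)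

/-- The element of `E ⊗ E` represented by a combination of pairs of monomials. -/
def evalBi (P : BiPoly) : E ⊗[ℂ] E :=
  (P.map fun t => (t.1 : ℂ) • (m t.2.1 ⊗ₜ[ℂ] m t.2.2)).sum

theorem evalBi_cons (t : ℤ × List (Fin 16) × List (Fin 16)) (P : BiPoly) :
    evalBi m (t :: P) = (t.1 : ℂ) • (m t.2.1 ⊗ₜ[ℂ] m t.2.2) + evalBi m P := by
  simp [evalBi]

/-- Addition of a term to a combination of pairs of monomials. -/
def addBiTerm (z : ℤ) (L R : List (Fin 16)) : BiPoly → BiPoly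
  | [] => [(z, L, R)]
  | t :: P => if t.2 = (L, R) then (t.1 + z, L, R) :: P else t :: addBiTerm z L R P

theorem evalBi_addBiTerm (z : ℤ) (L R : List (Fin 16)) (P : BiPoly) :
    evalBi m (addBiTerm z L R P) = (z : ℂ) • (m L ⊗ₜ[ℂ] m R) + evalBi m P := by
  induction P with
  | nil => simp [addBiTerm, evalBi]
  | cons t P ih =>
    rw [addBiTerm]
    split_ifs with h
    · rw [evalBi_cons, evalBi_cons, h]
      push_cast
      module
    · rw [evalBi_cons, evalBi_cons, ih]
      module

/-- Adds the contraction by `Γₚ` of a multiple of a pair of monomials, the second of which has the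
given contractions. -/
def addContr (p : Bool × Fin 5) (z : ℤ) (s : ℤ × Fin 16 × List (Fin 16)) :
    List (ℤ × Fin 16 × List (Fin 16)) → BiPoly → BiPoly
  | [], P => P
  | t :: T, P =>
    if gammaEntry p s.2.1 t.2.1 = 0 then addContr p z s T P else
      addBiTerm (z * (s.1 * t.1 * gammaEntry p s.2.1 t.2.1)) s.2.2 t.2.2 (addContr p z s T P)

theorem evalBi_addContr (p : Bool × Fin 5) (z : ℤ) (s : ℤ × Fin 16 × List (Fin 16))
    (T : List (ℤ × Fin 16 × List (Fin 16))) (P : BiPoly) :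
    evalBi m (addContr p z s T P) = (z : ℂ) • (T.map fun t =>
      ((s.1 * t.1 * gammaEntry p s.2.1 t.2.1 : ℤ) : ℂ) •
        (m s.2.2 ⊗ₜ[ℂ] m t.2.2)).sum + evalBi m P := by
  induction T with
  | nil => simp [addContr]
  | cons t T ih =>
    rw [addContr, List.map_cons, List.sum_cons]
    split_ifs with h
    · rw [ih, h]
      simp
    · rw [evalBi_addBiTerm, ih, smul_add, smul_smul, add_assoc, ← Int.cast_mul]

/-- Adds the contraction by `Γₚ` of a multiple of a pair of monomials. -/
def addContrs (p : Bool × Fin 5) (z : ℤ) (T : List (ℤ × Fin 16 × List (Fin 16))) :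
    List (ℤ × Fin 16 × List (Fin 16)) → BiPoly → BiPoly
  | [], P => P
  | s :: S, P => addContr p z s T (addContrs p z T S P)

theorem evalBi_addContrs (p : Bool × Fin 5) (z : ℤ) (S T : List (ℤ × Fin 16 × List (Fin 16)))
    (P : BiPoly) :
    evalBi m (addContrs p z T S P) = (z : ℂ) • (S.map fun s => (T.map fun t =>
      ((s.1 * t.1 * gammaEntry p s.2.1 t.2.1 : ℤ) : ℂ) •
        (m s.2.2 ⊗ₜ[ℂ] m t.2.2)).sum).sum + evalBi m P := by
  induction S with
  | nil => simp [addContrs]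
  | cons s S ih =>
    rw [addContrs, evalBi_addContr, ih, List.map_cons, List.sum_cons, smul_add, add_assoc]

/-- The contraction by `Γₚ` of a combination of pairs of monomials. -/
def biPoly (p : Bool × Fin 5) : BiPoly → BiPoly
  | [] => []
  | t :: P => if t.1 = 0 then biPoly p P else
      addContrs p t.1 (contrAll t.2.2) (contrAll t.2.1) (biPoly p P)

theorem sum_list_map_smul {α : Type*} (l : List α)
    (u : Fin 16 → ℂ) (f : α → Fin 16 → E) :
    ∑ a, u a • (l.map fun s => f s a).sum = (l.map fun s => ∑ a, u a • f s a).sum := by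
  induction l with
  | nil => simp
  | cons s l ih => simp [smul_add, Finset.sum_add_distrib, ih]

theorem biContr_mono {c : Fin 16 → Module.End ℂ E}
    (hc : ∀ a L, c a (m L) = ((contrAll L).map fun s =>
      ((s.1 : ℂ) * if s.2.1 = a then 1 else 0) • m s.2.2).sum) (p : Bool × Fin 5) (L R : List (Fin 16)) :
    biContr c (gammaMat p) (m L ⊗ₜ[ℂ] m R) =
      ((contrAll L).map fun s => ((contrAll R).map fun t =>
        ((s.1 * t.1 * gammaEntry p s.2.1 t.2.1 : ℤ) : ℂ) •
          (m s.2.2 ⊗ₜ[ℂ] m t.2.2)).sum).sum := by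
  have h1 : ∀ (l : List (ℤ × Fin 16 × List (Fin 16))) (f : ℤ × Fin 16 × List (Fin 16) →
      E) (y : E),
      (l.map f).sum ⊗ₜ[ℂ] y = (l.map fun s => f s ⊗ₜ[ℂ] y).sum := by
    intro l f y
    induction l with
    | nil => simp
    | cons s l ih => simp [TensorProduct.add_tmul, ih]
  have h2 : ∀ (l : List (ℤ × Fin 16 × List (Fin 16))) (f : ℤ × Fin 16 × List (Fin 16) →
      E) (y : E),
      y ⊗ₜ[ℂ] (l.map f).sum = (l.map fun s => y ⊗ₜ[ℂ] f s).sum := by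
    intro l f y
    induction l with
    | nil => simp
    | cons s l ih => simp [TensorProduct.tmul_add, ih]
  rw [biContr_tmul]
  simp only [hc, h1, h2, sum_list_map_smul]
  have h3 : ∀ (l : List (ℤ × Fin 16 × List (Fin 16))) (f : Fin 16 → ℤ × Fin 16 × List (Fin 16) →
      E ⊗[ℂ] E),
      ∑ a, (l.map (f a)).sum = (l.map fun s => ∑ a, f a s).sum := by
    intro l f
    simpa using sum_list_map_smul l (fun _ => 1) fun s a => f a s
  simp only [h3]
  congr 1
  refine List.map_congr_left fun s _ => ?_
  congr 1
  refine List.map_congr_left fun t _ => ?_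
  rw [Finset.sum_eq_single s.2.1, Finset.sum_eq_single t.2.1]
  · rw [if_pos rfl, if_pos rfl, TensorProduct.smul_tmul_smul, smul_smul, gammaMat]
    push_cast
    congr 1
    ring
  · intro b _ hb
    rw [if_neg hb.symm, mul_zero, zero_smul, TensorProduct.tmul_zero, smul_zero]
  · simp
  · intro b _ hb
    simp only [if_neg hb.symm, mul_zero, zero_smul, TensorProduct.zero_tmul, smul_zero,
      Finset.sum_const_zero]
  · simp

theorem evalBi_biPoly {c : Fin 16 → Module.End ℂ E}
    (hc : ∀ a L, c a (m L) = ((contrAll L).map fun s =>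
      ((s.1 : ℂ) * if s.2.1 = a then 1 else 0) • m s.2.2).sum) (p : Bool × Fin 5) (P : BiPoly) :
    biContr c (gammaMat p) (evalBi m P) = evalBi m (biPoly p P) := by
  induction P with
  | nil => simp [biPoly, evalBi]
  | cons t P ih =>
    rw [evalBi_cons, map_add, map_smul, biContr_mono m hc, ih, biPoly]
    split_ifs with h
    · simp [h]
    · rw [evalBi_addContrs]

/-- The constant term of a combination of pairs of monomials. -/
def constBi (P : BiPoly) : ℤ := (P.map fun t => if t.2 = ([], []) then t.1 else 0).sum

theorem counit_evalBi (ε : E →ₗ[ℂ] ℂ) (hε : ∀ L, ε (m L) = if L = [] then 1 else 0)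
    (P : BiPoly) :
    LinearMap.mul' ℂ ℂ (TensorProduct.map ε ε (evalBi m P)) = (constBi P : ℂ) := by
  induction P with
  | nil => simp [constBi, evalBi]
  | cons t P ih =>
    rw [evalBi_cons, map_add, map_add, ih]
    have h : constBi (t :: P) = (if t.2 = ([], []) then t.1 else 0) + constBi P := by
      simp [constBi]
    rw [h]
    obtain ⟨z, L, R⟩ := t
    cases L <;> cases R <;> simp [hε]

/-- The value of the quartic contraction on a combination of pairs of monomials. -/
def quarticBi (P : BiPoly) : ℤ :=
  ∑ p, constBi (biPoly (dualIdx p) (biPoly p P))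

/-- Turns a value of the form into integer arithmetic on lists of monomials, which can be decided by
evaluation. -/
theorem biForm_evalBi {c : Fin 16 → Module.End ℂ E} (ε : E →ₗ[ℂ] ℂ)
    (hc : ∀ a L, c a (m L) = ((contrAll L).map fun s =>
      ((s.1 : ℂ) * if s.2.1 = a then 1 else 0) • m s.2.2).sum)
    (hε : ∀ L, ε (m L) = if L = [] then 1 else 0) (P : BiPoly) :
    biForm c ε (evalBi m P) = (quarticBi ((biPoly topIdx)^[5] P) : ℂ) := by
  have h1 : ∀ n P, (biContr c (gammaMat topIdx) ^ n) (evalBi m P) =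
      evalBi m ((biPoly topIdx)^[n] P) := by
    intro n
    induction n with
    | zero => intro P; rfl
    | succ n ih =>
      intro P
      rw [pow_succ, Module.End.mul_apply, evalBi_biPoly m hc, ih, Function.iterate_succ_apply]
  rw [biForm, LinearMap.comp_apply, LinearMap.comp_apply, LinearMap.comp_apply, h1, quarticContr, LinearMap.sum_apply, map_sum, map_sum, quarticBi,
    Int.cast_sum]
  refine Finset.sum_congr rfl fun p _ => ?_
  rw [Module.End.mul_apply, evalBi_biPoly m hc, evalBi_biPoly m hc, counit_evalBi m ε hε]

end EvalBi

/-- The tensor product of two combinations of monomials. -/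
def tensPoly : SPoly → SPoly → BiPoly
  | [], _ => []
  | s :: P, R => R.map (fun t => (s.1 * t.1, s.2, t.2)) ++ tensPoly P R

/-- The value of the form on two combinations of monomials. -/
def covariantPoly (P R : SPoly) : ℤ := quarticBi ((biPoly topIdx)^[5] (tensPoly P R))

theorem evalBi_append (P R : BiPoly) :
    evalBi (mono sVec) (P ++ R) = evalBi (mono sVec) P + evalBi (mono sVec) R := by
  simp [evalBi]

theorem evalBi_tensPoly (P R : SPoly) :
    evalBi (mono sVec) (tensPoly P R) = evalPoly P ⊗ₜ[ℂ] evalPoly R := by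
  have h1 : ∀ (s : ℤ × List (Fin 16)) (R : SPoly),
      evalBi (mono sVec) (R.map fun t => (s.1 * t.1, s.2, t.2)) =
        ((s.1 : ℂ) • mono sVec s.2) ⊗ₜ[ℂ] evalPoly R := by
    intro s R
    induction R with
    | nil => simp [evalBi, evalPoly]
    | cons t R ih =>
      rw [List.map_cons, evalBi_cons, ih, evalPoly_cons, TensorProduct.tmul_add,
        TensorProduct.smul_tmul_smul, Int.cast_mul]
  induction P with
  | nil => simp [tensPoly, evalBi, evalPoly]
  | cons s P ih => rw [tensPoly, evalBi_append, h1, ih, evalPoly_cons, TensorProduct.add_tmul]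

theorem covariant_evalPoly (P R : SPoly) :
    covariant (evalPoly P ⊗ₜ[ℂ] evalPoly R) = (covariantPoly P R : ℂ) := by
  rw [← evalBi_tensPoly]
  refine biForm_evalBi (mono sVec) _ (fun a L => ?_) (fun L => ?_) _
  · rw [extContr_mono_eq]
    simp only [← sBasis_apply, Module.Basis.coord_apply, Module.Basis.repr_self,
      Finsupp.single_apply]
  · cases L with
    | nil => simp [mono]
    | cons a L => simp [mono_cons, ExteriorAlgebra.algebraMapInv]

/-! ### The highest weight vectors `v₁` and `v₂` -/

theorem s2_eq_sVec (i j : Fin 5) (a : Fin 16) (h : evenIdx a = [i, j]) : s2 i j = sVec a := by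
  refine Subtype.ext ?_
  simp [sVec, mono, h, s2, uVec]

theorem s4_eq_sVec (i j k l : Fin 5) (a : Fin 16) (h : evenIdx a = [i, j, k, l]) :
    s4 i j k l = sVec a := by
  refine Subtype.ext ?_
  simp [sVec, mono, h, s4, s2, uVec, mul_assoc]

/-- The monomials `v₁` (for `false`) and `v₂` (for `true`). -/
def hwMono (c : Bool) : List (Fin 16) :=
  if c then [1, 2, 3, 11, 12, 13, 14] else [1, 2, 11, 12, 13, 14, 15]

/-- The vectors `v₁` (for `false`) and `v₂` (for `true`). -/
def hwLambda (c : Bool) : LSeven := if c then v₂ else v₁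

theorem coe_hwLambda (c : Bool) :
    (hwLambda c : ExteriorAlgebra ℂ Splus) = mono sVec (hwMono c) := by
  cases c
  · change (v₁ : ExteriorAlgebra ℂ Splus) = mono sVec [1, 2, 11, 12, 13, 14, 15]
    rw [v₁, exteriorPower.ιMulti_apply_coe, ExteriorAlgebra.ιMulti_apply, mono,
      s2_eq_sVec 0 1 1 rfl, s2_eq_sVec 0 2 2 rfl, s4_eq_sVec 0 1 2 3 11 rfl,
      s4_eq_sVec 0 1 2 4 12 rfl, s4_eq_sVec 0 1 3 4 13 rfl, s4_eq_sVec 0 2 3 4 14 rfl,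
      s4_eq_sVec 1 2 3 4 15 rfl]
    simp [List.ofFn_succ]
  · change (v₂ : ExteriorAlgebra ℂ Splus) = mono sVec [1, 2, 3, 11, 12, 13, 14]
    rw [v₂, exteriorPower.ιMulti_apply_coe, ExteriorAlgebra.ιMulti_apply, mono,
      s2_eq_sVec 0 1 1 rfl, s2_eq_sVec 0 2 2 rfl, s2_eq_sVec 0 3 3 rfl,
      s4_eq_sVec 0 1 2 3 11 rfl, s4_eq_sVec 0 1 2 4 12 rfl, s4_eq_sVec 0 1 3 4 13 rfl,
      s4_eq_sVec 0 2 3 4 14 rfl]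
    simp [List.ofFn_succ]

/-- The weights of `v₁` and `v₂`. -/
def hwWeight (c : Bool) (k : Fin 5) : ℚ := ((hwMono c).map (spinWeight k)).sum

theorem raising_hwLambda (c : Bool) (i : Fin 5) : raising lambdaAct i (hwLambda c) = 0 := by
  refine Subtype.ext ?_
  have h1 : ∀ c i, normPoly (derPoly (raiseIdx i).1 (raiseIdx i).2 [(1, hwMono c)]) = [] := by
    decide +kernel
  have h2 : evalPoly [(1, hwMono c)] = mono sVec (hwMono c) := by simp [evalPoly]
  rw [raising_eq, lambdaAct, coe_extDer, coe_hwLambda, ← h2,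
    extDerAux_evalPoly _ _ (raiseIdx_ne i), h1]
  rfl

theorem cartan_hwLambda (c : Bool) (k : Fin 5) :
    cartan lambdaAct k (hwLambda c) = (hwWeight c k : ℂ) • hwLambda c := by
  refine Subtype.ext ?_
  have h1 := extDerAux_diagonal (cartan spinAct k) (fun a => (spinWeight k a : ℂ)) (cartan_sVec k)
    (hwMono c)
  rw [cartan, lambdaAct, coe_extDer, Submodule.coe_smul, coe_hwLambda]
  refine h1.trans ?_
  rw [hwWeight, Rat.cast_list_sum, List.map_map]
  rfl

/-- The restriction of a form on `E ⊗ E` to a subspace. -/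
def restrictForm {E : Type*} [AddCommGroup E] [Module ℂ E] (f : E ⊗[ℂ] E →ₗ[ℂ] ℂ)
    (N : Submodule ℂ E) : N →ₗ[ℂ] N →ₗ[ℂ] ℂ :=
  ((TensorProduct.mk ℂ E E).compr₂ f).compl₁₂ N.subtype N.subtype

theorem restrictForm_apply {E : Type*} [AddCommGroup E] [Module ℂ E] (f : E ⊗[ℂ] E →ₗ[ℂ] ℂ)
    (N : Submodule ℂ E) (x y : N) : restrictForm f N x y = f ((x : E) ⊗ₜ[ℂ] y) := rfl

theorem restrictForm_biDer {E : Type*} [AddCommGroup E] [Module ℂ E] (f : E ⊗[ℂ] E →ₗ[ℂ] ℂ)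
    (N : Submodule ℂ E) (D : Module.End ℂ E) (D' : Module.End ℂ N)
    (h : ∀ x, (D' x : E) = D x) (x y : N) :
    restrictForm f N (D' x) y + restrictForm f N x (D' y) =
      f (biDer D ((x : E) ⊗ₜ[ℂ] (y : E))) := by
  rw [biDer_tmul, map_add, restrictForm_apply, restrictForm_apply, h, h]

/-- The equivariant form on `Λ⁷ S⁺`. -/
def lambdaForm : LSeven →ₗ[ℂ] LSeven →ₗ[ℂ] ℂ := restrictForm covariant (⋀[ℂ]^7 Splus)

theorem lambdaForm_apply (x y : LSeven) :
    lambdaForm x y = covariant ((x : ExteriorAlgebra ℂ Splus) ⊗ₜ[ℂ] y) := by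
  rw [lambdaForm, restrictForm_apply]

theorem lambdaForm_extDer (f : Module.End ℂ Splus) (x y : LSeven) :
    lambdaForm (extDer 7 f x) y + lambdaForm x (extDer 7 f y) =
      covariant (biDer (extDerAux f) ((x : ExteriorAlgebra ℂ Splus) ⊗ₜ[ℂ] y)) := by
  rw [lambdaForm, restrictForm_biDer covariant _ (extDerAux f) (extDer 7 f) (coe_extDer 7 f)]

theorem lambdaForm_lowering (i : Fin 5) (x y : LSeven) :
    lambdaForm (lowering lambdaAct i x) y + lambdaForm x (lowering lambdaAct i y) = 0 := by
  rw [lowering_eq, lambdaAct, lambdaForm_extDer, ← lowering_eq spinAct, covariant_lowering]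

theorem cartan_lambdaAct (k : Fin 5) : cartan lambdaAct k = extDer 7 (cartan spinAct k) := rfl

theorem lambdaForm_cartan (k : Fin 5) (x y : LSeven) :
    lambdaForm (cartan lambdaAct k x) y + lambdaForm x (cartan lambdaAct k y) =
      (fiveOmega k : ℂ) * lambdaForm x y := by
  have h : (fiveOmega k : ℂ) = 5 * if k = 0 then 1 else 0 := by
    fin_cases k <;> simp [fiveOmega]
  rw [cartan_lambdaAct, lambdaForm_extDer, covariant_cartan, h, lambdaForm_apply]

/-- The vectors at which the form is evaluated: the images of `vᵢ` under successive operators. -/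
def applyPolys (l : List ((Bool × Fin 5) × (Bool × Fin 5))) (P : SPoly) : SPoly :=
  l.foldr (fun p P => normPoly (derPoly p.1 p.2 P)) P

theorem exists_applyPolys (c : Bool) (l : List ((Bool × Fin 5) × (Bool × Fin 5)))
    (hl : ∀ p ∈ l, dualIdx p.1 ≠ p.2) :
    ∃ x ∈ generated lambdaAct (hwLambda c),
      (x : ExteriorAlgebra ℂ Splus) = evalPoly (applyPolys l [(1, hwMono c)]) := by
  induction l with
  | nil => exact ⟨hwLambda c, mem_generated _ _, by simp [coe_hwLambda, applyPolys, evalPoly]⟩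
  | cons p l ih =>
    obtain ⟨x, hx, h⟩ := ih fun p hp => hl p (List.mem_cons_of_mem _ hp)
    refine ⟨lambdaAct (stdVec p.1) (stdVec p.2) x, generated_stable _ _ _ _ x hx, ?_⟩
    rw [lambdaAct, coe_extDer, h, extDerAux_evalPoly _ _ (hl p List.mem_cons_self)]
    rfl

/-- The operators whose values on `v₁` and `v₂` pair nontrivially. -/
def leftOps (c : Bool) : List ((Bool × Fin 5) × (Bool × Fin 5)) :=
  if c then [((false, 1), (true, 0))] else []

/-- The operators whose values on `v₁` and `v₂` pair nontrivially. -/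
def rightOps (c : Bool) : List ((Bool × Fin 5) × (Bool × Fin 5)) :=
  if c then [((true, 1), (true, 0)), ((true, 2), (true, 1)), ((false, 4), (true, 3))] else
    [((true, 2), (true, 1)), ((true, 2), (true, 1)), ((true, 2), (true, 1)), ((true, 4), (true, 3))]

/-- The form vanishes unless the weights of its arguments add up to 5L₁, which dictates the
operators. Twice the weight of v₁ is (5, 3, 3, 1, 1), and the operators remove 3(L₂ + L₃) + (L₄ +
L₅); twice the weight of v₂ is (7, 1, 1, 1, −1), and they remove 2L₁ + L₂ + L₃ + L₄ − L₅. -/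
theorem covariantPoly_ne_zero : ∀ c,
    covariantPoly (applyPolys (leftOps c) [(1, hwMono c)])
        (applyPolys (rightOps c) [(1, hwMono c)]) +
      covariantPoly (applyPolys (rightOps c) [(1, hwMono c)])
        (applyPolys (leftOps c) [(1, hwMono c)]) ≠ 0 := by
  decide +kernel

theorem exists_lambdaForm_ne_zero (c : Bool) :
    ∃ x ∈ generated lambdaAct (hwLambda c), ∃ y ∈ generated lambdaAct (hwLambda c),
      lambdaForm x y + lambdaForm y x ≠ 0 := by
  have h1 : ∀ c, (∀ p ∈ leftOps c, dualIdx p.1 ≠ p.2) ∧ ∀ p ∈ rightOps c, dualIdx p.1 ≠ p.2 := by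
    decide
  obtain ⟨x, hx, hx'⟩ := exists_applyPolys c (leftOps c) (h1 c).1
  obtain ⟨y, hy, hy'⟩ := exists_applyPolys c (rightOps c) (h1 c).2
  refine ⟨x, hx, y, hy, ?_⟩
  rw [lambdaForm_apply, lambdaForm_apply, hx', hy', covariant_evalPoly, covariant_evalPoly,
    ← Int.cast_add, Int.cast_ne_zero]
  exact covariantPoly_ne_zero c

/-- The vector is nonzero because the form would otherwise vanish on the submodule it generates. -/
theorem isHighest_hwLambda (c : Bool) : IsHighest lambdaAct (hwWeight c) (hwLambda c) := by
  refine ⟨fun h0 => ?_, raising_hwLambda c, cartan_hwLambda c⟩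
  obtain ⟨x, hx, y, -, h⟩ := exists_lambdaForm_ne_zero c
  have hx0 : x ∈ (⊥ : Submodule ℂ LSeven) := (Submodule.mem_sInf).mp hx ⊥ ⟨h0, fun a b x hx => by
    rw [(Submodule.mem_bot ℂ).mp hx, map_zero]; exact Submodule.zero_mem _⟩
  rw [(Submodule.mem_bot ℂ).mp hx0] at h
  simp at h

theorem exists_highest_symPow_generated (c : Bool) :
    ∃ w ∈ symPow 2 (generated lambdaAct (hwLambda c)),
      IsHighestWeightVector symLAct fiveOmega w := by
  obtain ⟨x, hx, y, hy, h⟩ := exists_lambdaForm_ne_zero c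
  exact exists_highest_symPow_two lambdaFrame isLieAct_lambdaAct _ le_top
    (generated_stable lambdaAct (hwLambda c)) lambdaForm lambdaForm_lowering fiveOmega
    lambdaForm_cartan hx hy h

/-- Submodules generated by highest weight vectors of different weights are orthogonal. -/
theorem herm_generated {M : Type*} [AddCommGroup M] [Module ℂ M]
    {act : Std → Std → Module.End ℂ M} {S : Submodule ℂ M} (φ : Frame act S) (h : IsLieAct act)
    {lam lam' : Fin 5 → ℚ} {w w' : M} (hw : IsHighest act lam w) (hw' : IsHighest act lam' w')
    (hne : lam ≠ lam') (x y : M) (hx : x ∈ generated act w) (hy : y ∈ generated act w') :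
    φ.herm x y = 0 := by
  -- Eigenvectors of a self-adjoint operator for distinct real eigenvalues are orthogonal. Lowering
  -- operators are then moved across the form as raising operators.
  have h0 : φ.herm w w' = 0 := by
    obtain ⟨k, hk⟩ := Function.ne_iff.mp hne
    have h1 := φ.herm_cartan h k w w'
    rw [hw.2.2, hw'.2.2, φ.herm_smul_left, map_smul, smul_eq_mul,
      show star ((lam k : ℚ) : ℂ) = lam k from star_ratCast _] at h1
    have h2 : ((lam k : ℂ) - lam' k) * φ.herm w w' = 0 := by rw [sub_mul, h1, sub_self]
    refine (mul_eq_zero.mp h2).resolve_left fun h3 => hk ?_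
    exact_mod_cast sub_eq_zero.mp h3
  have h1 : ∀ I, ∀ y ∈ generated act w', φ.herm (word act I w) y = 0 := by
    intro I
    induction I with
    | nil =>
      intro y hy
      rw [generated_eq_wordSpan h hw'] at hy
      refine Submodule.span_induction (p := fun y _ => φ.herm w y = 0) ?_ ?_ ?_ ?_ hy
      · rintro _ ⟨J, rfl⟩
        cases J with
        | nil => exact h0
        | cons j J =>
          change φ.herm w (word act (j :: J) w') = 0
          rw [word_cons, ← φ.herm_raise, hw.2.1, φ.herm_zero_left]
      · exact map_zero _
      · intro x y _ _ hx hy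
        rw [map_add, hx, hy, add_zero]
      · intro t x _ hx
        rw [map_smul, hx, smul_zero]
    | cons i I ih =>
      intro y hy
      rw [word_cons, φ.herm_lower]
      exact ih _ (raising_mem (generated_stable act w') i hy)
  rw [generated_eq_wordSpan h hw] at hx
  refine Submodule.span_induction (p := fun x _ => φ.herm x y = 0) ?_ ?_ ?_ ?_ hx
  · rintro _ ⟨I, rfl⟩
    exact h1 I y hy
  · exact φ.herm_zero_left y
  · intro x x' _ _ hx hx'
    rw [φ.herm_add_left, hx, hx', add_zero]
  · intro t x _ hx
    rw [φ.herm_smul_left, hx, mul_zero]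

theorem disjoint_V₁_V₂ : Disjoint V₁ V₂ := by
  rw [Submodule.disjoint_def]
  intro x hx hy
  exact lambdaFrame.eq_zero_of_herm Submodule.mem_top
    (herm_generated lambdaFrame isLieAct_lambdaAct (isHighest_hwLambda false)
      (isHighest_hwLambda true) (fun h => by
        -- The L₁-coordinates of the two weights are 5/2 and 7/2.
        have h1 : hwWeight false 0 ≠ hwWeight true 0 := by decide +kernel
        exact h1 (congrFun h 0)) x x hx hy)

/-! ### The inverse of the invariant form on an irreducible self-dual module -/

section Gram

/-- The invariant bilinear form on words, for a self-dual module in which the lowest weight vector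
is a multiple `q⁻¹` of the word `K`. -/
def gramForm (lam : Fin 5 → ℚ) (K : List (Fin 5)) (q : ℚ) : List (Fin 5) → List (Fin 5) → ℚ
  | I, [] => q⁻¹ * wordForm lam I K
  | I, j :: J => -gramForm lam K q (j :: I) J

variable {M : Type*} [AddCommGroup M] [Module ℂ M] {act : Std → Std → Module.End ℂ M}
  {S : Submodule ℂ M}

/-- A highest weight vector `w` of a self-dual module, with an involution `θ` that exchanges the
raising and lowering operators up to sign. -/
structure SelfDual (φ : Frame act S) (lam : Fin 5 → ℚ) (w : M) (θ : Module.End ℂ M)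
    (K : List (Fin 5)) (q : ℚ) : Prop where
  isLieAct : IsLieAct act
  isHighest : IsHighest act lam w
  mem : w ∈ S
  stable : ∀ i, ∀ x ∈ S, lowering act i x ∈ S
  involutive : ∀ x, θ (θ x) = x
  exchange : ∀ i x, θ (lowering act i x) = -raising act i (θ x)
  ne_zero : q ≠ 0
  lowest : word act K w = (q : ℂ) • θ w

variable {φ : Frame act S} {lam : Fin 5 → ℚ} {w : M} {θ : Module.End ℂ M} {K : List (Fin 5)}
  {q : ℚ}

/-- A basis of words. -/
structure WordBasis (act : Std → Std → Module.End ℂ M) (w : M) {κ : Type*}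
    (b : κ → List (Fin 5)) : Prop where
  independent : LinearIndependent ℂ fun k => word act (b k) w
  span : Submodule.span ℂ (Set.range fun k => word act (b k) w) = wordSpan act w

/-- θ turns a lowering operator into minus a raising operator, whose adjoint is the lowering
operator again. So a letter of J moves to I with a sign, and for empty J the vector θ w is q⁻¹ times
the word K. -/
theorem herm_gramForm (X : SelfDual φ lam w θ K q)
    (I J : List (Fin 5)) :
    φ.herm (word act I w) (θ (word act J w)) = (gramForm lam K q I J : ℂ) * φ.herm w w := by
  have h2 : ∀ i y, φ.herm w (lowering act i y) = 0 := fun i y => by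
    rw [← φ.herm_raise, X.isHighest.2.1 i, φ.herm_zero_left]
  induction J generalizing I with
  | nil =>
    have h1 := form_word X.isLieAct X.isHighest (fun x => φ.herm x) φ.herm_lower h2 I K
    rw [X.lowest, map_smul, smul_eq_mul] at h1
    have hq' : (q : ℂ) ≠ 0 := Rat.cast_ne_zero.mpr X.ne_zero
    rw [word_nil, gramForm]
    push_cast
    rw [mul_assoc, ← h1, inv_mul_cancel_left₀ hq']
  | cons j J ih =>
    rw [word_cons, X.exchange, map_neg, ← φ.herm_lower, ← word_cons, ih, gramForm]
    push_cast
    ring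

theorem reflection_mem_wordSpan (X : SelfDual φ lam w θ K q)
    (x : M) (hx : x ∈ wordSpan act w) : θ x ∈ wordSpan act w := by
  have hst := generated_stable act w
  rw [generated_eq_wordSpan X.isLieAct X.isHighest] at hst
  refine Submodule.span_induction (p := fun x _ => θ x ∈ wordSpan act w) ?_ ?_ ?_ ?_ hx
  · rintro _ ⟨J, rfl⟩
    change θ (word act J w) ∈ _
    induction J with
    | nil =>
      have h1 : θ w = (q : ℂ)⁻¹ • word act K w := by
        rw [X.lowest, inv_smul_smul₀ (Rat.cast_ne_zero.mpr X.ne_zero)]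
      rw [word_nil, h1]
      exact Submodule.smul_mem _ _ (word_mem_wordSpan w K)
    | cons j J ih =>
      rw [word_cons, X.exchange]
      exact Submodule.neg_mem _ (raising_mem hst j ih)
  · rw [map_zero]
    exact Submodule.zero_mem _
  · intro x y _ _ hx hy
    rw [map_add]
    exact Submodule.add_mem _ hx hy
  · intro t x _ hx
    rw [map_smul]
    exact Submodule.smul_mem _ _ hx

variable {κ : Type*} [Fintype κ] [DecidableEq κ] {b : κ → List (Fin 5)}

theorem herm_eq_zero_of_span {ι : Type*} (v : ι → M) (y : M)
    (hv : ∀ k, φ.herm (v k) y = 0) (x : M) (hx : x ∈ Submodule.span ℂ (Set.range v)) :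
    φ.herm x y = 0 := by
  refine Submodule.span_induction (p := fun x _ => φ.herm x y = 0) ?_ ?_ ?_ ?_ hx
  · rintro _ ⟨k, rfl⟩
    exact hv k
  · exact φ.herm_zero_left y
  · intro x x' _ _ hx hx'
    rw [φ.herm_add_left, hx, hx', add_zero]
  · intro t x _ hx
    rw [φ.herm_smul_left, hx, mul_zero]

/-- The Gram matrix of a basis of words. -/
def gramMatrix (lam : Fin 5 → ℚ) (K : List (Fin 5)) (q : ℚ) (b : κ → List (Fin 5)) :
    Matrix κ κ ℚ := fun k l => gramForm lam K q (b k) (b l)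

/-- A null vector of the matrix gives a y for which θ y is orthogonal to all words. As θ y lies in
their span, positive definiteness makes it zero, and independence makes the null vector zero. -/
theorem isUnit_gramMatrix (X : SelfDual φ lam w θ K q) (Y : WordBasis act w b)
    : IsUnit (gramMatrix lam K q b).det := by
  rw [isUnit_iff_ne_zero]
  intro h0
  obtain ⟨v, hv0, hv⟩ := Matrix.exists_mulVec_eq_zero_iff.mpr h0
  set y := ∑ l, (v l : ℂ) • word act (b l) w with hy
  have h1 : ∀ k, φ.herm (word act (b k) w) (θ y) = 0 := by
    intro k
    have h2 := congrArg (Rat.cast : ℚ → ℂ) (congrFun hv k)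
    simp only [Matrix.mulVec, dotProduct, gramMatrix, Pi.zero_apply] at h2
    push_cast at h2
    rw [hy, map_sum, map_sum]
    simp only [map_smul, herm_gramForm X, smul_eq_mul]
    rw [← zero_mul (φ.herm w w), ← h2, Finset.sum_mul]
    refine Finset.sum_congr rfl fun l _ => by ring
  have hyS : y ∈ wordSpan act w := Submodule.sum_mem _ fun l _ =>
    Submodule.smul_mem _ _ (word_mem_wordSpan w _)
  have h2 := reflection_mem_wordSpan X y hyS
  have h3 : θ y = 0 := by
    refine φ.eq_zero_of_herm ?_ (herm_eq_zero_of_span (φ := φ) _ _ h1 _ (Y.span ▸ h2))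
    have h4 : wordSpan act w ≤ S := by
      refine Submodule.span_le.mpr ?_
      rintro _ ⟨I, rfl⟩
      exact word_mem X.stable X.mem I
    exact h4 h2
  have h4 : y = 0 := by rw [← X.involutive y, h3, map_zero]
  have h5 := (Fintype.linearIndependent_iff.mp Y.independent) (fun l => (v l : ℂ)) h4
  exact hv0 (funext fun l => Rat.cast_eq_zero.mp (h5 l))

/-- The coordinates solve a linear system whose invertible matrix and right-hand side, both made of
values of `gramForm`, are rational. -/
theorem exists_rat_coords (X : SelfDual φ lam w θ K q) (Y : WordBasis act w b)
    (I : List (Fin 5)) :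
    ∃ a : κ → ℚ, word act I w = ∑ k, (a k : ℂ) • word act (b k) w := by
  have hG := isUnit_gramMatrix X Y
  set G := gramMatrix lam K q b with hGdef
  obtain ⟨z, hz⟩ := (Submodule.mem_span_range_iff_exists_fun ℂ).mp (Y.span ▸ word_mem_wordSpan w I)
  have hww : φ.herm w w ≠ 0 := fun h0 => X.isHighest.1 (φ.eq_zero_of_herm X.mem h0)
  set g : κ → ℚ := fun k => gramForm lam K q (b k) I
  have h1 : (G.map (Rat.castHom ℂ)).mulVec z = fun k => ((g k : ℚ) : ℂ) := by
    funext k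
    have h2 := herm_gramForm X (b k) I
    rw [← hz, map_sum, map_sum] at h2
    simp only [map_smul, herm_gramForm X, smul_eq_mul] at h2
    refine mul_right_cancel₀ hww (Eq.trans ?_ h2)
    simp only [Matrix.mulVec, dotProduct, Matrix.map_apply, Finset.sum_mul, hGdef, gramMatrix]
    refine Finset.sum_congr rfl fun l _ => ?_
    rw [eq_ratCast]
    ring
  have h2 : (G⁻¹.map (Rat.castHom ℂ)) * (G.map (Rat.castHom ℂ)) = 1 := by
    rw [← Matrix.map_mul, Matrix.nonsing_inv_mul _ hG, Matrix.map_one _ (map_zero _) (map_one _)]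
  refine ⟨G⁻¹.mulVec g, ?_⟩
  rw [← hz]
  refine Finset.sum_congr rfl fun k _ => ?_
  have h3 : z k = ((G⁻¹.map (Rat.castHom ℂ)).mulVec ((G.map (Rat.castHom ℂ)).mulVec z)) k := by
    rw [Matrix.mulVec_mulVec, h2, Matrix.one_mulVec]
  rw [h3, h1]
  congr 1
  simp [Matrix.mulVec, dotProduct]

/-- The inverse of the Gram matrix is invariant. -/
theorem gramMatrix_inv_invariant (X : SelfDual φ lam w θ K q) (Y : WordBasis act w b)
    (D : Module.End ℂ M)
    (hD : ∀ x y, φ.herm (D x) (θ y) = -φ.herm x (θ (D y))) (m : Matrix κ κ ℚ)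
    (hm : ∀ k, D (word act (b k) w) = ∑ l, (m l k : ℂ) • word act (b l) w) :
    m * (gramMatrix lam K q b)⁻¹ + (gramMatrix lam K q b)⁻¹ * m.transpose = 0 := by
  have hG := isUnit_gramMatrix X Y
  set G := gramMatrix lam K q b with hGdef
  have hww : φ.herm w w ≠ 0 := fun h0 => X.isHighest.1 (φ.eq_zero_of_herm X.mem h0)
  have h1 : m.transpose * G + G * m = 0 := by
    ext k l
    have h2 := hD (word act (b k) w) (word act (b l) w)
    have h3 : φ.herm (D (word act (b k) w)) (θ (word act (b l) w)) =
        ((m.transpose * G) k l : ℚ) * φ.herm w w := by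
      have h4 : ∀ (s : κ → M) y, φ.herm (∑ j, s j) y = ∑ j, φ.herm (s j) y := fun s y => by
        simp [Frame.herm_apply, star_sum, sum_dotProduct]
      rw [hm, h4]
      simp only [φ.herm_smul_left, herm_gramForm X, Matrix.mul_apply, hGdef,
        gramMatrix, Matrix.transpose_apply]
      push_cast
      rw [Finset.sum_mul]
      refine Finset.sum_congr rfl fun j _ => ?_
      rw [show star ((m j k : ℚ) : ℂ) = m j k from star_ratCast _, mul_assoc]
    have h4 : φ.herm (word act (b k) w) (θ (D (word act (b l) w))) =
        ((G * m) k l : ℚ) * φ.herm w w := by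
      rw [hm, map_sum, map_sum]
      simp only [map_smul, herm_gramForm X, Matrix.mul_apply, hGdef,
        gramMatrix, smul_eq_mul]
      push_cast
      rw [Finset.sum_mul]
      refine Finset.sum_congr rfl fun j _ => by ring
    rw [h3, h4, ← neg_mul] at h2
    have h5 := mul_right_cancel₀ hww h2
    rw [Matrix.add_apply, Matrix.zero_apply]
    have h6 : (m.transpose * G) k l = -(G * m) k l := by exact_mod_cast h5
    rw [h6, neg_add_cancel]
  -- Multiplying the invariance of the form G by G⁻¹ on both sides turns it into the invariance of
  -- G⁻¹ as a tensor.
  have h2 : G⁻¹ * (m.transpose * G + G * m) * G⁻¹ = 0 := by rw [h1, mul_zero, zero_mul]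
  rw [mul_add, add_mul, ← mul_assoc G⁻¹ G, Matrix.nonsing_inv_mul _ hG, one_mul, mul_assoc,
    mul_assoc, Matrix.mul_nonsing_inv _ hG, mul_one, add_comm] at h2
  exact h2

end Gram

/-! ### The module `V(5ω₁)` -/

section SymPow

variable {M : Type*} [AddCommGroup M] [Module ℂ M]

theorem symDer_mem_symPow (f : Module.End ℂ M) {N : Submodule ℂ M} (hN : ∀ x ∈ N, f x ∈ N)
    (n : ℕ) (x : SymmetricAlgebra ℂ M) (hx : x ∈ symPow n N) : symDer f x ∈ symPow n N := by
  induction n generalizing x with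
  | zero =>
    rw [symPow, pow_zero] at hx
    obtain ⟨r, rfl⟩ := Submodule.mem_one.mp hx
    rw [symDer_algebraMap]
    exact Submodule.zero_mem _
  | succ n ih =>
    rw [symPow, pow_succ] at hx ⊢
    refine Submodule.mul_induction_on hx ?_ ?_
    · rintro a ha _ ⟨m, hm, rfl⟩
      rw [symDer_mul, symDer_ι]
      exact Submodule.add_mem _ (Submodule.mul_mem_mul ha ⟨_, hN m hm, rfl⟩)
        (Submodule.mul_mem_mul (ih a ha) ⟨m, hm, rfl⟩)
    · intro a b ha hb
      rw [map_add]
      exact Submodule.add_mem _ ha hb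

theorem symDer_ι_pow (f : Module.End ℂ M) (m : M) (n : ℕ) :
    symDer f (SymmetricAlgebra.ι ℂ M m ^ (n + 1)) =
      ((n + 1 : ℕ) : ℂ) • (SymmetricAlgebra.ι ℂ M m ^ n * SymmetricAlgebra.ι ℂ M (f m)) := by
  induction n with
  | zero => simp [symDer_ι]
  | succ n ih =>
    rw [pow_succ, symDer_mul, ih, symDer_ι, pow_succ]
    push_cast
    rw [smul_mul_assoc]
    have h : SymmetricAlgebra.ι ℂ M m ^ n * SymmetricAlgebra.ι ℂ M (f m) *
        SymmetricAlgebra.ι ℂ M m = SymmetricAlgebra.ι ℂ M m ^ n * SymmetricAlgebra.ι ℂ M m *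
        SymmetricAlgebra.ι ℂ M (f m) := by ring
    rw [h]
    module

theorem symDer_pow_mul_pow (f : Module.End ℂ M) {x y : M} (hx : f x = y) (hy : f y = 0)
    (a b : ℕ) :
    symDer f (SymmetricAlgebra.ι ℂ M x ^ (a + 1) * SymmetricAlgebra.ι ℂ M y ^ b) =
      ((a + 1 : ℕ) : ℂ) • (SymmetricAlgebra.ι ℂ M x ^ a * SymmetricAlgebra.ι ℂ M y ^ (b + 1)) := by
  have h : symDer f (SymmetricAlgebra.ι ℂ M y ^ b) = 0 := by
    cases b with
    | zero => simp [symDer_one]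
    | succ b => rw [symDer_ι_pow, hy, map_zero, mul_zero, smul_zero]
  rw [symDer_mul, h, mul_zero, zero_add, symDer_ι_pow, hx, smul_mul_assoc, mul_assoc, pow_succ']

end SymPow

theorem isHighest_hwStd : IsHighest symStdAct (fun k => (fiveOmega k : ℚ)) hwStd := by
  refine ⟨fun h0 => ?_, fun i => ?_, fun k => ?_⟩
  -- Evaluation at the first coordinate of U_∞ sends e₁⁵ to 1.
  · have h1 := congrArg (SymmetricAlgebra.lift (LinearMap.proj 0 ∘ₗ LinearMap.snd ℂ
      (Module.Dual ℂ U) U)) h0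
    simp [hwStd, e] at h1
  · have h1 : ∀ i : Fin 5, ∀ j, stdEntry (raiseIdx i).1 (raiseIdx i).2 j (false, 0) = 0 := by
      decide +kernel
    have h2 : raising stdAct i (e 0) = 0 := by
      rw [raising_eq]
      change stdAct _ _ (stdVec (false, 0)) = 0
      rw [stdAct_stdVec]
      simp [h1]
    have h3 : raising symStdAct i = symDer (raising stdAct i) := by rw [raising_eq, raising_eq]; rfl
    rw [h3, hwStd, symDer_ι_pow _ _ 4, h2, map_zero, mul_zero, smul_zero]
  · have h1 : cartan stdAct k (e 0) = (if k = 0 then (1 : ℂ) else 0) • e 0 := by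
      change stdAct (stdVec (false, k)) (stdVec (true, k)) (stdVec (false, 0)) =
        _ • stdVec (false, 0)
      rw [stdAct_stdVec]
      have h2 : ∀ k j, stdEntry (false, k) (true, k) j (false, 0) =
          if k = 0 ∧ j = (false, 0) then 1 else 0 := by decide +kernel
      simp only [h2]
      by_cases hk : k = 0 <;> simp [hk]
    have h3 : cartan symStdAct k = symDer (cartan stdAct k) := rfl
    rw [h3, hwStd, symDer_ι_pow _ _ 4, h1, map_smul, mul_smul_comm, smul_smul, ← pow_succ]
    congr 1
    fin_cases k <;> simp [fiveOmega]

theorem hwStd_mem : hwStd ∈ symPow 5 (⊤ : Submodule ℂ Std) :=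
  Submodule.pow_mem_pow _ (Submodule.mem_map_of_mem Submodule.mem_top) 5

/-- The reflection of `Std` that exchanges `eᵢ` and `e₋ᵢ`. -/
def stdReflection : Module.End ℂ Std := stdBasis.constr ℂ fun p => stdVec (dualIdx p)

theorem stdReflection_stdVec (p : Bool × Fin 5) :
    stdReflection (stdVec p) = stdVec (dualIdx p) := by
  rw [stdReflection, ← stdBasis_apply, Module.Basis.constr_basis]

/-- Conjugation by the swap of e_i and e_{-i} sends X_{-α} to −X_α, the Chevalley involution; in
coordinates this is a finite check. -/
theorem stdReflection_lowering (i : Fin 5) :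
    stdReflection * lowering stdAct i = (-raising stdAct i) * stdReflection := by
  refine stdBasis.ext fun r => ?_
  rw [stdBasis_apply, Module.End.mul_apply, Module.End.mul_apply, LinearMap.neg_apply,
    stdReflection_stdVec, lowering_eq, raising_eq, stdAct_stdVec, stdAct_stdVec, map_sum,
    ← Finset.sum_neg_distrib]
  have hd : Function.Involutive dualIdx := fun p => by simp [dualIdx]
  rw [← Equiv.sum_comp (Function.Involutive.toPerm dualIdx hd)]
  have h1 : ∀ i j r, stdEntry (lowIdx i).1 (lowIdx i).2 (dualIdx j) r =
      -stdEntry (raiseIdx i).1 (raiseIdx i).2 j (dualIdx r) := by decide +kernel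
  refine Finset.sum_congr rfl fun j _ => ?_
  rw [Function.Involutive.coe_toPerm, map_smul, stdReflection_stdVec, hd j, h1]
  push_cast
  rw [neg_smul]

theorem symMap_comp {M : Type*} [AddCommGroup M] [Module ℂ M] (f g : Module.End ℂ M)
    (x : SymmetricAlgebra ℂ M) : symMap f (symMap g x) = symMap (f * g) x := by
  have h : (symMap f).comp (symMap g) = symMap (f * g) := by
    ext m
    simp [symMap]
  exact DFunLike.congr_fun h x

theorem symMap_id {M : Type*} [AddCommGroup M] [Module ℂ M] (x : SymmetricAlgebra ℂ M) :
    symMap (1 : Module.End ℂ M) x = x := by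
  have h : symMap (1 : Module.End ℂ M) = AlgHom.id ℂ _ := by
    ext m
    simp [symMap]
  exact DFunLike.congr_fun h x

theorem lowering_symStdAct (i : Fin 5) : lowering symStdAct i = symDer (lowering stdAct i) := by
  rw [lowering_eq, lowering_eq]
  rfl

theorem raising_symStdAct (i : Fin 5) : raising symStdAct i = symDer (raising stdAct i) := by
  rw [raising_eq, raising_eq]
  rfl

/-- With X x = y and X y = 0, five applications of X to x⁵ give 5! y⁵. -/
theorem word_replicate_lowering {x y : Std} {i : Fin 5} (hx : lowering stdAct i x = y)
    (hy : lowering stdAct i y = 0) (L : List (Fin 5)) (t : ℚ)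
    (hL : word symStdAct L hwStd = (t : ℂ) • SymmetricAlgebra.ι ℂ Std x ^ 5) :
    word symStdAct (i :: i :: i :: i :: i :: L) hwStd =
      ((120 * t : ℚ) : ℂ) • SymmetricAlgebra.ι ℂ Std y ^ 5 := by
  have h0 := symDer_pow_mul_pow _ hx hy 4 0
  have h1 := symDer_pow_mul_pow _ hx hy 3 1
  have h2 := symDer_pow_mul_pow _ hx hy 2 2
  have h3 := symDer_pow_mul_pow _ hx hy 1 3
  have h4 := symDer_pow_mul_pow _ hx hy 0 4
  rw [pow_zero, mul_one] at h0
  rw [pow_zero, one_mul] at h4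
  simp only [word_cons, hL, lowering_symStdAct, map_smul]
  norm_num at h0 h1 h2 h3 h4
  simp only [h0, h1, h2, h3, h4, map_smul, smul_smul]
  congr 1
  push_cast
  ring

/-- The sequence of lowering operators that leads to the lowest weight vector. -/
def lowestWord : List (Fin 5) :=
  [0, 0, 0, 0, 0, 1, 1, 1, 1, 1, 2, 2, 2, 2, 2, 4, 4, 4, 4, 4, 3, 3, 3, 3, 3, 2, 2, 2, 2, 2,
    1, 1, 1, 1, 1, 0, 0, 0, 0, 0]

theorem lowering_stdAct_stdVec (i : Fin 5) (r : Bool × Fin 5) (z : ℤ) (s : Bool × Fin 5)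
    (h : ∀ j, stdEntry (lowIdx i).1 (lowIdx i).2 j r = if j = s then z else 0) :
    lowering stdAct i (stdVec r) = (z : ℂ) • stdVec s := by
  rw [lowering_eq, stdAct_stdVec]
  simp [h, ite_smul]

/-- The fifth powers run through e₁, e₂, e₃, e₄, e₅, e₋₄, e₋₃, e₋₂, e₋₁. Each of the eight steps
contributes 5!, and the four signs in the second half cancel. -/
theorem word_lowestWord : word symStdAct lowestWord hwStd =
    ((120 ^ 8 : ℚ) : ℂ) • symMap stdReflection hwStd := by
  have hl : ∀ (i : Fin 5) (r : Bool × Fin 5) (z : ℤ) (s : Bool × Fin 5) (z' : ℂ),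
      (∀ j, stdEntry (lowIdx i).1 (lowIdx i).2 j r = if j = s then z else 0) →
      lowering stdAct i (z' • stdVec r) = (z * z') • stdVec s := fun i r z s z' h => by
    rw [map_smul, lowering_stdAct_stdVec i r z s h, smul_smul, mul_comm]
  have hz : ∀ (i : Fin 5) (r : Bool × Fin 5) (z' : ℂ),
      (∀ j, stdEntry (lowIdx i).1 (lowIdx i).2 j r = 0) →
      lowering stdAct i (z' • stdVec r) = 0 := fun i r z' h => by
    rw [map_smul, lowering_eq, stdAct_stdVec]
    simp [h]
  have s0 : word symStdAct [] hwStd =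
      ((1 : ℚ) : ℂ) • SymmetricAlgebra.ι ℂ Std ((1 : ℂ) • stdVec (false, 0)) ^ 5 := by
    rw [Rat.cast_one, one_smul, one_smul]
    rfl
  have s1 := word_replicate_lowering (hl 0 (false, 0) 1 (false, 1) _ (by decide +kernel))
    (hz _ _ _ (by decide +kernel)) _ _ s0
  have s2 := word_replicate_lowering (hl 1 (false, 1) 1 (false, 2) _ (by decide +kernel))
    (hz _ _ _ (by decide +kernel)) _ _ s1
  have s3 := word_replicate_lowering (hl 2 (false, 2) 1 (false, 3) _ (by decide +kernel))
    (hz _ _ _ (by decide +kernel)) _ _ s2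
  have s4 := word_replicate_lowering (hl 3 (false, 3) 1 (false, 4) _ (by decide +kernel))
    (hz _ _ _ (by decide +kernel)) _ _ s3
  have s5 := word_replicate_lowering (hl 4 (false, 4) (-1) (true, 3) _ (by decide +kernel))
    (hz _ _ _ (by decide +kernel)) _ _ s4
  have s6 := word_replicate_lowering (hl 2 (true, 3) (-1) (true, 2) _ (by decide +kernel))
    (hz _ _ _ (by decide +kernel)) _ _ s5
  have s7 := word_replicate_lowering (hl 1 (true, 2) (-1) (true, 1) _ (by decide +kernel))
    (hz _ _ _ (by decide +kernel)) _ _ s6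
  have s8 := word_replicate_lowering (hl 0 (true, 1) (-1) (true, 0) _ (by decide +kernel))
    (hz _ _ _ (by decide +kernel)) _ _ s7
  refine s8.trans ?_
  have h1 : symMap stdReflection hwStd = SymmetricAlgebra.ι ℂ Std (stdVec (true, 0)) ^ 5 := by
    rw [hwStd, map_pow, symMap, SymmetricAlgebra.lift_ι_apply, LinearMap.comp_apply]
    have h2 := stdReflection_stdVec (false, 0)
    change stdReflection (e 0) = _ at h2
    rw [h2]
    rfl
  rw [h1]
  norm_num

theorem selfDual_hwStd : SelfDual symStdFrame (fun k => (fiveOmega k : ℚ)) hwStd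
    (symMap stdReflection).toLinearMap lowestWord (120 ^ 8) where
  isLieAct := isLieAct_symStdAct
  isHighest := isHighest_hwStd
  mem := hwStd_mem
  stable i x hx := by
    rw [lowering_symStdAct]
    exact symDer_mem_symPow _ (fun _ _ => Submodule.mem_top) 5 x hx
  involutive x := by
    have h : stdReflection * stdReflection = 1 := by
      refine stdBasis.ext fun r => ?_
      rw [stdBasis_apply, Module.End.mul_apply, stdReflection_stdVec, stdReflection_stdVec]
      simp [dualIdx]
    rw [AlgHom.toLinearMap_apply, AlgHom.toLinearMap_apply, symMap_comp, h, symMap_id]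
  exchange i x := by
    rw [AlgHom.toLinearMap_apply, AlgHom.toLinearMap_apply, lowering_symStdAct,
      symMap_symDer _ _ _ (stdReflection_lowering i), raising_symStdAct,
      ← neg_one_smul ℂ (raising stdAct i), symDer_smul, LinearMap.smul_apply,
      neg_one_smul]
  ne_zero := by norm_num
  lowest := word_lowestWord

theorem VFive_eq_wordSpan : VFive = wordSpan symStdAct hwStd :=
  generated_eq_wordSpan isLieAct_symStdAct isHighest_hwStd

theorem Frame.finite {M : Type*} [AddCommGroup M] [Module ℂ M]
    {act : Std → Std → Module.End ℂ M} {S : Submodule ℂ M} (φ : Frame act S) :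
    Module.Finite ℂ S := by
  refine Module.Finite.of_injective (φ.coord ∘ₗ S.subtype) ?_
  rw [← LinearMap.ker_eq_bot, LinearMap.ker_eq_bot']
  exact fun x hx => Subtype.ext (φ.inj x x.2 hx)

theorem fvec_eq_word (I : List (Fin 5)) : fvec I = word symStdAct I.reverse hwStd :=
  lowerSeq_eq_word _ I hwStd

/-- There is a finite basis of `V(5ω₁)` of vectors `f_I`. -/
theorem exists_basis_fvec : ∃ A : Finset (List (Fin 5)),
    LinearIndependent ℂ (fun I : A => fvec I) ∧ Submodule.span ℂ (fvec '' A) = VFive := by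
  -- A maximal independent subfamily of all f_I; it is finite because the frame makes Sym⁵ Std
  -- finite-dimensional.
  obtain ⟨b, -, -, hspan, hb⟩ := exists_linearIndepOn_extension (v := fvec)
    (linearIndepOn_empty ℂ fvec) (Set.empty_subset Set.univ)
  have hV : ∀ I, fvec I ∈ symPow 5 (⊤ : Submodule ℂ Std) := fun I => by
    rw [fvec_eq_word]
    exact word_mem selfDual_hwStd.stable hwStd_mem _
  have hfin : b.Finite := by
    have := symStdFrame.finite
    have h1 : LinearIndependent ℂ
        (fun I : b => (⟨fvec I, hV I⟩ : symPow 5 (⊤ : Submodule ℂ Std))) :=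
      LinearIndependent.of_comp (Submodule.subtype _) hb
    exact Set.finite_coe_iff.mp h1.finite
  refine ⟨hfin.toFinset, ?_, ?_⟩
  · have h1 : LinearIndepOn ℂ fvec (hfin.toFinset : Set (List (Fin 5))) := by
      rwa [hfin.coe_toFinset]
    exact h1
  · rw [hfin.coe_toFinset, VFive_eq_wordSpan]
    refine le_antisymm (Submodule.span_le.mpr ?_) (Submodule.span_le.mpr ?_)
    · rintro _ ⟨I, -, rfl⟩
      rw [fvec_eq_word]
      exact word_mem_wordSpan _ _
    · rintro _ ⟨I, rfl⟩
      refine hspan ⟨I.reverse, Set.mem_univ _, ?_⟩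
      rw [fvec_eq_word, List.reverse_reverse]

/-! ### The invariant element of `V(5ω₁) ⊗ V(5ω₁)` and its images -/

section Invariant

/-- On coefficient matrices the infinitesimal action on a tensor product is c ↦ m c + c mᵀ. -/
theorem tensAct_sum {M N κ : Type*} [AddCommGroup M] [Module ℂ M] [AddCommGroup N] [Module ℂ N]
    [Fintype κ] (D : Module.End ℂ M) (D' : Module.End ℂ N) (x : κ → M) (y : κ → N)
    (m c : Matrix κ κ ℚ) (hx : ∀ k, D (x k) = ∑ l, (m l k : ℂ) • x l)
    (hy : ∀ k, D' (y k) = ∑ l, (m l k : ℂ) • y l) (hc : m * c + c * m.transpose = 0) :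
    (TensorProduct.map D LinearMap.id + TensorProduct.map LinearMap.id D' :
        Module.End ℂ (M ⊗[ℂ] N))
      (∑ k, ∑ l, (c k l : ℂ) • (x k ⊗ₜ[ℂ] y l)) = 0 := by
  have h1 : ∀ k l, ((∑ j, (m k j : ℂ) * c j l) + ∑ j, (c k j : ℂ) * m l j) = 0 := by
    intro k l
    have h2 := congrArg (Rat.cast : ℚ → ℂ) (congrFun (congrFun hc k) l)
    simpa [Matrix.mul_apply] using h2
  have h2 : (TensorProduct.map D LinearMap.id + TensorProduct.map LinearMap.id D' :
        Module.End ℂ (M ⊗[ℂ] N))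
      (∑ k, ∑ l, (c k l : ℂ) • (x k ⊗ₜ[ℂ] y l)) =
      ∑ k, ∑ l, ((∑ j, (m k j : ℂ) * c j l) + ∑ j, (c k j : ℂ) * m l j) • (x k ⊗ₜ[ℂ] y l) := by
    simp only [map_sum, map_smul, LinearMap.add_apply, TensorProduct.map_tmul, LinearMap.id_apply,
      hx, hy, TensorProduct.sum_tmul, TensorProduct.tmul_sum, TensorProduct.tmul_smul,
      TensorProduct.smul_tmul', Finset.sum_add_distrib, add_smul, Finset.sum_smul,
      Finset.smul_sum, smul_smul]
    congr 1
    · rw [Finset.sum_comm]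
      conv_rhs => rw [Finset.sum_comm]
      refine Finset.sum_congr rfl fun l _ => ?_
      rw [Finset.sum_comm]
      simp only [← TensorProduct.smul_tmul', mul_comm]
    · refine Finset.sum_congr rfl fun k _ => ?_
      rw [Finset.sum_comm]
      simp only [mul_comm]
  rw [h2]
  simp [h1]

theorem SelfDual.exchange_raising {M : Type*} [AddCommGroup M] [Module ℂ M]
    {act : Std → Std → Module.End ℂ M} {S : Submodule ℂ M} {φ : Frame act S} {lam : Fin 5 → ℚ}
    {w : M} {θ : Module.End ℂ M} {K : List (Fin 5)} {q : ℚ} (X : SelfDual φ lam w θ K q)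
    (i : Fin 5) (x : M) : θ (raising act i x) = -lowering act i (θ x) := by
  have h := X.exchange i (θ x)
  rw [X.involutive] at h
  rw [← neg_eq_iff_eq_neg.mpr h, map_neg, X.involutive]

variable {κ : Type*} [Fintype κ] [DecidableEq κ] {b : κ → List (Fin 5)}

theorem exists_rat_matrix {M : Type*} [AddCommGroup M] [Module ℂ M]
    {act : Std → Std → Module.End ℂ M} {S : Submodule ℂ M} {φ : Frame act S} {lam : Fin 5 → ℚ}
    {w : M} {θ : Module.End ℂ M} {K : List (Fin 5)} {q : ℚ} (X : SelfDual φ lam w θ K q)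
    (Y : WordBasis act w b) (i : Fin 5) :
    (∃ m : Matrix κ κ ℚ, ∀ k, lowering act i (word act (b k) w) =
      ∑ l, (m l k : ℂ) • word act (b l) w) ∧
    ∃ m : Matrix κ κ ℚ, ∀ k, raising act i (word act (b k) w) =
      ∑ l, (m l k : ℂ) • word act (b l) w := by
  have h1 : ∀ l : List (ℚ × List (Fin 5)), ∃ a : κ → ℚ,
      (l.map fun p => (p.1 : ℂ) • word act p.2 w).sum = ∑ k, (a k : ℂ) • word act (b k) w := by
    intro l
    induction l with
    | nil => exact ⟨0, by simp⟩
    | cons p l ih =>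
      obtain ⟨a, ha⟩ := ih
      obtain ⟨a', ha'⟩ := exists_rat_coords X Y p.2
      refine ⟨p.1 • a' + a, ?_⟩
      rw [List.map_cons, List.sum_cons, ha, ha', Finset.smul_sum, ← Finset.sum_add_distrib]
      refine Finset.sum_congr rfl fun k _ => ?_
      simp [add_smul, smul_smul]
  constructor
  · choose a ha using fun k => exists_rat_coords X Y (i :: b k)
    exact ⟨fun l k => a k l, ha⟩
  · choose a ha using fun k => h1 (raisingCoeffs lam i (b k))
    exact ⟨fun l k => a k l, fun k => (raising_word X.isLieAct X.isHighest i (b k)).trans (ha k)⟩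

/-- The map f is only known on words; it commutes with raising operators there because their
coefficients on words are the same in both modules. -/
theorem raising_word_transport {M P : Type*} [AddCommGroup M] [Module ℂ M] [AddCommGroup P]
    [Module ℂ P] {act : Std → Std → Module.End ℂ M} {act' : Std → Std → Module.End ℂ P}
    {lam : Fin 5 → ℚ} {w : M} {w' : P} (h : IsLieAct act) (hw : IsHighest act lam w)
    (h' : IsLieAct act') (hw' : IsHighest act' lam w') (f : M →ₗ[ℂ] P)
    (hf : ∀ I, f (word act I w) = word act' I w') (i : Fin 5) (I : List (Fin 5)) :
    raising act' i (word act' I w') = f (raising act i (word act I w)) := by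
  rw [raising_word h' hw', raising_word h hw, map_list_sum, List.map_map]
  congr 2
  funext p
  simp [hf]

/-- Only the simple root vectors and their negatives need to be checked. Through f₁ and f₂ they act
on the words of w₁ and w₂ by the same rational matrices as on the basis of words of w, for which the
inverse Gram matrix is invariant. -/
theorem annihilates_sum_word {M N N' : Type*} [AddCommGroup M] [Module ℂ M] [AddCommGroup N]
    [Module ℂ N] [AddCommGroup N'] [Module ℂ N']
    {act : Std → Std → Module.End ℂ M} {S : Submodule ℂ M} {φ : Frame act S} {lam : Fin 5 → ℚ}
    {w : M} {θ : Module.End ℂ M} {K : List (Fin 5)} {q : ℚ} (X : SelfDual φ lam w θ K q)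
    (Y : WordBasis act w b) {act₁ : Std → Std → Module.End ℂ N}
    {act₂ : Std → Std → Module.End ℂ N'} (h₁ : IsLieAct act₁) (h₂ : IsLieAct act₂) {w₁ : N}
    {w₂ : N'} (hw₁ : IsHighest act₁ lam w₁) (hw₂ : IsHighest act₂ lam w₂) (f₁ : M →ₗ[ℂ] N)
    (f₂ : M →ₗ[ℂ] N') (hf₁ : ∀ I, f₁ (word act I w) = word act₁ I w₁)
    (hf₂ : ∀ I, f₂ (word act I w) = word act₂ I w₂) (u v : Std) :
    tensAct act₁ act₂ u v (∑ k, ∑ l, (((gramMatrix lam K q b)⁻¹ k l : ℚ) : ℂ) •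
      (word act₁ (b k) w₁ ⊗ₜ[ℂ] word act₂ (b l) w₂)) = 0 := by
  refine (IsLieAct.tensAct h₁ h₂).annihilates (fun i => ?_) (fun i => ?_) u v
  · obtain ⟨m, hm⟩ := (exists_rat_matrix X Y i).2
    have h3 := tensAct_sum (raising act₁ i) (raising act₂ i) (fun k => word act₁ (b k) w₁)
      (fun k => word act₂ (b k) w₂) m (gramMatrix lam K q b)⁻¹
      (fun k => by
        rw [raising_word_transport X.isLieAct X.isHighest h₁ hw₁ f₁ hf₁, hm, map_sum]
        simp only [map_smul, hf₁])
      (fun k => by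
        rw [raising_word_transport X.isLieAct X.isHighest h₂ hw₂ f₂ hf₂, hm, map_sum]
        simp only [map_smul, hf₂])
      (gramMatrix_inv_invariant X Y _ (fun x y => by
        rw [φ.herm_raise, X.exchange_raising, map_neg, neg_neg]) m hm)
    rw [raising_eq, raising_eq] at h3
    rw [raising_eq]
    exact h3
  · obtain ⟨m, hm⟩ := (exists_rat_matrix X Y i).1
    have h3 := tensAct_sum (lowering act₁ i) (lowering act₂ i) (fun k => word act₁ (b k) w₁)
      (fun k => word act₂ (b k) w₂) m (gramMatrix lam K q b)⁻¹
      (fun k => by rw [← word_cons, ← hf₁, word_cons, hm, map_sum]; simp only [map_smul, hf₁])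
      (fun k => by rw [← word_cons, ← hf₂, word_cons, hm, map_sum]; simp only [map_smul, hf₂])
      (gramMatrix_inv_invariant X Y _ (fun x y => by
        rw [φ.herm_lower, X.exchange, map_neg, neg_neg]) m hm)
    rw [lowering_eq, lowering_eq] at h3
    rw [lowering_eq]
    exact h3

/-- Invariance under a Cartan element, which acts on the basis of words by the diagonal matrix of
their weights. -/
theorem gramMatrix_inv_weight {M : Type*} [AddCommGroup M] [Module ℂ M]
    {act : Std → Std → Module.End ℂ M} {S : Submodule ℂ M} {φ : Frame act S} {lam : Fin 5 → ℚ}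
    {w : M} {θ : Module.End ℂ M} {K : List (Fin 5)} {q : ℚ} (X : SelfDual φ lam w θ K q)
    (Y : WordBasis act w b) (j : Fin 5)
    (hj : ∀ x, θ (cartan act j x) = -cartan act j (θ x)) (k l : κ) :
    (wordWeight lam (b k) j + wordWeight lam (b l) j) * (gramMatrix lam K q b)⁻¹ k l = 0 := by
  have h := gramMatrix_inv_invariant X Y (cartan act j)
    (fun x y => by rw [φ.herm_cartan X.isLieAct, hj, map_neg, neg_neg])
    (Matrix.diagonal fun k => wordWeight lam (b k) j) (fun k => by
      rw [cartan_word X.isLieAct X.isHighest, Finset.sum_eq_single k]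
      · rw [Matrix.diagonal_apply_eq]
      · intro l _ hl
        rw [Matrix.diagonal_apply_ne _ hl, Rat.cast_zero, zero_smul]
      · simp)
  have h1 := congrFun (congrFun h k) l
  rw [Matrix.add_apply, Matrix.diagonal_transpose, Matrix.diagonal_mul, Matrix.mul_diagonal,
    Matrix.zero_apply] at h1
  linear_combination h1

end Invariant

theorem stdReflection_cartan (k : Fin 5) :
    stdReflection * cartan stdAct k = (-cartan stdAct k) * stdReflection := by
  refine stdBasis.ext fun r => ?_
  have h0 : cartan stdAct k = stdAct (stdVec (false, k)) (stdVec (true, k)) := rfl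
  rw [stdBasis_apply, Module.End.mul_apply, Module.End.mul_apply, LinearMap.neg_apply,
    stdReflection_stdVec, h0, stdAct_stdVec, stdAct_stdVec, map_sum, ← Finset.sum_neg_distrib]
  have hd : Function.Involutive dualIdx := fun p => by simp [dualIdx]
  rw [← Equiv.sum_comp (Function.Involutive.toPerm dualIdx hd)]
  have h1 : ∀ i j r, stdEntry (false, i) (true, i) (dualIdx j) r =
      -stdEntry (false, i) (true, i) j (dualIdx r) := by decide +kernel
  refine Finset.sum_congr rfl fun j _ => ?_
  rw [Function.Involutive.coe_toPerm, map_smul, stdReflection_stdVec, hd j, h1]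
  push_cast
  rw [neg_smul]

theorem symMap_stdReflection_cartan (k : Fin 5) (x : SymmetricAlgebra ℂ Std) :
    (symMap stdReflection).toLinearMap (cartan symStdAct k x) =
      -cartan symStdAct k ((symMap stdReflection).toLinearMap x) := by
  have h0 : cartan symStdAct k = symDer (cartan stdAct k) := rfl
  rw [AlgHom.toLinearMap_apply, AlgHom.toLinearMap_apply, h0,
    symMap_symDer _ _ _ (stdReflection_cartan k), ← neg_one_smul ℂ (cartan stdAct k), symDer_smul,
    LinearMap.smul_apply, neg_one_smul]

/-! ### The coefficients and the tensor they define -/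

/-- The Gram matrix of the vectors `f_I`, `I ∈ A`. -/
def hwGram (A : Finset (List (Fin 5))) : Matrix A A ℚ :=
  gramMatrix (fun k => (fiveOmega k : ℚ)) lowestWord (120 ^ 8) fun I : A => I.1.reverse

/-- The coefficients `c_{IJ}`. -/
def invCoeff (A : Finset (List (Fin 5))) (I J : List (Fin 5)) : ℚ :=
  if h : I ∈ A ∧ J ∈ A then (hwGram A)⁻¹ ⟨I, h.1⟩ ⟨J, h.2⟩ else 0

/-- `A` indexes a basis of `V(5ω₁)`. -/
structure IsBasisSet (A : Finset (List (Fin 5))) : Prop where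
  independent : LinearIndependent ℂ (fun I : A => fvec I)
  span : Submodule.span ℂ (fvec '' A) = VFive

variable {A : Finset (List (Fin 5))}

theorem IsBasisSet.wordBasis (hA : IsBasisSet A) :
    WordBasis symStdAct hwStd fun I : A => I.1.reverse where
  independent := by
    have h := hA.independent
    simpa only [fvec_eq_word] using h
  span := by
    rw [← VFive_eq_wordSpan, ← hA.span, Set.image_eq_range]
    simp only [fvec_eq_word]
    rfl

theorem seqWeight_add_eq_zero (hA : IsBasisSet A) (I J : A) (h : (hwGram A)⁻¹ I J ≠ 0) :
    seqWeight I + seqWeight J = 0 := by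
  funext k
  have h1 := gramMatrix_inv_weight selfDual_hwStd hA.wordBasis k (symMap_stdReflection_cartan k) I J
  have h2 := (mul_eq_zero.mp h1).resolve_right h
  have h3 : ∀ I : List (Fin 5), wordWeight (fun k => (fiveOmega k : ℚ)) I.reverse k =
      (seqWeight I k : ℚ) := fun I => by
    simp [wordWeight, seqWeight, List.sum_reverse]
  rw [h3, h3] at h2
  exact_mod_cast h2

section Generic

variable {N N' : Type*} [AddCommGroup N] [Module ℂ N] [AddCommGroup N'] [Module ℂ N']
  {act₁ : Std → Std → Module.End ℂ N} {act₂ : Std → Std → Module.End ℂ N'} {S₁ : Submodule ℂ N}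
  {S₂ : Submodule ℂ N'}

/-- The element `∑ c_{IJ} X_I w₁ ⊗ X_J w₂`. -/
def tensorSum (act₁ : Std → Std → Module.End ℂ N) (act₂ : Std → Std → Module.End ℂ N')
    (P : Finset (List (Fin 5) × List (Fin 5))) (c : List (Fin 5) → List (Fin 5) → ℚ) (w₁ : N)
    (w₂ : N') : N ⊗[ℂ] N' :=
  ∑ p ∈ P, (c p.1 p.2 : ℂ) • (lowerSeq act₁ p.1 w₁ ⊗ₜ[ℂ] lowerSeq act₂ p.2 w₂)

/-- The restriction to opposite weights can be dropped, since all other coefficients vanish. -/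
theorem tensorSum_eq_sum (hA : IsBasisSet A) (w₁ : N) (w₂ : N') :
    tensorSum act₁ act₂ (oppositePairs A A) (invCoeff A) w₁ w₂ =
      ∑ I : A, ∑ J : A, (((hwGram A)⁻¹ I J : ℚ) : ℂ) •
        (word act₁ I.1.reverse w₁ ⊗ₜ[ℂ] word act₂ J.1.reverse w₂) := by
  rw [tensorSum, oppositePairs, Finset.sum_filter, Finset.sum_product, ← Finset.sum_coe_sort]
  refine Finset.sum_congr rfl fun I _ => ?_
  rw [← Finset.sum_coe_sort]
  refine Finset.sum_congr rfl fun J _ => ?_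
  have h1 : invCoeff A I J = (hwGram A)⁻¹ I J := by
    rw [invCoeff, dif_pos ⟨I.2, J.2⟩]
  rw [lowerSeq_eq_word, lowerSeq_eq_word, h1]
  split_ifs with h
  · rfl
  · have h2 : (hwGram A)⁻¹ I J = 0 := by
      by_contra h3
      exact h (seqWeight_add_eq_zero hA I J h3)
    rw [h2, Rat.cast_zero, zero_smul]

theorem tensorSum_annihilated (hA : IsBasisSet A) (φ₁ : Frame act₁ S₁) (φ₂ : Frame act₂ S₂)
    (h₁ : IsLieAct act₁) (h₂ : IsLieAct act₂) (hS₁ : ∀ i, ∀ x ∈ S₁, lowering act₁ i x ∈ S₁)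
    (hS₂ : ∀ i, ∀ x ∈ S₂, lowering act₂ i x ∈ S₂) {w₁ : N} {w₂ : N'}
    (hw₁ : IsHighest act₁ (fun k => (fiveOmega k : ℚ)) w₁)
    (hw₂ : IsHighest act₂ (fun k => (fiveOmega k : ℚ)) w₂) (hm₁ : w₁ ∈ S₁) (hm₂ : w₂ ∈ S₂)
    (u v : Std) :
    tensAct act₁ act₂ u v (tensorSum act₁ act₂ (oppositePairs A A) (invCoeff A) w₁ w₂) = 0 := by
  obtain ⟨f₁, hf₁⟩ := exists_transport symStdFrame φ₁ isLieAct_symStdAct h₁ hS₁ isHighest_hwStd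
    hw₁ hwStd_mem hm₁
  obtain ⟨f₂, hf₂⟩ := exists_transport symStdFrame φ₂ isLieAct_symStdAct h₂ hS₂ isHighest_hwStd
    hw₂ hwStd_mem hm₂
  rw [tensorSum_eq_sum hA]
  exact annihilates_sum_word selfDual_hwStd hA.wordBasis h₁ h₂ hw₁ hw₂ f₁ f₂ hf₁ hf₂ u v

theorem IsBasisSet.nonempty (hA : IsBasisSet A) : Nonempty A := by
  by_contra hne
  rw [not_nonempty_iff] at hne
  have h6 : hwStd ∈ VFive := mem_generated _ _
  rw [VFive_eq_wordSpan, ← hA.wordBasis.span, Set.range_eq_empty, Submodule.span_empty,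
    Submodule.mem_bot] at h6
  exact isHighest_hwStd.1 h6

theorem hwGram_inv_ne_zero (hA : IsBasisSet A) : (hwGram A)⁻¹ ≠ 0 := by
  intro h3
  have h4 := Matrix.mul_nonsing_inv _ (isUnit_gramMatrix selfDual_hwStd hA.wordBasis)
  change hwGram A * (hwGram A)⁻¹ = 1 at h4
  rw [h3, mul_zero] at h4
  have := hA.nonempty
  exact zero_ne_one h4

theorem sum_tmul_ne_zero {P κ : Type*} [AddCommGroup P] [Module ℂ P] [Fintype κ] {x : κ → P}
    (hx : LinearIndependent ℂ x) (c : Matrix κ κ ℚ) (f₁ : N →ₗ[ℂ] P) (f₂ : N' →ₗ[ℂ] P)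
    {y : κ → N} {y' : κ → N'} (hf₁ : ∀ k, f₁ (y k) = x k) (hf₂ : ∀ k, f₂ (y' k) = x k)
    (h0 : ∑ k, ∑ l, (c k l : ℂ) • (y k ⊗ₜ[ℂ] y' l) = 0) : c = 0 := by
  have h1 := congrArg (TensorProduct.map f₁ f₂) h0
  simp only [map_sum, map_smul, TensorProduct.map_tmul, hf₁, hf₂, map_zero] at h1
  rw [← Fintype.sum_prod_type (fun p : κ × κ => (c p.1 p.2 : ℂ) • (x p.1 ⊗ₜ[ℂ] x p.2))] at h1
  have h2 := Fintype.linearIndependent_iff.mp (hx.tmul_of_isDomain hx) (fun p => (c p.1 p.2 : ℂ)) h1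
  ext I J
  exact Rat.cast_eq_zero.mp (h2 (I, J))

/-- Transport runs backwards here, from w₁ and w₂ to e₁⁵: there the tensors f_I ⊗ f_J are
independent, and their coefficient matrix, being an inverse, is not zero. -/
theorem tensorSum_ne_zero (hA : IsBasisSet A) (φ₁ : Frame act₁ S₁) (φ₂ : Frame act₂ S₂)
    (h₁ : IsLieAct act₁) (h₂ : IsLieAct act₂) {w₁ : N} {w₂ : N'}
    (hw₁ : IsHighest act₁ (fun k => (fiveOmega k : ℚ)) w₁)
    (hw₂ : IsHighest act₂ (fun k => (fiveOmega k : ℚ)) w₂) (hm₁ : w₁ ∈ S₁) (hm₂ : w₂ ∈ S₂) :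
    tensorSum act₁ act₂ (oppositePairs A A) (invCoeff A) w₁ w₂ ≠ 0 := by
  intro h0
  obtain ⟨f₁, hf₁⟩ := exists_transport φ₁ symStdFrame h₁ isLieAct_symStdAct
    selfDual_hwStd.stable hw₁ isHighest_hwStd hm₁ hwStd_mem
  obtain ⟨f₂, hf₂⟩ := exists_transport φ₂ symStdFrame h₂ isLieAct_symStdAct
    selfDual_hwStd.stable hw₂ isHighest_hwStd hm₂ hwStd_mem
  rw [tensorSum_eq_sum hA] at h0
  exact hwGram_inv_ne_zero hA (sum_tmul_ne_zero hA.wordBasis.independent (hwGram A)⁻¹ f₁ f₂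
    (fun I => hf₁ _) (fun I => hf₂ _) h0)

theorem tensorSum_mem {T₁ : Submodule ℂ N} {T₂ : Submodule ℂ N'}
    (hT₁ : ∀ i, ∀ x ∈ T₁, lowering act₁ i x ∈ T₁) (hT₂ : ∀ i, ∀ x ∈ T₂, lowering act₂ i x ∈ T₂)
    (P : Finset (List (Fin 5) × List (Fin 5))) (c : List (Fin 5) → List (Fin 5) → ℚ) {w₁ : N}
    {w₂ : N'} (hw₁ : w₁ ∈ T₁) (hw₂ : w₂ ∈ T₂) :
    tensorSum act₁ act₂ P c w₁ w₂ ∈ LinearMap.range (TensorProduct.mapIncl T₁ T₂) := by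
  refine Submodule.sum_mem _ fun p _ => Submodule.smul_mem _ _ ?_
  rw [lowerSeq_eq_word, lowerSeq_eq_word]
  exact ⟨⟨_, word_mem hT₁ hw₁ _⟩ ⊗ₜ ⟨_, word_mem hT₂ hw₂ _⟩, rfl⟩

end Generic

theorem Ften_eq_tensorSum (P : Finset (List (Fin 5) × List (Fin 5)))
    (c : List (Fin 5) → List (Fin 5) → ℚ) (w₁ w₂ : SymL) :
    Ften P c w₁ w₂ = tensorSum symLAct symLAct P c w₁ w₂ := by
  unfold Ften tensorSum
  with_reducible_and_instances rfl

theorem symLAct_lowering_mem {V : Submodule ℂ LSeven}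
    (hV : ∀ a b, ∀ x ∈ V, lambdaAct a b x ∈ V) (n : ℕ) (i : Fin 5) (x : SymL)
    (hx : x ∈ symPow n V) : lowering symLAct i x ∈ symPow n V := by
  rw [lowering_eq]
  exact symDer_mem_symPow _ (hV _ _) n x hx

theorem lambdaAct_top_stable : ∀ a b, ∀ x ∈ (⊤ : Submodule ℂ LSeven),
    lambdaAct a b x ∈ (⊤ : Submodule ℂ LSeven) := fun _ _ _ _ => Submodule.mem_top

theorem tensorSum_symL_annihilated (hA : IsBasisSet A) {w₁ w₂ : SymL}
    (hw₁ : IsHighestWeightVector symLAct fiveOmega w₁)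
    (hw₂ : IsHighestWeightVector symLAct fiveOmega w₂)
    (hS₁ : w₁ ∈ symPow 2 (⊤ : Submodule ℂ LSeven)) (hS₂ : w₂ ∈ symPow 2 (⊤ : Submodule ℂ LSeven))
    (u v : Std) : tensAct symLAct symLAct u v
      (tensorSum symLAct symLAct (oppositePairs A A) (invCoeff A) w₁ w₂) = 0 := by
  have hst := symLAct_lowering_mem lambdaAct_top_stable 2
  exact tensorSum_annihilated hA symLFrame symLFrame isLieAct_symLAct isLieAct_symLAct hst hst
    hw₁.isHighest hw₂.isHighest hS₁ hS₂ u v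

theorem tensorSum_symL_ne_zero (hA : IsBasisSet A) {w₁ w₂ : SymL}
    (hw₁ : IsHighestWeightVector symLAct fiveOmega w₁)
    (hw₂ : IsHighestWeightVector symLAct fiveOmega w₂)
    (hS₁ : w₁ ∈ symPow 2 (⊤ : Submodule ℂ LSeven))
    (hS₂ : w₂ ∈ symPow 2 (⊤ : Submodule ℂ LSeven)) :
    tensorSum symLAct symLAct (oppositePairs A A) (invCoeff A) w₁ w₂ ≠ 0 :=
  tensorSum_ne_zero hA symLFrame symLFrame isLieAct_symLAct isLieAct_symLAct
    hw₁.isHighest hw₂.isHighest hS₁ hS₂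

theorem tensorSum_symL_mem (P : Finset (List (Fin 5) × List (Fin 5)))
    (c : List (Fin 5) → List (Fin 5) → ℚ) {w₁ w₂ : SymL} (hw₁ : w₁ ∈ symPow 2 V₁)
    (hw₂ : w₂ ∈ symPow 2 V₂) : tensorSum symLAct symLAct P c w₁ w₂ ∈
      LinearMap.range (TensorProduct.mapIncl (symPow 2 V₁) (symPow 2 V₂)) :=
  tensorSum_mem (symLAct_lowering_mem (generated_stable lambdaAct v₁) 2)
    (symLAct_lowering_mem (generated_stable lambdaAct v₂) 2) P c hw₁ hw₂

/-! ### Multiplication of polynomials on independent subspaces -/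

section Independent

variable {M : Type*} [AddCommGroup M] [Module ℂ M]

/-- The algebra homomorphism `Sym M → Sym M ⊗ Sym M` that splits the variables by a pair of
endomorphisms. -/
def symSplit (p₁ p₂ : Module.End ℂ M) :
    SymmetricAlgebra ℂ M →ₐ[ℂ] SymmetricAlgebra ℂ M ⊗[ℂ] SymmetricAlgebra ℂ M :=
  SymmetricAlgebra.lift
    (Algebra.TensorProduct.includeLeft.toLinearMap ∘ₗ SymmetricAlgebra.ι ℂ M ∘ₗ p₁ +
      Algebra.TensorProduct.includeRight.toLinearMap ∘ₗ SymmetricAlgebra.ι ℂ M ∘ₗ p₂)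

theorem symSplit_left (p₁ p₂ : Module.End ℂ M) {V : Submodule ℂ M} (h₁ : ∀ x ∈ V, p₁ x = x)
    (h₂ : ∀ x ∈ V, p₂ x = 0) (n : ℕ) (x : SymmetricAlgebra ℂ M) (hx : x ∈ symPow n V) :
    symSplit p₁ p₂ x = x ⊗ₜ 1 := by
  induction n generalizing x with
  | zero =>
    rw [symPow, pow_zero] at hx
    obtain ⟨r, rfl⟩ := Submodule.mem_one.mp hx
    rw [AlgHom.commutes]
    rfl
  | succ n ih =>
    rw [symPow, pow_succ] at hx
    refine Submodule.mul_induction_on hx ?_ ?_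
    · rintro a ha _ ⟨m, hm, rfl⟩
      rw [map_mul, ih a ha]
      simp [symSplit, h₁ m hm, h₂ m hm]
    · intro a b ha hb
      rw [map_add, ha, hb, TensorProduct.add_tmul]

theorem symSplit_right (p₁ p₂ : Module.End ℂ M) {V : Submodule ℂ M} (h₁ : ∀ x ∈ V, p₁ x = 0)
    (h₂ : ∀ x ∈ V, p₂ x = x) (n : ℕ) (x : SymmetricAlgebra ℂ M) (hx : x ∈ symPow n V) :
    symSplit p₁ p₂ x = 1 ⊗ₜ x := by
  induction n generalizing x with
  | zero =>
    rw [symPow, pow_zero] at hx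
    obtain ⟨r, rfl⟩ := Submodule.mem_one.mp hx
    rw [AlgHom.commutes, Algebra.algebraMap_eq_smul_one, Algebra.algebraMap_eq_smul_one,
      TensorProduct.tmul_smul]
    rfl
  | succ n ih =>
    rw [symPow, pow_succ] at hx
    refine Submodule.mul_induction_on hx ?_ ?_
    · rintro a ha _ ⟨m, hm, rfl⟩
      rw [map_mul, ih a ha]
      simp [symSplit, h₁ m hm, h₂ m hm]
    · intro a b ha hb
      rw [map_add, ha, hb, TensorProduct.tmul_add]

/-- Polynomials on independent subspaces multiply injectively. -/
theorem mul'_ne_zero {W₁ W₂ : Submodule ℂ M} (h : Disjoint W₁ W₂) (m n : ℕ)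
    (z : SymmetricAlgebra ℂ M ⊗[ℂ] SymmetricAlgebra ℂ M)
    (hz : z ∈ LinearMap.range (TensorProduct.mapIncl (symPow m W₁) (symPow n W₂)))
    (hz0 : z ≠ 0) : LinearMap.mul' ℂ (SymmetricAlgebra ℂ M) z ≠ 0 := by
  -- With C a complement of W₁ that contains W₂, the projection p onto W₁ along C and 1 − p separate
  -- the variables, and `symSplit` becomes a left inverse of multiplication.
  obtain ⟨C, hC, hcompl⟩ := h.symm.exists_isCompl
  have hδ : ∀ z ∈ LinearMap.range (TensorProduct.mapIncl (symPow m W₁) (symPow n W₂)),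
      symSplit (W₁.projection C hcompl.symm) (1 - W₁.projection C hcompl.symm)
        (LinearMap.mul' ℂ (SymmetricAlgebra ℂ M) z) = z := by
    rintro _ ⟨t, rfl⟩
    induction t with
    | zero => simp
    | add x y hx hy => simp only [map_add, hx, hy]
    | tmul x y =>
      have h₁ : ∀ v ∈ W₁, W₁.projection C hcompl.symm v = v := fun v hv =>
        Submodule.projection_apply_of_mem_left _ hv
      have h₂ : ∀ v ∈ W₂, W₁.projection C hcompl.symm v = 0 := fun v hv =>
        Submodule.projection_apply_of_mem_right _ (hC hv)
      rw [TensorProduct.mapIncl, TensorProduct.map_tmul, LinearMap.mul'_apply, map_mul,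
        Submodule.subtype_apply, Submodule.subtype_apply, symSplit_left _ _ h₁ (fun v hv => by rw [LinearMap.sub_apply, h₁ v hv]; exact sub_self v) m _ x.2,
        symSplit_right _ _ h₂ (fun v hv => by rw [LinearMap.sub_apply, h₂ v hv]; exact sub_zero v) n _ y.2,
        Algebra.TensorProduct.tmul_mul_tmul, one_mul, mul_one]
  intro h0
  have h1 := hδ z hz
  rw [h0, map_zero] at h1
  exact hz0 h1.symm

theorem mul'_mem_symPow {W₁ W₂ : Submodule ℂ M} (m n : ℕ)
    (z : SymmetricAlgebra ℂ M ⊗[ℂ] SymmetricAlgebra ℂ M)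
    (hz : z ∈ LinearMap.range (TensorProduct.mapIncl (symPow m W₁) (symPow n W₂))) :
    LinearMap.mul' ℂ (SymmetricAlgebra ℂ M) z ∈ symPow (m + n) (⊤ : Submodule ℂ M) := by
  obtain ⟨t, rfl⟩ := hz
  have hle : ∀ (k : ℕ) (W : Submodule ℂ M), symPow k W ≤ symPow k ⊤ := fun k W =>
    pow_le_pow_left' (Submodule.map_mono le_top) k
  induction t with
  | zero => simp
  | add x y hx hy =>
    rw [map_add, map_add]
    exact Submodule.add_mem _ hx hy
  | tmul x y =>
    rw [TensorProduct.mapIncl, TensorProduct.map_tmul, LinearMap.mul'_apply, symPow, pow_add]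
    exact Submodule.mul_mem_mul (hle _ _ x.2) (hle _ _ y.2)

end Independent

/-! ### Polynomial curves and their logarithmic derivatives -/

open Polynomial in
/-- The polynomial curves in `M`, paired with their derivatives. -/
def curves (M : Type*) [AddCommGroup M] [Module ℂ M] : Submodule ℂ ((ℂ → M) × (ℂ → M)) :=
  Submodule.span ℂ (Set.range fun p : ℂ[X] × M =>
    (fun t => p.1.eval t • p.2, fun t => p.1.derivative.eval t • p.2))

section Curves

open Polynomial

variable {M N P : Type*} [AddCommGroup M] [Module ℂ M] [AddCommGroup N] [Module ℂ N]
  [AddCommGroup P] [Module ℂ P]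

theorem monomial_mem_curves (p : ℂ[X]) (m : M) :
    ((fun t => p.eval t • m, fun t => p.derivative.eval t • m) : (ℂ → M) × (ℂ → M)) ∈ curves M :=
  Submodule.subset_span ⟨(p, m), rfl⟩

theorem curves_map (f : M →ₗ[ℂ] N) {x : (ℂ → M) × (ℂ → M)} (hx : x ∈ curves M) :
    ((fun t => f (x.1 t), fun t => f (x.2 t)) : (ℂ → N) × (ℂ → N)) ∈ curves N := by
  induction hx using Submodule.span_induction with
  | mem x hx =>
    obtain ⟨⟨p, m⟩, rfl⟩ := hx
    simpa using monomial_mem_curves p (f m)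
  | zero =>
    simp only [Prod.fst_zero, Prod.snd_zero, Pi.zero_apply, map_zero]
    exact (curves N).zero_mem
  | add x y _ _ hx hy =>
    simp only [Prod.fst_add, Prod.snd_add, Pi.add_apply, map_add]
    exact (curves N).add_mem hx hy
  | smul c x _ hx =>
    simp only [Prod.smul_fst, Prod.smul_snd, Pi.smul_apply, map_smul]
    exact (curves N).smul_mem c hx

theorem curves_bilinear (β : M →ₗ[ℂ] N →ₗ[ℂ] P) {x : (ℂ → M) × (ℂ → M)}
    {y : (ℂ → N) × (ℂ → N)} (hx : x ∈ curves M) (hy : y ∈ curves N) :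
    ((fun t => β (x.1 t) (y.1 t), fun t => β (x.2 t) (y.1 t) + β (x.1 t) (y.2 t)) :
      (ℂ → P) × (ℂ → P)) ∈ curves P := by
  induction hx using Submodule.span_induction with
  | mem x hx =>
    obtain ⟨⟨p, m⟩, rfl⟩ := hx
    induction hy using Submodule.span_induction with
    | mem y hy =>
      obtain ⟨⟨r, n⟩, rfl⟩ := hy
      convert monomial_mem_curves (p * r) (β m n) using 2
      · funext t
        simp [smul_smul, mul_comm]
      · funext t
        simp [smul_smul, add_smul, mul_comm]
    | zero =>
      simp only [Prod.fst_zero, Prod.snd_zero, Pi.zero_apply, map_zero, add_zero]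
      exact (curves P).zero_mem
    | add y z _ _ hy hz =>
      convert (curves P).add_mem hy hz using 2
      · funext t
        simp
      · funext t
        simp
        abel
    | smul c y _ hy =>
      convert (curves P).smul_mem c hy using 2
      · funext t
        simp
      · funext t
        simp
  | zero =>
    simp only [Prod.fst_zero, Prod.snd_zero, Pi.zero_apply, map_zero, LinearMap.zero_apply, add_zero]
    exact (curves P).zero_mem
  | add x z _ _ hx hz =>
    convert (curves P).add_mem hx hz using 2
    · funext t
      simp
    · funext t
      simp
      abel
  | smul c x _ hx =>
    convert (curves P).smul_mem c hx using 2
    · funext t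
      simp
    · funext t
      simp

/-- Functionals reduce a differential equation for curves to one for scalar polynomials. -/
theorem exists_polynomial_of_mem_curves (f : M →ₗ[ℂ] ℂ) {x : (ℂ → M) × (ℂ → M)}
    (hx : x ∈ curves M) :
    ∃ p : ℂ[X], ∀ t, f (x.1 t) = p.eval t ∧ f (x.2 t) = p.derivative.eval t := by
  induction hx using Submodule.span_induction with
  | mem x hx =>
    obtain ⟨⟨p, m⟩, rfl⟩ := hx
    exact ⟨f m • p, fun t => by simp [mul_comm]⟩
  | zero => exact ⟨0, fun t => by simp⟩
  | add x y _ _ hx hy =>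
    obtain ⟨p, hp⟩ := hx
    obtain ⟨r, hr⟩ := hy
    exact ⟨p + r, fun t => by simp [hp, hr]⟩
  | smul c x _ hx =>
    obtain ⟨p, hp⟩ := hx
    exact ⟨c • p, fun t => by simp [hp]⟩

/-- The logarithmic derivative determines a polynomial up to its constant term. -/
theorem polynomial_eq_smul_pow {p q : ℂ[X]} {n : ℕ} (hq : q.eval 0 = 1)
    (h : q * p.derivative = (n : ℂ[X]) * q.derivative * p) : p = C (p.eval 0) * q ^ n := by
  set r := p - C (p.eval 0) * q ^ n with hr
  have h0 : r.eval 0 = 0 := by simp [hr, hq]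
  have h1 : q * r.derivative = (n : ℂ[X]) * q.derivative * r := by
    rcases n with _ | n
    · simp [hr] at h ⊢
      exact h
    · rw [hr]
      simp only [derivative_sub, derivative_mul, derivative_C, zero_mul, zero_add,
        derivative_pow_succ, mul_sub, h]
      rw [pow_succ]
      simp only [map_add, map_natCast, map_one, Nat.cast_add, Nat.cast_one]
      ring
  -- The difference r solves the same equation and vanishes at 0. If it were nonzero, its derivative
  -- would vanish there to one order less, while the equation makes q r' vanish at least as much as
  -- r, and q(0) = 1.
  by_contra hne
  have hr0 : r ≠ 0 := fun h => hne (sub_eq_zero.mp h)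
  have hd : r.derivative ≠ 0 := by
    intro hd
    have h2 := eq_C_of_derivative_eq_zero hd
    rw [coeff_zero_eq_eval_zero, h0, C_0] at h2
    exact hr0 h2
  have hqr : q * r.derivative ≠ 0 := by
    refine mul_ne_zero (fun h => ?_) hd
    simp [h] at hq
  have h2 : rootMultiplicity 0 (q * r.derivative) = rootMultiplicity 0 r - 1 := by
    rw [rootMultiplicity_mul hqr, derivative_rootMultiplicity_of_root h0,
      rootMultiplicity_eq_zero (by simp [IsRoot, hq]), zero_add]
  have h3 : rootMultiplicity 0 r ≤ rootMultiplicity 0 (q * r.derivative) := by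
    rw [h1] at hqr ⊢
    rw [rootMultiplicity_mul hqr]
    exact Nat.le_add_left _ _
  have h4 := (rootMultiplicity_pos hr0).mpr h0
  omega

/-- Along the curve `T t x` the logarithmic derivative of `T t` is `(D + (n / 2) q') / q`. -/
def IsWeightCurve (q : ℂ[X]) (T : ℂ → Module.End ℂ M) (D : Module.End ℂ M) (n : ℕ) (x : M) :
    Prop :=
  ∃ x' : ℂ → M, ((fun t => T t x, x') : (ℂ → M) × (ℂ → M)) ∈ curves M ∧
    ∀ t, q.eval t • x' t = T t (D x) + ((n : ℂ) * q.derivative.eval t / 2) • T t x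

namespace IsWeightCurve

variable {q : ℂ[X]} {T : ℂ → Module.End ℂ M} {D : Module.End ℂ M} {n : ℕ}

theorem zero : IsWeightCurve q T D n 0 :=
  ⟨0, by simp only [map_zero]; exact (curves M).zero_mem, by simp⟩

theorem add {x y : M} (hx : IsWeightCurve q T D n x) (hy : IsWeightCurve q T D n y) :
    IsWeightCurve q T D n (x + y) := by
  obtain ⟨x', hx, hx'⟩ := hx
  obtain ⟨y', hy, hy'⟩ := hy
  refine ⟨x' + y', ?_, fun t => ?_⟩
  · simp only [map_add]
    exact (curves M).add_mem hx hy
  · rw [Pi.add_apply, smul_add, hx', hy', map_add, map_add, map_add, smul_add]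
    abel

theorem of_injective {T' : ℂ → Module.End ℂ N} {D' : Module.End ℂ N} (f : M →ₗ[ℂ] N)
    (hf : Function.Injective f) (hT : ∀ t x, f (T t x) = T' t (f x))
    (hD : ∀ x, f (D x) = D' (f x)) {x : M} (hx : IsWeightCurve q T' D' n (f x)) :
    IsWeightCurve q T D n x := by
  obtain ⟨g, hg⟩ := LinearMap.exists_leftInverse_of_injective f (LinearMap.ker_eq_bot.mpr hf)
  have hgf : ∀ y, g (f y) = y := fun y => LinearMap.congr_fun hg y
  obtain ⟨x', hx, hx'⟩ := hx
  refine ⟨fun t => g (x' t), ?_, fun t => ?_⟩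
  · simpa [← hT, hgf] using curves_map g hx
  · rw [← map_smul, hx', map_add, map_smul, ← hD, ← hT, ← hT, hgf, hgf]

/-- By the product rule the logarithmic derivatives add, and with them the multiples of q'/2. -/
theorem bilinear {T₁ : ℂ → Module.End ℂ N} {D₁ : Module.End ℂ N} {T₂ : ℂ → Module.End ℂ P}
    {D₂ : Module.End ℂ P} (β : M →ₗ[ℂ] N →ₗ[ℂ] P)
    (hT : ∀ t x y, T₂ t (β x y) = β (T t x) (T₁ t y))
    (hD : ∀ x y, D₂ (β x y) = β (D x) y + β x (D₁ y)) {m : ℕ} {x : M} {y : N}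
    (hx : IsWeightCurve q T D n x) (hy : IsWeightCurve q T₁ D₁ m y) :
    IsWeightCurve q T₂ D₂ (n + m) (β x y) := by
  obtain ⟨x', hx, hx'⟩ := hx
  obtain ⟨y', hy, hy'⟩ := hy
  refine ⟨fun t => β (x' t) (T₁ t y) + β (T t x) (y' t), ?_, fun t => ?_⟩
  · simp only [hT]
    exact curves_bilinear β hx hy
  · have h1 : q.eval t • β (x' t) (T₁ t y) = β (q.eval t • x' t) (T₁ t y) := by
      rw [map_smul, LinearMap.smul_apply]
    rw [hD, map_add, hT, hT, hT, smul_add, h1, ← map_smul, hx', hy', map_add, LinearMap.add_apply,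
      map_add, map_smul, map_smul, LinearMap.smul_apply]
    push_cast
    module

/-- When D x = 0 the equation reads q x' = k q' x, and q^k x is its only polynomial solution
starting at x. The even degree 2k avoids a square root of q. -/
theorem eq_smul {x : M} {k : ℕ} (hx : IsWeightCurve q T D (2 * k) x) (hq : q.eval 0 = 1)
    (hT : T 0 x = x) (hD : D x = 0) (t : ℂ) : T t x = q.eval t ^ k • x := by
  obtain ⟨x', hx, hx'⟩ := hx
  rw [← sub_eq_zero, ← Module.forall_dual_apply_eq_zero_iff ℂ]
  intro f
  obtain ⟨p, hp⟩ := exists_polynomial_of_mem_curves f hx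
  have h1 : q * p.derivative = (k : ℂ[X]) * q.derivative * p := by
    refine Polynomial.funext fun t => ?_
    have h2 := congrArg f (hx' t)
    rw [hD, map_zero, zero_add, map_smul, map_smul, (hp t).1, (hp t).2] at h2
    simp only [smul_eq_mul, Nat.cast_mul, Nat.cast_ofNat] at h2
    simp only [eval_mul, eval_natCast]
    linear_combination h2
  have h2 := polynomial_eq_smul_pow hq h1
  have h3 : f x = p.eval 0 := by
    have h4 := (hp 0).1
    simp only [hT] at h4
    exact h4
  rw [map_sub, map_smul, (hp t).1, h2, h3]
  simp [mul_comm]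

end IsWeightCurve

end Curves

/-! ### Weight curves on exterior powers, symmetric powers and tensor products -/

section Functors

open Polynomial

variable {M : Type*} [AddCommGroup M] [Module ℂ M]

theorem coe_exteriorPower_map (n : ℕ) (f : Module.End ℂ M) (x : ⋀[ℂ]^n M) :
    (exteriorPower.map n f x : ExteriorAlgebra ℂ M) = ExteriorAlgebra.map f x := by
  have h : (⋀[ℂ]^n M).subtype ∘ₗ exteriorPower.map n f =
      (ExteriorAlgebra.map f).toLinearMap ∘ₗ (⋀[ℂ]^n M).subtype := by
    refine exteriorPower.linearMap_ext ?_
    ext m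
    simp
  exact LinearMap.congr_fun h x

variable {q : ℂ[X]} {T : ℂ → Module.End ℂ M} {D : Module.End ℂ M}

theorem IsWeightCurve.exteriorAlgebra {k : ℕ} (h : ∀ x, IsWeightCurve q T D k x) (n : ℕ)
    (x : ExteriorAlgebra ℂ M) (hx : x ∈ ⋀[ℂ]^n M) :
    IsWeightCurve q (fun t => (ExteriorAlgebra.map (T t)).toLinearMap) (extDerAux D) (n * k) x := by
  induction n generalizing x with
  | zero =>
    rw [ExteriorAlgebra.exteriorPower, pow_zero] at hx
    obtain ⟨r, rfl⟩ := Submodule.mem_one.mp hx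
    refine ⟨0, ?_, fun t => ?_⟩
    · convert monomial_mem_curves 1 (algebraMap ℂ (ExteriorAlgebra ℂ M) r) using 2
      · funext t
        simp
      · funext t
        simp
    · simp [extDerAux_algebraMap]
  | succ n ih =>
    rw [ExteriorAlgebra.exteriorPower, pow_succ] at hx
    rw [add_mul, one_mul]
    refine Submodule.mul_induction_on hx ?_ fun a b ha hb => ha.add hb
    rintro a ha _ ⟨m, rfl⟩
    refine (ih a ha).bilinear (LinearMap.mul ℂ (ExteriorAlgebra ℂ M)) (fun t x y => ?_)
      (fun x y => ?_) (y := ExteriorAlgebra.ι ℂ m)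
      (T₁ := fun t => (ExteriorAlgebra.map (T t)).toLinearMap) (D₁ := extDerAux D) ?_
    · simp
    · simp only [LinearMap.mul_apply']
      rw [extDerAux_mul, add_comm]
    · obtain ⟨m', hm, hm'⟩ := h m
      refine ⟨fun t => ExteriorAlgebra.ι ℂ (m' t), ?_, fun t => ?_⟩
      · convert curves_map (ExteriorAlgebra.ι ℂ) hm using 2
        funext t
        simp
      · rw [← map_smul, hm', map_add, map_smul, extDerAux_ι]
        simp

theorem IsWeightCurve.exteriorPower {k : ℕ} (h : ∀ x, IsWeightCurve q T D k x) (n : ℕ)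
    (x : ⋀[ℂ]^n M) :
    IsWeightCurve q (fun t => exteriorPower.map n (T t)) (extDer n D) (n * k) x :=
  IsWeightCurve.of_injective (T := fun t => exteriorPower.map n (T t)) (D := extDer n D)
    (T' := fun t => (ExteriorAlgebra.map (T t)).toLinearMap)
    (D' := extDerAux D) (⋀[ℂ]^n M).subtype (Submodule.subtype_injective _)
    (fun t x => coe_exteriorPower_map n (T t) x) (fun x => coe_extDer n D x)
    (IsWeightCurve.exteriorAlgebra h n x x.2)

theorem IsWeightCurve.symPow {k : ℕ} (h : ∀ x, IsWeightCurve q T D k x) (n : ℕ)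
    (x : SymmetricAlgebra ℂ M) (hx : x ∈ symPow n (⊤ : Submodule ℂ M)) :
    IsWeightCurve q (fun t => (symMap (T t)).toLinearMap) (symDer D) (n * k) x := by
  induction n generalizing x with
  | zero =>
    rw [SpinTen.symPow, pow_zero] at hx
    obtain ⟨r, rfl⟩ := Submodule.mem_one.mp hx
    refine ⟨0, ?_, fun t => ?_⟩
    · convert monomial_mem_curves 1 (algebraMap ℂ (SymmetricAlgebra ℂ M) r) using 2
      · funext t
        simp
      · funext t
        simp
    · simp [symDer_algebraMap]
  | succ n ih =>
    rw [SpinTen.symPow, pow_succ] at hx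
    rw [add_mul, one_mul]
    refine Submodule.mul_induction_on hx ?_ fun a b ha hb => ha.add hb
    rintro a ha _ ⟨m, -, rfl⟩
    refine (ih a ha).bilinear (LinearMap.mul ℂ (SymmetricAlgebra ℂ M)) (fun t x y => ?_)
      (fun x y => ?_) (y := SymmetricAlgebra.ι ℂ M m)
      (T₁ := fun t => (symMap (T t)).toLinearMap) (D₁ := symDer D) ?_
    · simp
    · simp only [LinearMap.mul_apply']
      rw [symDer_mul, add_comm]
    · obtain ⟨m', hm, hm'⟩ := h m
      refine ⟨fun t => SymmetricAlgebra.ι ℂ M (m' t), ?_, fun t => ?_⟩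
      · convert curves_map (SymmetricAlgebra.ι ℂ M) hm using 2
        funext t
        simp [symMap]
      · rw [← map_smul, hm', map_add, map_smul, symDer_ι]
        simp [symMap]

theorem IsWeightCurve.tensorSymPow {k : ℕ} (h : ∀ x, IsWeightCurve q T D k x) (n m : ℕ)
    (z : SymmetricAlgebra ℂ M ⊗[ℂ] SymmetricAlgebra ℂ M)
    (hz : z ∈ LinearMap.range (TensorProduct.mapIncl (SpinTen.symPow n (⊤ : Submodule ℂ M))
      (SpinTen.symPow m (⊤ : Submodule ℂ M)))) :
    IsWeightCurve q
      (fun t => TensorProduct.map (symMap (T t)).toLinearMap (symMap (T t)).toLinearMap)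
      (TensorProduct.map (symDer D) LinearMap.id + TensorProduct.map LinearMap.id (symDer D))
      (n * k + m * k) z := by
  obtain ⟨z, rfl⟩ := hz
  induction z with
  | zero => rw [map_zero]; exact .zero
  | add x y hx hy => rw [map_add]; exact hx.add hy
  | tmul x y =>
    rw [TensorProduct.mapIncl, TensorProduct.map_tmul]
    exact (IsWeightCurve.symPow h n x x.2).bilinear
      (T₂ := fun t => TensorProduct.map (symMap (T t)).toLinearMap (symMap (T t)).toLinearMap)
      (D₂ := TensorProduct.map (symDer D) LinearMap.id + TensorProduct.map LinearMap.id (symDer D))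
      (TensorProduct.mk ℂ _ _)
      (fun t x y => by simp) (fun x y => by simp) (IsWeightCurve.symPow h m y y.2)

/-- The algebra endomorphism of `Sym M ⊗ Sym M` induced by an endomorphism of `M`. -/
def tensMap (f : Module.End ℂ M) : Module.End ℂ
    (SymmetricAlgebra ℂ M ⊗[ℂ] SymmetricAlgebra ℂ M) :=
  TensorProduct.map (symMap f).toLinearMap (symMap f).toLinearMap

theorem tensMap_one (z : SymmetricAlgebra ℂ M ⊗[ℂ] SymmetricAlgebra ℂ M) :
    tensMap (1 : Module.End ℂ M) z = z := by
  induction z with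
  | zero => rw [map_zero]
  | add x y hx hy => rw [map_add, hx, hy]
  | tmul x y =>
    rw [tensMap, TensorProduct.map_tmul]
    simp only [AlgHom.toLinearMap_apply]
    rw [symMap_id, symMap_id]

theorem tensMap_mul (f g : Module.End ℂ M)
    (z : SymmetricAlgebra ℂ M ⊗[ℂ] SymmetricAlgebra ℂ M) :
    tensMap (f * g) z = tensMap f (tensMap g z) := by
  induction z with
  | zero => simp only [map_zero]
  | add x y hx hy => simp only [map_add, hx, hy]
  | tmul x y =>
    simp only [tensMap, TensorProduct.map_tmul, AlgHom.toLinearMap_apply, symMap_comp]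

theorem tensMap_eq_smul {k : ℕ} (h : ∀ x, IsWeightCurve q T D k x) (hq : q.eval 0 = 1)
    (hT : T 0 = 1) {z : SymmetricAlgebra ℂ M ⊗[ℂ] SymmetricAlgebra ℂ M}
    (hz : z ∈ LinearMap.range (TensorProduct.mapIncl
      (SpinTen.symPow 2 (⊤ : Submodule ℂ M)) (SpinTen.symPow 2 (⊤ : Submodule ℂ M))))
    (h0 : (TensorProduct.map (symDer D) LinearMap.id +
      TensorProduct.map LinearMap.id (symDer D) : Module.End ℂ
        (SymmetricAlgebra ℂ M ⊗[ℂ] SymmetricAlgebra ℂ M)) z = 0) (t : ℂ) :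
    tensMap (T t) z = q.eval t ^ (2 * k) • z := by
  have h2 := IsWeightCurve.tensorSymPow h 2 2 z hz
  -- The degrees of the two symmetric squares add up to 2k + 2k, so the exponent of q is the integer
  -- 2k.
  rw [← two_mul] at h2
  refine h2.eq_smul hq ?_ h0 t
  rw [hT]
  exact tensMap_one z

/-- For `B² = δ`, the polynomial curve `1 + t (s - 1 + B)` from `1` to `s + B`. -/
theorem isWeightCurve_of_sq {B : Module.End ℂ M} {δ : ℂ} (hB : B * B = δ • 1) (s : ℂ) (x : M) :
    IsWeightCurve ((1 + C (s - 1) * X) ^ 2 - C δ * X ^ 2)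
      (fun t => 1 + t • ((s - 1) • 1 + B)) B 1 x := by
  have hBB : B (B x) = δ • x := LinearMap.congr_fun hB x
  refine ⟨fun _ => (s - 1) • x + B x, ?_, fun t => ?_⟩
  · have h2 := (curves M).add_mem (monomial_mem_curves 1 x)
      (monomial_mem_curves X ((s - 1) • x + B x))
    convert h2 using 2
    · funext t
      simp
    · funext t
      simp
  -- With a = 1 + (s − 1)t the polynomial is q = (a + tB)(a − tB), and (a − tB)(s − 1 + B) = B +
  -- q'/2.
  · have h2 : (derivative ((1 + C (s - 1) * X) ^ 2 - C δ * X ^ 2 : ℂ[X])).eval t =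
        2 * (1 + (s - 1) * t) * (s - 1) - 2 * δ * t := by
      simp [derivative_pow]
      ring
    rw [h2]
    simp [hBB]
    module

end Functors

/-! ### Invariance under the spin group -/

theorem bivector_add_polar (v w : Std) : (CliffordAlgebra.even.ι Q).bilin v w =
    (QuadraticMap.polar Q v w / 2) • 1 + bivector v w := by
  refine Subtype.ext ?_
  have h := CliffordAlgebra.ι_mul_ι_add_swap (Q := Q) v w
  have h1 : (((CliffordAlgebra.even.ι Q).bilin v w : CliffordAlgebra.even Q) : CliffordAlgebra Q) =
    CliffordAlgebra.ι Q v * CliffordAlgebra.ι Q w := rfl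
  have h2 : (((QuadraticMap.polar Q v w / 2) • 1 + bivector v w : CliffordAlgebra.even Q) :
      CliffordAlgebra Q) = (QuadraticMap.polar Q v w / 2) • 1 + bivector v w := rfl
  rw [h1, h2, coe_bivector, div_eq_inv_mul, mul_smul, ← Algebra.algebraMap_eq_smul_one, ← h,
    ← smul_add]
  rw [show CliffordAlgebra.ι Q v * CliffordAlgebra.ι Q w + CliffordAlgebra.ι Q w *
    CliffordAlgebra.ι Q v + (CliffordAlgebra.ι Q v * CliffordAlgebra.ι Q w - CliffordAlgebra.ι Q w *
    CliffordAlgebra.ι Q v) = (2 : ℂ) • (CliffordAlgebra.ι Q v * CliffordAlgebra.ι Q w) by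
    rw [two_smul]; abel, smul_smul]
  norm_num

/-- The product vw satisfies a quadratic equation with constant term Q(v)Q(w), and the bivector
completes the square. -/
theorem bivector_sq (v w : Std) : bivector v w * bivector v w =
    ((QuadraticMap.polar Q v w / 2) ^ 2 - Q v * Q w) • 1 := by
  have h : bivector v w = (CliffordAlgebra.even.ι Q).bilin v w -
      (QuadraticMap.polar Q v w / 2) • 1 := by
    rw [bivector_add_polar, add_sub_cancel_left]
  refine Subtype.ext ?_
  have h1 : (bivector v w : CliffordAlgebra Q) = CliffordAlgebra.ι Q v * CliffordAlgebra.ι Q w -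
      (QuadraticMap.polar Q v w / 2) • 1 := congrArg Subtype.val h
  have h2 : (bivector v w * bivector v w : CliffordAlgebra Q) =
      ((QuadraticMap.polar Q v w / 2) ^ 2 - Q v * Q w) • 1 := by
    have h3 : CliffordAlgebra.ι Q v * CliffordAlgebra.ι Q w *
        (CliffordAlgebra.ι Q v * CliffordAlgebra.ι Q w) =
        QuadraticMap.polar Q v w • (CliffordAlgebra.ι Q v * CliffordAlgebra.ι Q w) -
          (Q v * Q w) • 1 := by
      have h4 : CliffordAlgebra.ι Q w * CliffordAlgebra.ι Q v = algebraMap ℂ _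
          (QuadraticMap.polar Q v w) - CliffordAlgebra.ι Q v * CliffordAlgebra.ι Q w := by
        rw [← CliffordAlgebra.ι_mul_ι_add_swap, add_sub_cancel_left]
      calc _ = CliffordAlgebra.ι Q v * (CliffordAlgebra.ι Q w * CliffordAlgebra.ι Q v) *
            CliffordAlgebra.ι Q w := by noncomm_ring
        _ = CliffordAlgebra.ι Q v * algebraMap ℂ _ (QuadraticMap.polar Q v w) *
            CliffordAlgebra.ι Q w - (CliffordAlgebra.ι Q v * CliffordAlgebra.ι Q v) *
            (CliffordAlgebra.ι Q w * CliffordAlgebra.ι Q w) := by rw [h4]; noncomm_ring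
        _ = _ := by
          rw [CliffordAlgebra.ι_sq_scalar, CliffordAlgebra.ι_sq_scalar, ← Algebra.commutes,
            ← map_mul, Algebra.algebraMap_eq_smul_one, Algebra.algebraMap_eq_smul_one,
            smul_mul_assoc, smul_mul_assoc, one_mul]
    rw [h1, mul_sub, sub_mul, sub_mul, h3]
    simp only [smul_mul_assoc, mul_smul_comm, one_mul, mul_one]
    module
  exact h2

theorem prod_ι_mem (l : List Std) :
    CliffordAlgebra.involute ((l.map (CliffordAlgebra.ι Q)).prod) =
      (-1 : ℂ) ^ l.length • (l.map (CliffordAlgebra.ι Q)).prod := by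
  induction l with
  | nil => simp
  | cons v l ih => simp [ih, pow_succ]

theorem star_prod_ι_mul (l : List Std) :
    star ((l.map (CliffordAlgebra.ι Q)).prod) * (l.map (CliffordAlgebra.ι Q)).prod =
      algebraMap ℂ _ ((-1 : ℂ) ^ l.length * (l.map Q).prod) := by
  induction l with
  | nil => simp
  | cons v l ih =>
    rw [List.map_cons, List.prod_cons, star_mul, CliffordAlgebra.star_ι]
    calc _ = -(star ((l.map (CliffordAlgebra.ι Q)).prod) *
          (CliffordAlgebra.ι Q v * CliffordAlgebra.ι Q v) * (l.map (CliffordAlgebra.ι Q)).prod) := by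
            noncomm_ring
      _ = _ := by
        rw [CliffordAlgebra.ι_sq_scalar, ← Algebra.commutes, mul_assoc, ih, ← map_mul, ← map_neg]
        congr 1
        simp only [List.length_cons, List.map_cons, List.prod_cons, pow_succ]
        ring

/-- The inverse is carried along for the induction, since the group closure allows inverses; the
inverse of a generating vector is a multiple of that vector. -/
theorem exists_prod_ι (g : (CliffordAlgebra Q)ˣ) (hg : g ∈ lipschitzGroup Q) :
    ∃ l : List Std, (g : CliffordAlgebra Q) = (l.map (CliffordAlgebra.ι Q)).prod ∧
      ((g⁻¹ : (CliffordAlgebra Q)ˣ) : CliffordAlgebra Q) ∈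
        Set.range fun l : List Std => (l.map (CliffordAlgebra.ι Q)).prod := by
  induction hg using Subgroup.closure_induction with
  | mem g hg =>
    obtain ⟨v, hv⟩ := hg
    refine ⟨[v], by simp [hv], ?_⟩
    have h1 : (g : CliffordAlgebra Q) * g = algebraMap ℂ _ (Q v) := by
      rw [← hv, CliffordAlgebra.ι_sq_scalar]
    have h2 : Q v ≠ 0 := by
      intro h
      rw [h, map_zero] at h1
      exact (g * g).ne_zero h1
    refine ⟨[(Q v)⁻¹ • v], ?_⟩
    refine Units.eq_inv_of_mul_eq_one_right ?_
    simp only [List.map_cons, List.map_nil, List.prod_cons, List.prod_nil, mul_one, map_smul, hv,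
      smul_mul_assoc, h1, Algebra.algebraMap_eq_smul_one, smul_smul, inv_mul_cancel₀ h2, one_smul]
  | one => exact ⟨[], by simp, [], by simp⟩
  | mul a b _ _ ha hb =>
    obtain ⟨l, hl, l', hl'⟩ := ha
    obtain ⟨m, hm, m', hm'⟩ := hb
    refine ⟨l ++ m, by simp [hl, hm], m' ++ l', ?_⟩
    simp only at hl' hm'
    simp [hl', hm']
  | inv a _ ha =>
    obtain ⟨l, hl, l', hl'⟩ := ha
    exact ⟨l', hl'.symm, l, by simp [hl]⟩

/-- Vectors are taken in pairs, as Φ is only defined on the even subalgebra. -/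
theorem exists_even_of_prod {E : Type*} [AddCommGroup E] [Module ℂ E]
    (Φ : CliffordAlgebra.even Q → Module.End ℂ E) {z : E} (h1 : Φ 1 z = z)
    (hmul : ∀ a b, Φ (a * b) z = Φ a (Φ b z)) {k : ℕ}
    (h : ∀ v w, Φ ((CliffordAlgebra.even.ι Q).bilin v w) z = (Q v * Q w) ^ k • z)
    (n : ℕ) (l : List Std) (hl : l.length = 2 * n) :
    ∃ c : CliffordAlgebra.even Q, (c : CliffordAlgebra Q) = (l.map (CliffordAlgebra.ι Q)).prod ∧
      Φ c z = (l.map Q).prod ^ k • z := by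
  induction n generalizing l with
  | zero =>
    obtain rfl := List.length_eq_zero_iff.mp hl
    refine ⟨1, rfl, ?_⟩
    rw [h1, List.map_nil, List.prod_nil, one_pow, one_smul]
  | succ n ih =>
    match l, hl with
    | v :: w :: l, hl =>
      obtain ⟨c, hc, hcz⟩ := ih l (by simp at hl; omega)
      refine ⟨(CliffordAlgebra.even.ι Q).bilin v w * c, ?_, ?_⟩
      · rw [Subalgebra.coe_mul, hc, List.map_cons, List.map_cons, List.prod_cons, List.prod_cons,
          ← mul_assoc]
        rfl
      · rw [hmul, hcz, map_smul, h, smul_smul]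
        simp only [List.map_cons, List.prod_cons]
        ring_nf

theorem algebraMap_injective : Function.Injective (algebraMap ℂ (CliffordAlgebra Q)) := by
  intro a b hab
  have h := congrArg (fun c => spinor c 1) hab
  simpa using h

/-- Write g as a product of vectors. The involution fixes g, so their number is even; star g · g = 1
makes the product of their values under Q equal to 1, and the factor by which g acts on z is a power
of that product. -/
theorem even_apply_spin {E : Type*} [AddCommGroup E] [Module ℂ E]
    (Φ : CliffordAlgebra.even Q → Module.End ℂ E) {z : E} (h1 : Φ 1 z = z)
    (hmul : ∀ a b, Φ (a * b) z = Φ a (Φ b z)) {k : ℕ}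
    (h : ∀ v w, Φ ((CliffordAlgebra.even.ι Q).bilin v w) z = (Q v * Q w) ^ k • z) (g : Spin) :
    Φ ⟨g, spinGroup.mem_even g.2⟩ z = z := by
  obtain ⟨l, hl, -⟩ := exists_prod_ι (spinGroup.toUnits g)
    (spinGroup.units_mem_lipschitzGroup (x := spinGroup.toUnits g) g.2)
  have hl' : (g : CliffordAlgebra Q) = (l.map (CliffordAlgebra.ι Q)).prod := hl
  have hg : (g : CliffordAlgebra Q) ≠ 0 := (spinGroup.toUnits g).ne_zero
  have h5 := prod_ι_mem l
  rw [← hl', spinGroup.involute_eq g.2] at h5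
  have h2 : Even l.length := by
    by_contra h
    rw [Nat.not_even_iff_odd] at h
    rw [h.neg_one_pow, neg_one_smul] at h5
    have h6 : (2 : ℂ) • (g : CliffordAlgebra Q) = 0 := by
      rw [two_smul]
      exact add_eq_zero_iff_eq_neg.mpr h5
    exact hg ((smul_eq_zero.mp h6).resolve_left two_ne_zero)
  have h3 := star_prod_ι_mul l
  rw [← hl', spinGroup.star_mul_self_of_mem g.2, h2.neg_one_pow, one_mul, ← map_one (algebraMap ℂ _)]
    at h3
  obtain ⟨n, hn⟩ := h2
  obtain ⟨c, hc, hcz⟩ := exists_even_of_prod Φ h1 hmul h n l (by omega)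
  rw [← algebraMap_injective h3, one_pow, one_smul] at hcz
  have h4 : c = ⟨g, spinGroup.mem_even g.2⟩ := Subtype.ext (hc.trans hl'.symm)
  rwa [h4] at hcz

theorem symMap_spin {L : Type*} [AddCommGroup L] [Module ℂ L]
    (R : CliffordAlgebra.even Q → Module.End ℂ L) (h1 : R 1 = 1)
    (hmul : ∀ a b, R (a * b) = R a * R b) {act : Std → Std → Module.End ℂ L} {k : ℕ}
    {T : Std → Std → ℂ → Module.End ℂ L} {q : Std → Std → Polynomial ℂ}
    (hT : ∀ v w x, IsWeightCurve (q v w) (T v w) (act v w) k x) (hT0 : ∀ v w, T v w 0 = 1)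
    (hT1 : ∀ v w, T v w 1 = R ((CliffordAlgebra.even.ι Q).bilin v w))
    (hq0 : ∀ v w, (q v w).eval 0 = 1) (hq1 : ∀ v w, (q v w).eval 1 = Q v * Q w)
    {z : SymmetricAlgebra ℂ L ⊗[ℂ] SymmetricAlgebra ℂ L}
    (hz : z ∈ LinearMap.range (TensorProduct.mapIncl
      (symPow 2 (⊤ : Submodule ℂ L)) (symPow 2 (⊤ : Submodule ℂ L))))
    (h0 : ∀ u v, tensAct (fun a b => symDer (act a b)) (fun a b => symDer (act a b)) u v z = 0)
    (g : Spin) : TensorProduct.map (symMap (R ⟨g, spinGroup.mem_even g.2⟩)).toLinearMap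
      (symMap (R ⟨g, spinGroup.mem_even g.2⟩)).toLinearMap z = z := by
  refine even_apply_spin (fun c => tensMap (R c)) (by rw [h1, tensMap_one])
    (fun a b => by rw [hmul, tensMap_mul]) (k := 2 * k) (fun v w => ?_) g
  rw [← hT1, ← hq1]
  exact tensMap_eq_smul (hT v w) (hq0 v w) (hT0 v w) hz (h0 v w) 1

theorem exteriorPower_map_mul {M : Type*} [AddCommGroup M] [Module ℂ M] (n : ℕ)
    (f g : Module.End ℂ M) :
    exteriorPower.map n (f * g) = exteriorPower.map n f * exteriorPower.map n g := by
  refine exteriorPower.linearMap_ext (AlternatingMap.ext fun m => ?_)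
  simp only [LinearMap.compAlternatingMap_apply, Module.End.mul_apply,
    exteriorPower.map_apply_ιMulti]
  congr 1

theorem exteriorPower_map_one {M : Type*} [AddCommGroup M] [Module ℂ M] (n : ℕ) :
    exteriorPower.map n (1 : Module.End ℂ M) = 1 :=
  exteriorPower.map_id

-- With s half the polar form of v and w, the curve ends at ρ(vw), and its polynomial takes the
-- value s² − δ = Q(v)Q(w) at t = 1.
open Polynomial in
theorem isWeightCurve_even {M : Type*} [AddCommGroup M] [Module ℂ M]
    (ρ : CliffordAlgebra.even Q →ₐ[ℂ] Module.End ℂ M) (n : ℕ) (v w : Std) (x : ⋀[ℂ]^n M) :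
    IsWeightCurve ((1 + C (QuadraticMap.polar Q v w / 2 - 1) * X) ^ 2 -
        C ((QuadraticMap.polar Q v w / 2) ^ 2 - Q v * Q w) * X ^ 2)
      (fun t => exteriorPower.map n
        (1 + t • ((QuadraticMap.polar Q v w / 2 - 1) • 1 + ρ (bivector v w))))
      (extDer n (ρ (bivector v w))) n x := by
  have hB : ρ (bivector v w) * ρ (bivector v w) =
      ((QuadraticMap.polar Q v w / 2) ^ 2 - Q v * Q w) • 1 := by
    rw [← map_mul, bivector_sq, map_smul, map_one]
  have h := IsWeightCurve.exteriorPower (isWeightCurve_of_sq hB (QuadraticMap.polar Q v w / 2)) n x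
  rwa [mul_one] at h

theorem map_symLRep_eq {z : SymL ⊗[ℂ] SymL}
    (hz : z ∈ LinearMap.range (TensorProduct.mapIncl
      (symPow 2 (⊤ : Submodule ℂ LSeven)) (symPow 2 (⊤ : Submodule ℂ LSeven))))
    (h0 : ∀ u v, tensAct symLAct symLAct u v z = 0) (g : Spin) :
    TensorProduct.map (symLRep g).toLinearMap (symLRep g).toLinearMap z = z := by
  have h := @symMap_spin LSeven _ _ (fun c => exteriorPower.map 7 (spinorPlus c))
    (by rw [map_one]; exact exteriorPower_map_one 7)
    (fun a b => by rw [map_mul]; exact exteriorPower_map_mul 7 _ _) lambdaAct 7 _ _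
    (isWeightCurve_even spinorPlus 7) (fun v w => by
      rw [zero_smul, add_zero]; exact exteriorPower_map_one 7) (fun v w => by
      rw [bivector_add_polar, map_add, map_smul, map_one, one_smul]
      congr 1
      module) (fun v w => by simp) (fun v w => by simp) z hz h0 g
  exact h

theorem mul'_map_algHom {A : Type*} [CommRing A] [Algebra ℂ A] (f : A →ₐ[ℂ] A) (z : A ⊗[ℂ] A) :
    LinearMap.mul' ℂ A (TensorProduct.map f.toLinearMap f.toLinearMap z) =
      f (LinearMap.mul' ℂ A z) := by
  induction z with
  | zero => simp
  | add x y hx hy => simp only [map_add, hx, hy]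
  | tmul x y => simp

/-! ### Torus invariants -/

theorem coe_inv_mul (g : Spin) : ((g⁻¹ : Spin) : CliffordAlgebra Q) * (g : CliffordAlgebra Q) = 1 := by
  rw [← Submonoid.coe_mul, inv_mul_cancel, Submonoid.coe_one]

theorem coe_mul_inv (g : Spin) : (g : CliffordAlgebra Q) * ((g⁻¹ : Spin) : CliffordAlgebra Q) = 1 := by
  rw [← Submonoid.coe_mul, mul_inv_cancel, Submonoid.coe_one]

theorem ι_vecRep_mul (g : Spin) (v w : Std) :
    CliffordAlgebra.ι Q (vecRep g v) * CliffordAlgebra.ι Q (vecRep g w) =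
      (g : CliffordAlgebra Q) * (CliffordAlgebra.ι Q v * CliffordAlgebra.ι Q w) *
        ((g⁻¹ : Spin) : CliffordAlgebra Q) := by
  have h1 : ∀ v, CliffordAlgebra.ι Q (vecRep g v) =
    (g : CliffordAlgebra Q) * CliffordAlgebra.ι Q v * ((g⁻¹ : Spin) : CliffordAlgebra Q) := ι_vecMap g
  rw [h1, h1]
  calc _ = (g : CliffordAlgebra Q) * CliffordAlgebra.ι Q v *
        (((g⁻¹ : Spin) : CliffordAlgebra Q) * (g : CliffordAlgebra Q)) * CliffordAlgebra.ι Q w *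
          ((g⁻¹ : Spin) : CliffordAlgebra Q) := by simp only [mul_assoc]
    _ = _ := by rw [coe_inv_mul]; simp only [mul_assoc, one_mul]

theorem polar_vecRep (g : Spin) (v w : Std) :
    QuadraticMap.polar Q (vecRep g v) (vecRep g w) = QuadraticMap.polar Q v w := by
  refine algebraMap_injective ?_
  rw [← CliffordAlgebra.ι_mul_ι_add_swap, ι_vecRep_mul, ι_vecRep_mul, ← add_mul, ← mul_add,
    CliffordAlgebra.ι_mul_ι_add_swap, ← Algebra.commutes, mul_assoc, coe_mul_inv, mul_one]

theorem vecRep_mul_stdAct (g : Spin) (a b : Std) :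
    vecRep g * stdAct a b = stdAct (vecRep g a) (vecRep g b) * vecRep g := by
  refine LinearMap.ext fun v => ?_
  simp only [Module.End.mul_apply, stdAct, LinearMap.sub_apply, LinearMap.smulRight_apply,
    QuadraticMap.polarBilin_apply_apply, polar_vecRep, map_sub, map_smul]

theorem vecRep_em {g : Spin} (hg : g ∈ torus) {t : Fin 5 → ℂ}
    (ht : ∀ i, vecRep g (e i) = t i • e i) (i : Fin 5) :
    t i ≠ 0 ∧ vecRep g (em i) = (t i)⁻¹ • em i := by
  obtain ⟨u, hu⟩ := (hg i).2
  have h := polar_vecRep g (e i) (em i)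
  have h1 : QuadraticMap.polar Q (e i) (em i) = 1 := by
    have h2 := polarBilin_Q (e i) (em i)
    rw [QuadraticMap.polarBilin_apply_apply] at h2
    rw [h2]
    simp [e, em]
  rw [ht, hu, QuadraticMap.polar_smul_left, QuadraticMap.polar_smul_right, h1] at h
  have h2 : t i * u = 1 := by simpa using h
  exact ⟨left_ne_zero_of_mul_eq_one h2, by rw [hu, eq_inv_of_mul_eq_one_right h2]⟩

/-- The character of the torus on the weight `mu`. -/
def torusChar (t : Fin 5 → ℂ) (mu : Fin 5 → ℤ) : ℂ := ∏ k, t k ^ mu k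

theorem torusChar_add {t : Fin 5 → ℂ} (ht : ∀ i, t i ≠ 0) (mu nu : Fin 5 → ℤ) :
    torusChar t (mu + nu) = torusChar t mu * torusChar t nu := by
  simp only [torusChar, Pi.add_apply, ← Finset.prod_mul_distrib]
  exact Finset.prod_congr rfl fun k _ => zpow_add₀ (ht k) _ _

theorem vecRep_mul_lowering {g : Spin} (hg : g ∈ torus) {t : Fin 5 → ℂ}
    (ht : ∀ i, vecRep g (e i) = t i • e i) (i : Fin 5) :
    vecRep g * lowering stdAct i = (torusChar t (-simpleRoot i) • lowering stdAct i) * vecRep g := by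
  have h1 : ∀ i, t i ≠ 0 := fun i => (vecRep_em hg ht i).1
  have h2 : ∀ i, vecRep g (em i) = (t i)⁻¹ • em i := fun i => (vecRep_em hg ht i).2
  have h3 : ∀ (a b : Std) (x y : ℂ), stdAct (x • a) (y • b) = (x * y) • stdAct a b := by
    intro a b x y
    rw [isLieAct_stdAct.smul_left, isLieAct_stdAct.smul_right, smul_smul]
  fin_cases i <;>
  simp [lowering, vecRep_mul_stdAct, ht, h2, h3, torusChar, Fin.prod_univ_five, simpleRoot, mul_comm]

theorem symMap_vecRep_word {g : Spin} (hg : g ∈ torus) {t : Fin 5 → ℂ}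
    (ht : ∀ i, vecRep g (e i) = t i • e i) (I : List (Fin 5)) :
    symMap (vecRep g) (word symStdAct I hwStd) =
      torusChar t (fiveOmega - (I.map simpleRoot).sum) • word symStdAct I hwStd := by
  have h1 : ∀ i, t i ≠ 0 := fun i => (vecRep_em hg ht i).1
  induction I with
  | nil =>
    rw [word_nil, hwStd, map_pow]
    have h2 : symMap (vecRep g) (SymmetricAlgebra.ι ℂ Std (e 0)) =
        t 0 • SymmetricAlgebra.ι ℂ Std (e 0) := by
      simp [symMap, ht]
    rw [h2, smul_pow]
    congr 1
    simp [torusChar, Fin.prod_univ_five, fiveOmega]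
  | cons i I ih =>
    rw [word_cons, lowering_symStdAct, symMap_symDer _ _ _ (vecRep_mul_lowering hg ht i), ih,
      symDer_smul, LinearMap.smul_apply, map_smul, smul_smul, ← torusChar_add h1]
    congr 2
    simp only [List.map_cons, List.sum_cons]
    abel

theorem symMap_vecRep_fvec {g : Spin} (hg : g ∈ torus) {t : Fin 5 → ℂ}
    (ht : ∀ i, vecRep g (e i) = t i • e i) (I : List (Fin 5)) :
    symMap (vecRep g) (fvec I) = torusChar t (seqWeight I) • fvec I := by
  rw [fvec_eq_word, symMap_vecRep_word hg ht, seqWeight, List.map_reverse, List.sum_reverse]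

theorem exists_torus_char {g : Spin} (hg : g ∈ torus) :
    ∃ t : Fin 5 → ℂ, ∀ i, vecRep g (e i) = t i • e i := by
  choose t ht using fun i => (hg i).1
  exact ⟨t, ht⟩

theorem mul_ι_mem_spinGroup {v w : Std} (hv : Q v = 1) (hw : Q w = 1) :
    CliffordAlgebra.ι Q v * CliffordAlgebra.ι Q w ∈ spinGroup Q := by
  have hu : ∀ v : Std, Q v = 1 → CliffordAlgebra.ι Q v * CliffordAlgebra.ι Q v = 1 := by
    intro v hv
    rw [CliffordAlgebra.ι_sq_scalar, hv, map_one]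
  have hl : ∀ v : Std, Q v = 1 → ∃ u ∈ lipschitzGroup Q,
      (u : CliffordAlgebra Q) = CliffordAlgebra.ι Q v := fun v hv =>
    ⟨⟨_, _, hu v hv, hu v hv⟩, Subgroup.subset_closure ⟨v, rfl⟩, rfl⟩
  obtain ⟨a, ha, ha'⟩ := hl v hv
  obtain ⟨b, hb, hb'⟩ := hl w hw
  have hs : star (CliffordAlgebra.ι Q v * CliffordAlgebra.ι Q w) =
      CliffordAlgebra.ι Q w * CliffordAlgebra.ι Q v := by
    rw [star_mul, CliffordAlgebra.star_ι, CliffordAlgebra.star_ι, neg_mul_neg]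
  refine spinGroup.mem_iff.mpr ⟨pinGroup.mem_iff.mpr ⟨⟨a * b, mul_mem ha hb, ?_⟩, ?_⟩, ?_⟩
  · simp [ha', hb']
  · rw [Unitary.mem_iff, hs]
    constructor
    · rw [mul_assoc, ← mul_assoc (CliffordAlgebra.ι Q v), hu v hv, one_mul, hu w hw]
    · rw [mul_assoc, ← mul_assoc (CliffordAlgebra.ι Q w), hu w hw, one_mul, hu v hv]
  · exact CliffordAlgebra.ι_mul_ι_mem_evenOdd_zero _ _ _

/-- For a unit vector u, the map x ↦ u x u is minus the reflection in u; here two such maps are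
composed. -/
theorem vecRep_mul_ι {v w : Std} (hv : Q v = 1) (hw : Q w = 1) (x : Std) :
    vecRep ⟨_, mul_ι_mem_spinGroup hv hw⟩ x =
      QuadraticMap.polar Q v (QuadraticMap.polar Q w x • w - x) • v -
        (QuadraticMap.polar Q w x • w - x) := by
  have hr : ∀ v x : Std, Q v = 1 → CliffordAlgebra.ι Q v * CliffordAlgebra.ι Q x *
      CliffordAlgebra.ι Q v = CliffordAlgebra.ι Q (QuadraticMap.polar Q v x • v - x) := by
    intro v x hv
    have h := CliffordAlgebra.ι_mul_ι_add_swap (Q := Q) v x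
    rw [← eq_sub_iff_add_eq] at h
    rw [h, sub_mul, mul_assoc, CliffordAlgebra.ι_sq_scalar, hv, map_one, mul_one, map_sub, map_smul,
      Algebra.smul_def]
  refine ι_injective ?_
  rw [← hr v _ hv, ← hr w _ hw]
  have h1 : CliffordAlgebra.ι Q (vecRep ⟨_, mul_ι_mem_spinGroup hv hw⟩ x) = _ := ι_vecMap _ x
  have h2 : (((⟨_, mul_ι_mem_spinGroup hv hw⟩ : Spin)⁻¹ : Spin) : CliffordAlgebra Q) =
      CliffordAlgebra.ι Q w * CliffordAlgebra.ι Q v := by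
    have h3 : (((⟨_, mul_ι_mem_spinGroup hv hw⟩ : Spin)⁻¹ : Spin) : CliffordAlgebra Q) =
        star (CliffordAlgebra.ι Q v * CliffordAlgebra.ι Q w) := rfl
    rw [h3, star_mul, CliffordAlgebra.star_ι, CliffordAlgebra.star_ι, neg_mul_neg]
  rw [h1, h2]
  simp only [mul_assoc]

/-- The two unit vectors lie in the hyperbolic plane of e_k and e₋ₖ, so their product fixes the
other basis vectors. It scales e_k by 1/4, which is not a root of unity and therefore separates
weights. -/
theorem exists_torus (k : Fin 5) : ∃ g ∈ torus, ∀ i,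
    vecRep g (e i) = (if i = k then (4 : ℂ)⁻¹ else 1) • e i := by
  have hv : Q (e k + em k) = 1 := by simp [e, em]
  have hw : Q ((2 : ℂ) • e k + (2 : ℂ)⁻¹ • em k) = 1 := by simp [e, em]
  have hp : ∀ x y : Std, QuadraticMap.polar Q x y = x.1 y.2 + y.1 x.2 := polarBilin_Q
  have h1 : ∀ i, vecRep ⟨_, mul_ι_mem_spinGroup hv hw⟩ (e i) =
      (if i = k then (4 : ℂ)⁻¹ else 1) • e i := by
    intro i
    rw [vecRep_mul_ι hv hw]
    by_cases h : i = k
    · subst h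
      have h1 : QuadraticMap.polar Q ((2 : ℂ) • e i + (2 : ℂ)⁻¹ • em i) (e i) = 2⁻¹ := by
        simp [hp, e, em]
      have h2 : QuadraticMap.polar Q (e i + em i)
          ((2⁻¹ : ℂ) • ((2 : ℂ) • e i + (2 : ℂ)⁻¹ • em i) - e i) = 4⁻¹ := by
        simp [hp, e, em]
        norm_num
      rw [h1, h2, if_pos rfl]
      module
    · have h1 : QuadraticMap.polar Q ((2 : ℂ) • e k + (2 : ℂ)⁻¹ • em k) (e i) = 0 := by
        simp [hp, e, em, Ne.symm h]
      have h2 : QuadraticMap.polar Q (e k + em k)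
          ((0 : ℂ) • ((2 : ℂ) • e k + (2 : ℂ)⁻¹ • em k) - e i) = 0 := by
        simp [hp, e, em, Ne.symm h]
      rw [h1, h2, if_neg h]
      module
  have h2 : ∀ i, vecRep ⟨_, mul_ι_mem_spinGroup hv hw⟩ (em i) =
      (if i = k then (4 : ℂ) else 1) • em i := by
    intro i
    rw [vecRep_mul_ι hv hw]
    by_cases h : i = k
    · subst h
      have h1 : QuadraticMap.polar Q ((2 : ℂ) • e i + (2 : ℂ)⁻¹ • em i) (em i) = 2 := by
        simp [hp, e, em]
      have h2 : QuadraticMap.polar Q (e i + em i)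
          ((2 : ℂ) • ((2 : ℂ) • e i + (2 : ℂ)⁻¹ • em i) - em i) = 4 := by
        simp [hp, e, em]
        norm_num
      rw [h1, h2, if_pos rfl]
      module
    · have h1 : QuadraticMap.polar Q ((2 : ℂ) • e k + (2 : ℂ)⁻¹ • em k) (em i) = 0 := by
        simp [hp, e, em, h]
      have h2 : QuadraticMap.polar Q (e k + em k)
          ((0 : ℂ) • ((2 : ℂ) • e k + (2 : ℂ)⁻¹ • em k) - em i) = 0 := by
        simp [hp, e, em, h]
      rw [h1, h2, if_neg h]
      module
  exact ⟨_, fun i => ⟨⟨_, h1 i⟩, ⟨_, h2 i⟩⟩, h1⟩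

/-- A vector fixed by simultaneously diagonal operators is a combination of fixed basis vectors. -/
theorem mem_span_of_fixed {E κ κ' : Type*} [AddCommGroup E] [Module ℂ E] [Fintype κ] {f : κ → E}
    (hf : LinearIndependent ℂ f) (D : κ' → Module.End ℂ E) (χ : κ' → κ → ℂ)
    (hD : ∀ k p, D k (f p) = χ k p • f p) {z : E} (hz : z ∈ Submodule.span ℂ (Set.range f))
    (hfix : ∀ k, D k z = z) : z ∈ Submodule.span ℂ (f '' {p | ∀ k, χ k p = 1}) := by
  obtain ⟨c, rfl⟩ := (Submodule.mem_span_range_iff_exists_fun ℂ).mp hz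
  refine Submodule.sum_mem _ fun p _ => ?_
  by_cases hp : c p = 0
  · rw [hp, zero_smul]
    exact Submodule.zero_mem _
  · refine Submodule.smul_mem _ _ (Submodule.subset_span ⟨p, fun k => ?_, rfl⟩)
    have h1 : ∑ p, (c p * (χ k p - 1)) • f p = 0 := by
      rw [← sub_eq_zero.mpr (hfix k), map_sum, ← Finset.sum_sub_distrib]
      refine Finset.sum_congr rfl fun p _ => ?_
      rw [map_smul, hD]
      module
    have h2 := Fintype.linearIndependent_iff.mp hf _ h1 p
    exact sub_eq_zero.mp ((mul_eq_zero.mp h2).resolve_left hp)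

theorem range_mapIncl_le {E : Type*} [AddCommGroup E] [Module ℂ E] {κ : Type*} {f : κ → E}
    {V : Submodule ℂ E} (hV : V = Submodule.span ℂ (Set.range f)) :
    LinearMap.range (TensorProduct.mapIncl V V) ≤
      Submodule.span ℂ (Set.range fun p : κ × κ => f p.1 ⊗ₜ[ℂ] f p.2) := by
  rintro _ ⟨t, rfl⟩
  induction t with
  | zero => rw [map_zero]; exact Submodule.zero_mem _
  | add x y hx hy => rw [map_add]; exact Submodule.add_mem _ hx hy
  | tmul x y =>
    obtain ⟨x, hx⟩ := x
    obtain ⟨y, hy⟩ := y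
    rw [hV] at hx hy
    have h := Submodule.apply_mem_map₂ (TensorProduct.mk ℂ E E) hx hy
    rw [Submodule.map₂_span_span, Set.image2_range] at h
    exact h

variable {A : Finset (List (Fin 5))}

theorem linearIndependent_tmul_self {M κ : Type*} [AddCommGroup M] [Module ℂ M]
    {f : κ → SymmetricAlgebra ℂ M}
    (hf : LinearIndependent ℂ f) : LinearIndependent ℂ fun p : κ × κ => f p.1 ⊗ₜ[ℂ] f p.2 :=
  hf.tmul_of_isDomain hf

theorem linearIndependent_tmul (hA : IsBasisSet A) :
    LinearIndependent ℂ fun p : A × A => fvec p.1 ⊗ₜ[ℂ] fvec p.2 :=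
  linearIndependent_tmul_self (M := Std) (f := fun I : A => fvec I) hA.independent

theorem linearIndependent_opposite (hA : IsBasisSet A) :
    LinearIndependent ℂ fun p : oppositePairs A A => fvec p.1.1 ⊗ₜ[ℂ] fvec p.1.2 := by
  have hm : ∀ p : oppositePairs A A, p.1.1 ∈ A ∧ p.1.2 ∈ A := fun p =>
    Finset.mem_product.mp (Finset.mem_filter.mp p.2).1
  refine (linearIndependent_tmul hA).comp
    (fun p : oppositePairs A A => ((⟨p.1.1, (hm p).1⟩, ⟨p.1.2, (hm p).2⟩) : A × A)) ?_
  intro p q h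
  simp only [Prod.mk.injEq, Subtype.mk.injEq] at h
  exact Subtype.ext (Prod.ext h.1 h.2)

theorem map_vecRep_tmul_fvec {g : Spin} (hg : g ∈ torus) {t : Fin 5 → ℂ}
    (ht : ∀ i, vecRep g (e i) = t i • e i) (I J : List (Fin 5)) :
    TensorProduct.map (symMap (vecRep g)).toLinearMap (symMap (vecRep g)).toLinearMap
      (fvec I ⊗ₜ[ℂ] fvec J) = torusChar t (seqWeight I + seqWeight J) • (fvec I ⊗ₜ[ℂ] fvec J) := by
  rw [TensorProduct.map_tmul, AlgHom.toLinearMap_apply, AlgHom.toLinearMap_apply,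
    symMap_vecRep_fvec hg ht, symMap_vecRep_fvec hg ht, TensorProduct.smul_tmul_smul,
    torusChar_add fun i => (vecRep_em hg ht i).1]

/-- The tensors f_I ⊗ f_J are eigenvectors of T with the sum of the two weights as character. For
the reverse inclusion the five elements of `exists_torus` suffice. -/
theorem span_opposite_eq (hA : IsBasisSet A) :
    Submodule.span ℂ ((fun p : List (Fin 5) × List (Fin 5) => fvec p.1 ⊗ₜ[ℂ] fvec p.2) ''
      oppositePairs A A) = torusInvariants := by
  refine le_antisymm (Submodule.span_le.mpr ?_) fun z hz => ?_
  · rintro _ ⟨⟨I, J⟩, hp, rfl⟩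
    obtain ⟨hp, hw⟩ := Finset.mem_filter.mp (Finset.mem_coe.mp hp)
    obtain ⟨hI, hJ⟩ := Finset.mem_product.mp hp
    have hm : ∀ I ∈ A, fvec I ∈ VFive := fun I hI =>
      hA.span ▸ Submodule.subset_span ⟨I, hI, rfl⟩
    refine ⟨⟨⟨fvec I, hm I hI⟩ ⊗ₜ ⟨fvec J, hm J hJ⟩, rfl⟩, ?_⟩
    simp only [Submodule.mem_iInf, SetLike.mem_coe, LinearMap.mem_ker, LinearMap.sub_apply,
      LinearMap.id_apply]
    intro g hg
    obtain ⟨t, ht⟩ := exists_torus_char hg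
    rw [map_vecRep_tmul_fvec hg ht, hw]
    simp [torusChar]
  · obtain ⟨hz1, hz2⟩ := hz
    simp only [Submodule.mem_iInf, SetLike.mem_coe, LinearMap.mem_ker, LinearMap.sub_apply,
      LinearMap.id_apply, sub_eq_zero] at hz2
    choose g hg ht using exists_torus
    have hV : VFive = Submodule.span ℂ (Set.range fun I : A => fvec I) := by
      rw [← hA.span, Set.image_eq_range]
      rfl
    have h := mem_span_of_fixed (linearIndependent_tmul hA)
      (fun k => TensorProduct.map (symMap (vecRep (g k))).toLinearMap
        (symMap (vecRep (g k))).toLinearMap) _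
      (fun k p => map_vecRep_tmul_fvec (hg k) (ht k) p.1 p.2) (range_mapIncl_le hV hz1)
      (fun k => hz2 (g k) (hg k))
    refine Submodule.span_mono ?_ h
    rintro _ ⟨⟨I, J⟩, hp, rfl⟩
    refine ⟨(I, J), ?_, rfl⟩
    refine Finset.mem_coe.mpr (Finset.mem_filter.mpr ⟨Finset.mem_product.mpr ⟨I.2, J.2⟩, ?_⟩)
    funext k
    have h1 := hp k
    rw [torusChar, Finset.prod_eq_single k (fun j _ hj => by rw [if_neg hj, one_zpow]) (by simp),
      if_pos rfl] at h1
    by_contra hne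
    -- The eigenvalue is (1/4)ⁿ with n the k-th coordinate of the sum of the weights; its absolute
    -- value is 1 only for n = 0.
    have h2 := congrArg norm h1
    rw [norm_zpow, norm_one] at h2
    have h3 := (zpow_eq_one_iff_right₀ (norm_nonneg _) (by norm_num)).mp h2
    exact hne h3

/-! ### Invariance and nonvanishing of the tensor and of its image under multiplication -/

theorem symPow_mono {M : Type*} [AddCommGroup M] [Module ℂ M] (n : ℕ) (V : Submodule ℂ M) :
    symPow n V ≤ symPow n ⊤ :=
  pow_le_pow_left' (Submodule.map_mono le_top) n

theorem range_mapIncl_mono {E : Type*} [AddCommGroup E] [Module ℂ E] {V V' W W' : Submodule ℂ E}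
    (hV : V ≤ V') (hW : W ≤ W') :
    LinearMap.range (TensorProduct.mapIncl V W) ≤ LinearMap.range (TensorProduct.mapIncl V' W') := by
  rintro _ ⟨t, rfl⟩
  induction t with
  | zero => rw [map_zero]; exact Submodule.zero_mem _
  | add x y hx hy => rw [map_add]; exact Submodule.add_mem _ hx hy
  | tmul x y => exact ⟨⟨x, hV x.2⟩ ⊗ₜ ⟨y, hW y.2⟩, rfl⟩

theorem mul'_invariant {L : Type*} [AddCommGroup L] [Module ℂ L] {V W : Submodule ℂ L}
    (hd : Disjoint V W) {F t : SymmetricAlgebra ℂ L ⊗[ℂ] SymmetricAlgebra ℂ L} (hF : F = t)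
    (hm : t ∈ LinearMap.range (TensorProduct.mapIncl (symPow 2 V) (symPow 2 W))) (hn : t ≠ 0)
    {G : Type*} {R : G → SymmetricAlgebra ℂ L →ₐ[ℂ] SymmetricAlgebra ℂ L}
    (hR : ∀ g, TensorProduct.map (R g).toLinearMap (R g).toLinearMap t = t) :
    F ∈ LinearMap.range (TensorProduct.mapIncl (symPow 2 V) (symPow 2 W)) ∧
      (∀ g, TensorProduct.map (R g).toLinearMap (R g).toLinearMap F = F) ∧
      LinearMap.mul' ℂ (SymmetricAlgebra ℂ L) F ∈ symPow 4 (⊤ : Submodule ℂ L) ∧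
      LinearMap.mul' ℂ (SymmetricAlgebra ℂ L) F ≠ 0 ∧
      ∀ g, R g (LinearMap.mul' ℂ (SymmetricAlgebra ℂ L) F) =
        LinearMap.mul' ℂ (SymmetricAlgebra ℂ L) F := by
  subst hF
  refine ⟨hm, hR, mul'_mem_symPow 2 2 _ hm, mul'_ne_zero hd 2 2 _ hm hn, fun g => ?_⟩
  rw [← mul'_map_algHom, hR]

theorem exists_highest_V₁ : ∃ w ∈ symPow 2 V₁, IsHighestWeightVector symLAct fiveOmega w := by
  have h := exists_highest_symPow_generated false
  rw [show hwLambda false = v₁ from rfl] at h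
  exact h

theorem exists_highest_V₂ : ∃ w ∈ symPow 2 V₂, IsHighestWeightVector symLAct fiveOmega w := by
  have h := exists_highest_symPow_generated true
  rw [show hwLambda true = v₂ from rfl] at h
  exact h

variable {A : Finset (List (Fin 5))}

theorem tensorSum_symL_invariant (hA : IsBasisSet A) {w₁ w₂ : SymL} (hS₁ : w₁ ∈ symPow 2 V₁)
    (hS₂ : w₂ ∈ symPow 2 V₂) (hw₁ : IsHighestWeightVector symLAct fiveOmega w₁)
    (hw₂ : IsHighestWeightVector symLAct fiveOmega w₂) (g : Spin) :
    TensorProduct.map (symLRep g).toLinearMap (symLRep g).toLinearMap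
      (tensorSum symLAct symLAct (oppositePairs A A) (invCoeff A) w₁ w₂) =
        tensorSum symLAct symLAct (oppositePairs A A) (invCoeff A) w₁ w₂ :=
  map_symLRep_eq (range_mapIncl_mono (symPow_mono 2 V₁) (symPow_mono 2 V₂)
    (tensorSum_symL_mem _ _ hS₁ hS₂)) (tensorSum_symL_annihilated hA hw₁ hw₂
      (symPow_mono 2 V₁ hS₁) (symPow_mono 2 V₂ hS₂)) g

theorem exists_isBasisSet : ∃ A, IsBasisSet A := by
  obtain ⟨A, hA, hA'⟩ := exists_basis_fvec
  exact ⟨A, hA, hA'⟩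

theorem Ften_Fpoly_invariant (hA : IsBasisSet A) {w₁ w₂ : SymL} (hS₁ : w₁ ∈ symPow 2 V₁)
    (hS₂ : w₂ ∈ symPow 2 V₂) (hw₁ : IsHighestWeightVector symLAct fiveOmega w₁)
    (hw₂ : IsHighestWeightVector symLAct fiveOmega w₂) :
    Ften (oppositePairs A A) (invCoeff A) w₁ w₂ ∈
        LinearMap.range (TensorProduct.mapIncl (symPow 2 V₁) (symPow 2 V₂)) ∧
      (∀ g : Spin, TensorProduct.map (symLRep g).toLinearMap (symLRep g).toLinearMap
        (Ften (oppositePairs A A) (invCoeff A) w₁ w₂) =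
          Ften (oppositePairs A A) (invCoeff A) w₁ w₂) ∧
      Fpoly (oppositePairs A A) (invCoeff A) w₁ w₂ ∈ symPow 4 (⊤ : Submodule ℂ LSeven) ∧
      Fpoly (oppositePairs A A) (invCoeff A) w₁ w₂ ≠ 0 ∧
      ∀ g : Spin, symLRep g (Fpoly (oppositePairs A A) (invCoeff A) w₁ w₂) =
        Fpoly (oppositePairs A A) (invCoeff A) w₁ w₂ :=
  mul'_invariant disjoint_V₁_V₂ (Ften_eq_tensorSum _ _ w₁ w₂) (tensorSum_symL_mem _ _ hS₁ hS₂)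
    (tensorSum_symL_ne_zero hA hw₁ hw₂ (symPow_mono 2 V₁ hS₁) (symPow_mono 2 V₂ hS₂))
    (tensorSum_symL_invariant hA hS₁ hS₂ hw₁ hw₂)

end SpinTen

end

theorem mainTheorem2 :
    (∃ w₁ ∈ SpinTen.symPow 2 SpinTen.V₁,
      SpinTen.IsHighestWeightVector SpinTen.symLAct SpinTen.fiveOmega w₁) ∧
    (∃ w₂ ∈ SpinTen.symPow 2 SpinTen.V₂,
      SpinTen.IsHighestWeightVector SpinTen.symLAct SpinTen.fiveOmega w₂) ∧
    ∃ (A B : Finset (List (Fin 5))) (c : List (Fin 5) → List (Fin 5) → ℚ),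
      (LinearIndependent ℂ (fun I : A => SpinTen.fvec I) ∧
        Submodule.span ℂ (SpinTen.fvec '' A) = SpinTen.VFive) ∧
      (LinearIndependent ℂ (fun J : B => SpinTen.fvec J) ∧
        Submodule.span ℂ (SpinTen.fvec '' B) = SpinTen.VFive) ∧
      (LinearIndependent ℂ (fun p : SpinTen.oppositePairs A B =>
          SpinTen.fvec p.1.1 ⊗ₜ[ℂ] SpinTen.fvec p.1.2) ∧
        Submodule.span ℂ ((fun p : List (Fin 5) × List (Fin 5) =>
          SpinTen.fvec p.1 ⊗ₜ[ℂ] SpinTen.fvec p.2) '' SpinTen.oppositePairs A B) =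
            SpinTen.torusInvariants) ∧
      ∀ w₁ ∈ SpinTen.symPow 2 SpinTen.V₁, ∀ w₂ ∈ SpinTen.symPow 2 SpinTen.V₂,
        SpinTen.IsHighestWeightVector SpinTen.symLAct SpinTen.fiveOmega w₁ →
        SpinTen.IsHighestWeightVector SpinTen.symLAct SpinTen.fiveOmega w₂ →
        SpinTen.Ften (SpinTen.oppositePairs A B) c w₁ w₂ ∈
          LinearMap.range (TensorProduct.mapIncl
            (SpinTen.symPow 2 SpinTen.V₁) (SpinTen.symPow 2 SpinTen.V₂)) ∧
        (∀ g : SpinTen.Spin,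
          TensorProduct.map (SpinTen.symLRep g).toLinearMap (SpinTen.symLRep g).toLinearMap
              (SpinTen.Ften (SpinTen.oppositePairs A B) c w₁ w₂) =
            SpinTen.Ften (SpinTen.oppositePairs A B) c w₁ w₂) ∧
        SpinTen.Fpoly (SpinTen.oppositePairs A B) c w₁ w₂ ∈
          SpinTen.symPow 4 (⊤ : Submodule ℂ SpinTen.LSeven) ∧
        SpinTen.Fpoly (SpinTen.oppositePairs A B) c w₁ w₂ ≠ 0 ∧
        ∀ g : SpinTen.Spin,
          SpinTen.symLRep g (SpinTen.Fpoly (SpinTen.oppositePairs A B) c w₁ w₂) =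
            SpinTen.Fpoly (SpinTen.oppositePairs A B) c w₁ w₂ := by
  refine ⟨SpinTen.exists_highest_V₁, SpinTen.exists_highest_V₂, ?_⟩
  -- One basis serves on both sides, the coefficients being the inverse of its Gram matrix.
  refine SpinTen.exists_isBasisSet.elim fun A hA => ⟨A, A, SpinTen.invCoeff A, ?_⟩
  refine ⟨⟨hA.independent, hA.span⟩, ?_⟩
  refine ⟨⟨hA.independent, hA.span⟩, ?_⟩
  refine ⟨⟨SpinTen.linearIndependent_opposite hA, SpinTen.span_opposite_eq hA⟩, ?_⟩
  intro w₁ hS₁ w₂ hS₂ hw₁ hw₂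
  exact SpinTen.Ften_Fpoly_invariant hA hS₁ hS₂ hw₁ hw₂
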